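/- Let $(E,d)$ be a locally compact separable metric space, $\mu$ a locally finite Borel measure on $E$ with full topological support, and $(\mathcal E,D(\mathcal E))$ a symmetric, regular, strongly local Dirichlet form on $L^2(E,\mu)$. For $1\le r<\infty$ let $(T^r_t)_{t\ge0}$ be the associated strongly continuous contraction semigroup on $L^r(E,\mu)$: $(T^2_t)$ is the semigroup whose generator is the operator of the form $\mathcal E$, and $T^r_tf=T^2_tf$ for $f\in L^1(E,\mu)\cap L^\infty(E,\mu)$. Let $(L_r,D(L_r))$ be its generator, and $\|u\|_{D(L_r)}=\|u\|_{L^r}+\|L_ru\|_{L^r}$. Let $1<p<\infty$ and let $E_1\subset E$ be a Borel set with $\mathrm{cap}_{\mathcal E}(E\setminus E_1)=0$ such that: (a) every $u\in D(L_p)$ has a continuous version $\widetilde u$ on $E_1$ (a continuous $\widetilde u:E_1\to\mathbb R$ with $\widetilde u=u$ $\mu$-a.e. on $E_1$), and each $x\in E_1$ has a neighbourhood $U$ in $E_1$ and a constant $C<\infty$ with $\sup_{y\in U}|\widetilde u(y)|\le C\|u\|_{D(L_p)}$ for all $u\in D(L_p)$; (b) for each $x\in E_1$ there is a sequence $(u_n)$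 in $D(L_p)$ such that either $u_n^2\in D(L_p)$ for all $n$, or $0\le \widetilde u_n\le1$ and $\widetilde u_n(x)=1$ for all $n$; and for every $y\in E_1$, $y\ne x$, there is an $n$ with $\widetilde u_n(y)=0$ and $\widetilde u_n(x)=1$. Then there are kernels $P_t(x,dy)$, $t\ge0$, from $E_1$ to $E$, with $P_0(x,\cdot)=\delta_x$, such that, writing $P_tf(x)=\int_E f(y)\,P_t(x,dy)$: (i) For all $x\in E_1$ and $t\ge0$, $P_t(x,E)\le1$ and $P_t(x,E\setminus E_1)=0$, so that $P_t$ may be regarded as a kernel on $E_1$. For every $t>0$ there is a Borel measurable $p_t:E_1\times E\to[0,\infty)$ with $P_t(x,dy)=p_t(x,y)\,\mu(dy)$ for all $x\in E_1$. For $t>0$ and $f\in\mathcal L^p(E,\mu)$, $f$ is $P_t(x,\cdot)$-integrable for every $x\in E_1$, and $P_tf$ is the unique continuous version on $E_1$ of $T^p_tf$. For $t>0$ and $x\in E_1$, $P_t(x,\cdot)$ is the only Borel measure on $E$ for which every $f\in\mathcal L^p(E,\mu)$ is integrable with integral $P_tf(x)$. (ii) $(P_t)_{t\ge0}$ is a semigroup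 of kernels on $E_1$, i.e. $P_{t+s}=P_tP_s$, and it is $\mathcal L^p$-strong Feller: $P_tf\in C(E_1)$ for all $t>0$ and $f\in\mathcal L^p(E,\mu)$. Moreover, for $f\in\mathcal L^p(E,\mu)$, $s,t\ge0$ and $x\in E_1$, $P_sf$ is $P_t(x,\cdot)$-integrable and $P_{t+s}f(x)=P_t(P_sf)(x)$. (iii) For all $s>0$, $f\in \mathcal L^p(E,\mu)$ and $x\in E_1$, $\lim_{t\downarrow0}P_{t+s}f(x)=P_sf(x)$. For all $u\in D(L_p)$ and $x\in E_1$, $\lim_{t\downarrow0}P_tu(x)=\widetilde u(x)$. (iv) For every bounded Borel function $f$ on $E$, and for every Borel function $f\in\mathcal L^p(E,\mu)$, the map $(t,x)\mapsto P_tf(x)$ is Borel measurable on $[0,\infty)\times E_1$. -/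

import Mathlib

open MeasureTheory ProbabilityTheory Filter Topology
open scoped NNReal ENNReal

noncomputable section

namespace FellerKernel

/-- A symmetric Dirichlet form on `L²(E, μ)`: a densely defined, symmetric, nonnegative, closed
bilinear form on which the unit contraction operates. -/
structure DirichletForm {E : Type*} [MeasurableSpace E] (μ : Measure E) where
  /-- the domain `D(𝓔)` -/
  domain : Submodule ℝ (Lp ℝ 2 μ)
  /-- the bilinear form -/
  form : domain →ₗ[ℝ] domain →ₗ[ℝ] ℝ
  dense_domain : Dense (domain : Set (Lp ℝ 2 μ))
  symm : ∀ u v, form u v = form v u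
  nonneg : ∀ u, 0 ≤ form u u
  /-- `D(𝓔)` is complete for the norm with square `𝓔(u, u) + ‖u‖²`. -/
  closed : ∀ u : ℕ → domain,
    (∀ ε > 0, ∃ N, ∀ m ≥ N, ∀ n ≥ N,
      form (u m - u n) (u m - u n) + ‖((u m - u n : domain) : Lp ℝ 2 μ)‖ ^ 2 < ε) →
    ∃ v : domain, Tendsto
      (fun n => form (u n - v) (u n - v) + ‖((u n - v : domain) : Lp ℝ 2 μ)‖ ^ 2) atTop (𝓝 0)
  /-- the unit contraction operates: `u⁺ ∧ 1 ∈ D(𝓔)` and its energy is at most that of `u` -/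
  markov : ∀ u : domain, ∃ v : domain,
    ((v : Lp ℝ 2 μ) : E → ℝ) =ᵐ[μ] (fun x => min (max ((u : Lp ℝ 2 μ) x) 0) 1) ∧
      form v v ≤ form u u

namespace DirichletForm

variable {E : Type*} [MeasurableSpace E] {μ : Measure E}

/-- `𝓔₁(u, u) = 𝓔(u, u) + ‖u‖²`, the square of the norm of the form domain. -/
def energy (𝓔 : DirichletForm μ) (u : 𝓔.domain) : ℝ :=
  𝓔.form u u + ‖(u : Lp ℝ 2 μ)‖ ^ 2

/-- Regularity: `D(𝓔) ∩ C_c(E)` is dense in `D(𝓔)` for the form norm and in `C_c(E)` for the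
uniform norm. -/
def IsRegular [TopologicalSpace E] (𝓔 : DirichletForm μ) : Prop :=
  (∀ u : 𝓔.domain, ∀ ε > 0, ∃ (v : 𝓔.domain) (h : E → ℝ),
    Continuous h ∧ HasCompactSupport h ∧ ((v : Lp ℝ 2 μ) : E → ℝ) =ᵐ[μ] h ∧
      𝓔.energy (u - v) < ε) ∧
  (∀ g : E → ℝ, Continuous g → HasCompactSupport g → ∀ ε > 0, ∃ (v : 𝓔.domain) (h : E → ℝ),
    Continuous h ∧ HasCompactSupport h ∧ ((v : Lp ℝ 2 μ) : E → ℝ) =ᵐ[μ] h ∧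
      ∀ x, |g x - h x| < ε)

/-- The support of (the measure `|u| μ` defined by) a `μ`-class `u`: the complement of the largest
open set on which `u = 0` almost everywhere. -/
def essSupport [TopologicalSpace E] (u : Lp ℝ 2 μ) : Set E :=
  {x | ∀ U : Set E, IsOpen U → x ∈ U → ¬ ∀ᵐ y ∂μ, y ∈ U → u y = 0}

/-- Strong locality: `𝓔(u, v) = 0` whenever `u, v ∈ D(𝓔)` have compact supports and `v` is
constant on a neighbourhood of the support of `u`. -/
def IsStronglyLocal [TopologicalSpace E] (𝓔 : DirichletForm μ) : Prop :=
  ∀ u v : 𝓔.domain, IsCompact (essSupport (u : Lp ℝ 2 μ)) → IsCompact (essSupport (v : Lp ℝ 2 μ)) →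
    (∃ V : Set E, IsOpen V ∧ essSupport (u : Lp ℝ 2 μ) ⊆ V ∧
      ∃ c : ℝ, ∀ᵐ y ∂μ, y ∈ V → (v : Lp ℝ 2 μ) y = c) →
    𝓔.form u v = 0

/-- The capacity of a set `A`: the infimum of `𝓔₁(u, u)` over all open `V ⊇ A` and all
`u ∈ D(𝓔)` with `u ≥ 1` almost everywhere on `V` (`∞` if there is no such `u`). -/
def cap [TopologicalSpace E] (𝓔 : DirichletForm μ) (A : Set E) : ℝ≥0∞ :=
  ⨅ (V : Set E) (_ : IsOpen V) (_ : A ⊆ V) (u : 𝓔.domain)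
    (_ : ∀ᵐ y ∂μ, y ∈ V → 1 ≤ (u : Lp ℝ 2 μ) y), ENNReal.ofReal (𝓔.energy u)

end DirichletForm

/-- A strongly continuous contraction semigroup on a Banach space. -/
structure IsContractionSemigroup {X : Type*} [NormedAddCommGroup X] [NormedSpace ℝ X]
    (T : ℝ≥0 → X →L[ℝ] X) : Prop where
  zero : T 0 = ContinuousLinearMap.id ℝ X
  add : ∀ s t, T (s + t) = (T s).comp (T t)
  contraction : ∀ t, ‖T t‖ ≤ 1
  continuous : ∀ f, Tendsto (fun t => T t f) (𝓝 0) (𝓝 f)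

/-- `IsGeneratorAt T u v` says that `u` lies in the domain of the generator `L` of the semigroup
`T`, and `L u = v`. -/
def IsGeneratorAt {X : Type*} [NormedAddCommGroup X] [NormedSpace ℝ X]
    (T : ℝ≥0 → X →L[ℝ] X) (u v : X) : Prop :=
  Tendsto (fun t : ℝ≥0 => (t : ℝ)⁻¹ • (T t u - u)) (𝓝[>] 0) (𝓝 v)

/-- The domain of the generator of a semigroup. -/
def generatorDomain {X : Type*} [NormedAddCommGroup X] [NormedSpace ℝ X]
    (T : ℝ≥0 → X →L[ℝ] X) : Set X :=
  {u | ∃ v, IsGeneratorAt T u v}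

variable {E : Type*} [MeasurableSpace E] {μ : Measure E}

/-- `T` is the semigroup on `L²(E, μ)` of the form `𝓔`: its generator `L` is the operator of the
form, i.e. `u ∈ D(L)` and `L u = f` iff `u ∈ D(𝓔)` and `𝓔(u, v) = -(f, v)` for all
`v ∈ D(𝓔)`. -/
def IsL2Semigroup (𝓔 : DirichletForm μ) (T : ℝ≥0 → Lp ℝ 2 μ →L[ℝ] Lp ℝ 2 μ) : Prop :=
  IsContractionSemigroup T ∧
    ∀ u f : Lp ℝ 2 μ, IsGeneratorAt T u f ↔
      ∃ hu : u ∈ 𝓔.domain, ∀ v : 𝓔.domain, 𝓔.form ⟨u, hu⟩ v = -inner ℝ f (v : Lp ℝ 2 μ)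

/-- The semigroup `(T²_t)` on `L²(E, μ)` associated with the form: the unique family satisfying
`IsL2Semigroup 𝓔`. -/
def l2Semigroup (𝓔 : DirichletForm μ) : ℝ≥0 → Lp ℝ 2 μ →L[ℝ] Lp ℝ 2 μ :=
  Classical.epsilon (IsL2Semigroup 𝓔)

/-- `T` is a strongly continuous contraction semigroup on `L^r(E, μ)` that agrees with `(T²_t)` on
`L¹ ∩ L^∞`. -/
def IsLrSemigroup (𝓔 : DirichletForm μ) (r : ℝ≥0∞) [Fact (1 ≤ r)]
    (T : ℝ≥0 → Lp ℝ r μ →L[ℝ] Lp ℝ r μ) : Prop :=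
  IsContractionSemigroup T ∧
    ∀ (t : ℝ≥0) (f : Lp ℝ r μ) (g : Lp ℝ 2 μ), (f : E → ℝ) =ᵐ[μ] (g : E → ℝ) →
      MemLp f 1 μ → MemLp f ∞ μ →
        (T t f : E → ℝ) =ᵐ[μ] (l2Semigroup 𝓔 t g : E → ℝ)

/-- The semigroup `(T^r_t)` on `L^r(E, μ)`, `1 ≤ r < ∞`, associated with the form: the unique
family satisfying `IsLrSemigroup 𝓔 r`. -/
def lrSemigroup (𝓔 : DirichletForm μ) (r : ℝ≥0∞) [Fact (1 ≤ r)] :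
    ℝ≥0 → Lp ℝ r μ →L[ℝ] Lp ℝ r μ :=
  Classical.epsilon (IsLrSemigroup 𝓔 r)

/-- `g` is a continuous version on `E₁` of the `μ`-class `u`. -/
def IsContVersion [TopologicalSpace E] {r : ℝ≥0∞} (E₁ : Set E) (u : Lp ℝ r μ) (g : E₁ → ℝ) :
    Prop :=
  Continuous g ∧ ∀ᵐ y ∂μ, ∀ hy : y ∈ E₁, g ⟨y, hy⟩ = u y

/-- The regularity condition on the set `E₁` and the domain `D(L_p)` of the generator of
`(T^p_t)`. -/
structure RegularityCondition [TopologicalSpace E] (𝓔 : DirichletForm μ) (p : ℝ≥0∞)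
    [Fact (1 ≤ p)] (E₁ : Set E) : Prop where
  cap_compl : 𝓔.cap E₁ᶜ = 0
  /-- every `u ∈ D(L_p)` has a continuous version on `E₁` -/
  exists_version : ∀ u ∈ generatorDomain (lrSemigroup 𝓔 p), ∃ g, IsContVersion E₁ u g
  /-- the embedding of `D(L_p)`, with the graph norm, into `C(E₁)` is locally continuous -/
  locally_continuous : ∀ x : E₁, ∃ U ∈ 𝓝 x, ∃ C : ℝ, ∀ u v : Lp ℝ p μ,
    IsGeneratorAt (lrSemigroup 𝓔 p) u v → ∀ g, IsContVersion E₁ u g →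
      ∀ y ∈ U, |g y| ≤ C * (‖u‖ + ‖v‖)
  /-- for each `x ∈ E₁` there is a sequence in `D(L_p)` that is point separating in `x` -/
  point_separating : ∀ x : E₁, ∃ (u : ℕ → Lp ℝ p μ) (g : ℕ → E₁ → ℝ),
    (∀ n, u n ∈ generatorDomain (lrSemigroup 𝓔 p) ∧ IsContVersion E₁ (u n) (g n)) ∧
    ((∀ n, ∃ w ∈ generatorDomain (lrSemigroup 𝓔 p), (w : E → ℝ) =ᵐ[μ] fun y => (u n y) ^ 2) ∨
      (∀ n, (∀ y, 0 ≤ g n y ∧ g n y ≤ 1) ∧ g n x = 1)) ∧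
    ∀ y, y ≠ x → ∃ n, g n y = 0 ∧ g n x = 1

/-- A kernel from `E₁` to `E`, regarded as a kernel on `E₁` (by restricting its measures to the
Borel sets contained in `E₁`). -/
def onSubset {E₁ : Set E} (hE₁ : MeasurableSet E₁) (κ : Kernel E₁ E) : Kernel E₁ E₁ :=
  κ.comapRight (MeasurableEmbedding.subtype_coe hE₁)

end FellerKernel

end

noncomputable section

namespace FellerKernel

/-! ### Hille–Yosida: from a resolvent family to a contraction semigroup -/

section Semigroups

open NormedSpace

variable {X : Type*} [NormedAddCommGroup X] [NormedSpace ℝ X]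

/-! The heart of the matter is that the semigroup on `L^p`, `1 < p < ∞`, is analytic. Hence for `t >
0` it maps `L^p` boundedly into `D(L_p)` with the graph norm. The regularity condition then gives
every `T_t f` a continuous version on `E₁`, and makes evaluation at a point `x` a bounded functional
`ℓ t x` on `L^p` (`exists_isPointFunctional`). Sub-Markovianity of `T_t` holds almost everywhere,
hence everywhere on `E₁` by continuity and full support, so `ℓ t x` is positive and at most `1` on
indicator functions. Such a functional is integration against a sub-probability measure absolutely
continuous with respect to `μ` (`exists_measure_of_nonneg`, `integral_eq_apply`); this measure is `P
t x`. At time zero the kernel is set to be the Dirac kernel.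

The remaining claims follow from the factorisation `ℓ (t + s) x = ℓ t x ∘ T_s` for `t > 0`
(`IsPointFunctional.add_apply`): it yields Chapman–Kolmogorov, and, by strong continuity on `L^p`,
continuity in time. Joint measurability is the Carathéodory argument (continuous in `t > 0`,
measurable in `x`). Convergence to the continuous version of `u ∈ D(L_p)` as time tends to zero
holds because `T_t u` tends to `u` in the graph norm.

The semigroups are defined by a choice operator, so their existence and uniqueness have to be
established as well. On `L²`, the resolvents come from Riesz representation in the form domain and
the semigroup from their Yosida approximations (`l2Semigroup_eq`). These are exponentials of `c (S -
1)`, where `S = a (a - L)⁻¹` is a symmetric sub-Markov contraction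
(`isSymmSubMarkov_smul_resolvent`).

Analyticity is obtained by Stein interpolation at the level of these bounded approximations. Tested
against two simple functions, `exp (ζ c (S - 1))` gives a finite sum of entire functions of `ζ`. It
is controlled by `L¹` norms for `ζ ≥ 0` and by `L²` norms for `Re ζ ≥ 0`. The three lines theorem
gives the `L^p` bound on a sector (`norm_sum_le_of_interpolation`), and Cauchy's estimates turn this
into bounds on increments and difference quotients in time. The constants do not depend on the
approximation, so the bounds survive the limit (`analyticBounds_of_le_two`); symmetry of the
semigroup transfers them to `p ≥ 2`, and the converse of Hölder's inequality turns them into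
operator bounds on `L^p`. -/

theorem exp_smul_sub_one [CompleteSpace X] (S : X →L[ℝ] X) (r : ℝ) :
    exp (r • (S - 1)) = Real.exp (-r) • exp (r • S) := by
  let _ : NormedAlgebra ℚ (X →L[ℝ] X) := NormedAlgebra.restrictScalars ℚ ℝ _
  have h : r • (S - 1) = r • S + algebraMap ℝ (X →L[ℝ] X) (-r) := by
    rw [Algebra.algebraMap_eq_smul_one, smul_sub, neg_smul, sub_eq_add_neg]
  rw [h, exp_add_of_commute (Algebra.commute_algebraMap_right _ _), ← algebraMap_exp_comm,
    ← Real.exp_eq_exp_ℝ, Algebra.algebraMap_eq_smul_one, mul_smul_comm, mul_one]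

/-- The exponential of `r (S - 1)` is a limit of subconvex combinations of the powers of `S`. -/
theorem exp_smul_sub_one_mem [CompleteSpace X] {S : X →L[ℝ] X} {C : Set X} (hC : Convex ℝ C)
    (hcl : IsClosed C) (h0 : (0 : X) ∈ C) (hS : ∀ f ∈ C, S f ∈ C) {r : ℝ} (hr : 0 ≤ r) {f : X}
    (hf : f ∈ C) : exp (r • (S - 1)) f ∈ C := by
  rw [exp_smul_sub_one]
  have hpow : ∀ n : ℕ, (S ^ n) f ∈ C := by
    intro n
    induction n with
    | zero => simpa using hf
    | succ n ih => rw [pow_succ']; exact hS _ ih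
  set w : ℕ → ℝ := fun n => Real.exp (-r) * ((n.factorial : ℝ)⁻¹ * r ^ n) with hw
  have hw0 : ∀ n, 0 ≤ w n := fun n => by positivity
  have h1 : HasSum (fun n : ℕ => w n • (S ^ n) f) ((Real.exp (-r) • exp (r • S)) f) := by
    have := (exp_series_hasSum_exp' (𝕂 := ℝ) (r • S)).mapL (ContinuousLinearMap.apply ℝ X f)
    have := this.const_smul (Real.exp (-r))
    simpa [hw, smul_smul, smul_pow, mul_assoc] using this
  have h2 : HasSum w 1 := by
    have := (exp_series_hasSum_exp' (𝕂 := ℝ) r).mul_left (Real.exp (-r))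
    rw [← Real.exp_eq_exp_ℝ, ← Real.exp_add, neg_add_cancel, Real.exp_zero] at this
    simpa [hw] using this
  refine hcl.mem_of_tendsto h1 (Eventually.of_forall fun s => ?_)
  have hs1 : ∑ n ∈ s, w n ≤ 1 := sum_le_hasSum s (fun n _ => hw0 n) h2
  rcases (Finset.sum_nonneg fun n (_ : n ∈ s) => hw0 n).eq_or_lt with h | h
  · have : ∀ n ∈ s, w n = 0 := (Finset.sum_eq_zero_iff_of_nonneg fun n _ => hw0 n).1 h.symm
    rw [Finset.sum_eq_zero fun n hn => by rw [this n hn, zero_smul]]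
    exact h0
  · have hm := hC.centerMass_mem (t := s) (fun n _ => hw0 n) h (fun n _ => hpow n)
    have := hC.smul_mem_of_zero_mem h0 hm (t := ∑ n ∈ s, w n) ⟨h.le, hs1⟩
    rwa [Finset.centerMass, smul_smul, mul_inv_cancel₀ h.ne', one_smul] at this

/-- A contraction preserves the closed ball of radius `‖f‖`, which is a closed convex set containing
`0`. -/
theorem norm_exp_smul_sub_one_apply_le [CompleteSpace X] {S : X →L[ℝ] X} (hS : ‖S‖ ≤ 1) {r : ℝ}
    (hr : 0 ≤ r) (f : X) : ‖exp (r • (S - 1)) f‖ ≤ ‖f‖ := by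
  have := exp_smul_sub_one_mem (S := S) (convex_closedBall (0 : X) ‖f‖) Metric.isClosed_closedBall
    (by simp) (fun g hg => by
      rw [mem_closedBall_zero_iff] at hg ⊢
      exact (S.le_of_opNorm_le hS g).trans (by simpa using hg)) hr (f := f) (by simp)
  simpa using this

/-- A family of resolvents `G λ = (λ - L)⁻¹`, `λ > 0`, of a contraction semigroup. -/
structure IsResolventFamily (G : ℝ → X →L[ℝ] X) : Prop where
  resolvent_eq : ∀ a b, 0 < a → 0 < b → G a = G b + (b - a) • (G a * G b)
  contraction : ∀ a, 0 < a → ‖a • G a‖ ≤ 1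
  dense : DenseRange (G 1)

/-- The Yosida approximation of the generator of the semigroup with resolvents `G`. -/
def yosida (G : ℝ → X →L[ℝ] X) (n : ℕ) : X →L[ℝ] X :=
  ((n : ℝ) + 1) • (((n : ℝ) + 1) • G ((n : ℝ) + 1) - 1)

theorem smul_yosida (G : ℝ → X →L[ℝ] X) (n : ℕ) (t : ℝ) :
    t • yosida G n = (t * ((n : ℝ) + 1)) • (((n : ℝ) + 1) • G ((n : ℝ) + 1) - 1) := by
  rw [yosida, smul_smul]

namespace IsResolventFamily

variable {G : ℝ → X →L[ℝ] X}

/-- Interchanging `a` and `b` in the resolvent equation changes the sign of both the difference and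
the factor, so the two products must agree. -/
theorem commute (hG : IsResolventFamily G) {a b : ℝ} (ha : 0 < a) (hb : 0 < b) :
    Commute (G a) (G b) := by
  rcases eq_or_ne a b with rfl | hab
  · exact Commute.refl _
  have h1 := hG.resolvent_eq a b ha hb
  have h2 := hG.resolvent_eq b a hb ha
  have h3 : (b - a) • (G a * G b) = (b - a) • (G b * G a) := by
    rw [← sub_eq_iff_eq_add'.2 h1, ← neg_sub a b, neg_smul, ← sub_eq_iff_eq_add'.2 h2, neg_sub]
  exact smul_right_injective _ (sub_ne_zero.2 hab.symm) h3

theorem commute_yosida (hG : IsResolventFamily G) (m n : ℕ) :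
    Commute (yosida G m) (yosida G n) := by
  have h := hG.commute (a := (m : ℝ) + 1) (b := (n : ℝ) + 1) (by positivity) (by positivity)
  unfold yosida
  refine Commute.smul_left (Commute.smul_right ?_ _) _
  refine Commute.sub_left (Commute.sub_right (Commute.smul_left (Commute.smul_right h _) _)
    (Commute.one_right _)) (Commute.one_left _)

theorem norm_exp_apply_le [CompleteSpace X] (hG : IsResolventFamily G) (n : ℕ) {t : ℝ}
    (ht : 0 ≤ t) (f : X) : ‖exp (t • yosida G n) f‖ ≤ ‖f‖ := by
  rw [smul_yosida]
  exact norm_exp_smul_sub_one_apply_le (hG.contraction _ (by positivity)) (by positivity) f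

/-- The Yosida approximation converges on the domain `G 1 h` of the generator, as
`(n + 1) G (n + 1)` tends to the identity. -/
theorem yosida_apply (hG : IsResolventFamily G) (n : ℕ) (h : X) :
    yosida G n (G 1 h) = ((n : ℝ) + 1) • G ((n : ℝ) + 1) (G 1 h - h) := by
  have h1 : G ((n : ℝ) + 1) h = G 1 h + (1 - ((n : ℝ) + 1)) • G ((n : ℝ) + 1) (G 1 h) :=
    congrArg (fun A : X →L[ℝ] X => A h)
      (hG.resolvent_eq ((n : ℝ) + 1) 1 (by positivity) one_pos)
  change ((n : ℝ) + 1) • (((n : ℝ) + 1) • G ((n : ℝ) + 1) (G 1 h) - G 1 h) = _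
  rw [map_sub, h1]
  module

/-- On the range of `G 1` the error is `O(1 / n)`, because `n + 1` times the error is the bounded
vector of `yosida_apply`. Density of this range and the uniform bound extend the convergence to all
of `X`. -/
theorem tendsto_smul_apply (hG : IsResolventFamily G) (f : X) :
    Tendsto (fun n : ℕ => ((n : ℝ) + 1) • G ((n : ℝ) + 1) f) atTop (𝓝 f) := by
  have hc : ∀ n : ℕ, ‖((n : ℝ) + 1) • G ((n : ℝ) + 1)‖ ≤ 1 :=
    fun n => hG.contraction _ (by positivity)
  have hcore : ∀ h, Tendsto (fun n : ℕ => ((n : ℝ) + 1) • G ((n : ℝ) + 1) (G 1 h)) atTop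
      (𝓝 (G 1 h)) := by
    intro h
    rw [tendsto_iff_norm_sub_tendsto_zero]
    refine squeeze_zero (fun _ => norm_nonneg _) (g := fun n : ℕ => 1 / ((n : ℝ) + 1) * ‖G 1 h - h‖)
      (fun n => ?_) (by simpa using tendsto_one_div_add_atTop_nhds_zero_nat.mul_const ‖G 1 h - h‖)
    have hp : (0 : ℝ) < (n : ℝ) + 1 := by positivity
    have h1 : ((n : ℝ) + 1) • (((n : ℝ) + 1) • G ((n : ℝ) + 1) (G 1 h) - G 1 h)
        = ((n : ℝ) + 1) • G ((n : ℝ) + 1) (G 1 h - h) := hG.yosida_apply n h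
    have h2 : ‖((n : ℝ) + 1) • G ((n : ℝ) + 1) (G 1 h - h)‖ ≤ ‖G 1 h - h‖ := by
      simpa using ContinuousLinearMap.le_of_opNorm_le _ (hc n) (G 1 h - h)
    rw [← h1, norm_smul, Real.norm_of_nonneg hp.le] at h2
    rw [one_div_mul_eq_div, le_div_iff₀ hp, mul_comm]
    exact h2
  rw [Metric.tendsto_atTop]
  intro ε hε
  obtain ⟨h, hh⟩ := hG.dense.exists_dist_lt f (show (0 : ℝ) < ε / 3 by positivity)
  obtain ⟨N, hN⟩ := Metric.tendsto_atTop.1 (hcore h) (ε / 3) (by positivity)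
  refine ⟨N, fun n hn => ?_⟩
  have h1 : dist (((n : ℝ) + 1) • G ((n : ℝ) + 1) f) (((n : ℝ) + 1) • G ((n : ℝ) + 1) (G 1 h))
      ≤ dist f (G 1 h) := by
    rw [dist_eq_norm, dist_eq_norm, ← smul_sub, ← map_sub]
    simpa using ContinuousLinearMap.le_of_opNorm_le _ (hc n) (f - G 1 h)
  have h2 := hN n hn
  have h3 := dist_triangle4 (((n : ℝ) + 1) • G ((n : ℝ) + 1) f)
    (((n : ℝ) + 1) • G ((n : ℝ) + 1) (G 1 h)) (G 1 h) f
  rw [dist_comm (G 1 h) f] at h3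
  linarith

theorem tendsto_yosida (hG : IsResolventFamily G) (h : X) :
    Tendsto (fun n => yosida G n (G 1 h)) atTop (𝓝 (G 1 h - h)) := by
  simp_rw [hG.yosida_apply]
  exact hG.tendsto_smul_apply _

theorem norm_yosida_le (hG : IsResolventFamily G) (n : ℕ) (h : X) :
    ‖yosida G n (G 1 h)‖ ≤ ‖G 1 h - h‖ := by
  rw [hG.yosida_apply]
  simpa using ContinuousLinearMap.le_of_opNorm_le _
    (hG.contraction ((n : ℝ) + 1) (by positivity)) (G 1 h - h)

/-- The path `s ↦ exp (s A) exp ((t - s) B) f` joins the two vectors. As `A` and `B` commute, its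
derivative is two contractions applied to `A f - B f`. -/
theorem norm_exp_sub_exp_le [CompleteSpace X] (hG : IsResolventFamily G) (m n : ℕ) {t : ℝ}
    (ht : 0 ≤ t) (f : X) :
    ‖exp (t • yosida G m) f - exp (t • yosida G n) f‖ ≤ t * ‖yosida G m f - yosida G n f‖ := by
  let _ : NormedAlgebra ℚ (X →L[ℝ] X) := NormedAlgebra.restrictScalars ℚ ℝ _
  set A := yosida G m
  set B := yosida G n
  have hAB : Commute A B := hG.commute_yosida m n
  have hder : ∀ s : ℝ, HasDerivAt (fun s : ℝ => exp (s • A) (exp ((t - s) • B) f))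
      (exp (s • A) (exp ((t - s) • B) (A f - B f))) s := by
    intro s
    have h1 := hasDerivAt_exp_smul_const (𝕂 := ℝ) A s
    have h2 : HasDerivAt (fun s : ℝ => exp ((t - s) • B)) (-(exp ((t - s) • B) * B)) s := by
      have := (hasDerivAt_exp_smul_const (𝕂 := ℝ) B (t - s)).scomp s
        ((hasDerivAt_id s).const_sub t)
      simpa [Function.comp_def] using this
    have h3 := (h1.mul h2).clm_apply (hasDerivAt_const s f)
    refine h3.congr_deriv ?_
    have hc : exp ((t - s) • B) * A = A * exp ((t - s) • B) :=
      ((hAB.symm.smul_left (t - s)).exp_left).eq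
    rw [mul_assoc, ← hc]
    simp [sub_eq_add_neg]
  have h := norm_image_sub_le_of_norm_deriv_le_segment' (a := 0) (b := t) (C := ‖A f - B f‖)
    (fun s _ => (hder s).hasDerivWithinAt) (fun s hs => ?_) t ⟨ht, le_rfl⟩
  · simpa [mul_comm] using h
  · exact (hG.norm_exp_apply_le m hs.1 _).trans (hG.norm_exp_apply_le n (by linarith [hs.2]) _)

theorem cauchySeq_exp [CompleteSpace X] (hG : IsResolventFamily G) (t : ℝ≥0) (f : X) :
    CauchySeq fun n => exp ((t : ℝ) • yosida G n) f := by
  rw [Metric.cauchySeq_iff]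
  intro ε hε
  obtain ⟨h, hh⟩ := hG.dense.exists_dist_lt f (show (0 : ℝ) < ε / 3 by positivity)
  obtain ⟨N, hN⟩ := Metric.cauchySeq_iff.1 (hG.tendsto_yosida h).cauchySeq (ε / 3 / (t + 1))
    (by positivity)
  refine ⟨N, fun m hm n hn => ?_⟩
  have hd : ∀ k, dist (exp ((t : ℝ) • yosida G k) f) (exp ((t : ℝ) • yosida G k) (G 1 h))
      ≤ dist f (G 1 h) := fun k => by
    rw [dist_eq_norm, dist_eq_norm, ← map_sub]
    exact hG.norm_exp_apply_le k t.coe_nonneg _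
  have h2 : dist (exp ((t : ℝ) • yosida G m) (G 1 h)) (exp ((t : ℝ) • yosida G n) (G 1 h))
      < ε / 3 := by
    rw [dist_eq_norm]
    refine (hG.norm_exp_sub_exp_le m n t.coe_nonneg _).trans_lt ?_
    have := hN m hm n hn
    rw [dist_eq_norm, lt_div_iff₀ (by positivity)] at this
    have h0 := norm_nonneg (yosida G m (G 1 h) - yosida G n (G 1 h))
    linarith
  have h3 := dist_triangle4 (exp ((t : ℝ) • yosida G m) f) (exp ((t : ℝ) • yosida G m) (G 1 h))
    (exp ((t : ℝ) • yosida G n) (G 1 h)) (exp ((t : ℝ) • yosida G n) f)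
  have h4 := hd n
  rw [dist_comm] at h4
  linarith [hd m]

/-- The semigroup with resolvents `G`. -/
def semigroup [CompleteSpace X] (hG : IsResolventFamily G) (t : ℝ≥0) : X →L[ℝ] X :=
  continuousLinearMapOfTendsto (l := atTop) (fun n => exp ((t : ℝ) • yosida G n))
    (f := fun f => (cauchySeq_tendsto_of_complete (hG.cauchySeq_exp t f)).choose)
    (tendsto_pi_nhds.2 fun f => (cauchySeq_tendsto_of_complete (hG.cauchySeq_exp t f)).choose_spec)

variable [CompleteSpace X]

theorem tendsto_semigroup (hG : IsResolventFamily G) (t : ℝ≥0) (f : X) :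
    Tendsto (fun n => exp ((t : ℝ) • yosida G n) f) atTop (𝓝 (hG.semigroup t f)) :=
  (cauchySeq_tendsto_of_complete (hG.cauchySeq_exp t f)).choose_spec

theorem norm_semigroup_apply_le (hG : IsResolventFamily G) (t : ℝ≥0) (f : X) :
    ‖hG.semigroup t f‖ ≤ ‖f‖ :=
  le_of_tendsto (hG.tendsto_semigroup t f).norm
    (Eventually.of_forall fun n => hG.norm_exp_apply_le n t.coe_nonneg f)

theorem norm_exp_sub_self_le (hG : IsResolventFamily G) (n : ℕ) {t : ℝ} (ht : 0 ≤ t) (f : X) :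
    ‖exp (t • yosida G n) f - f‖ ≤ t * ‖yosida G n f‖ := by
  have h := norm_image_sub_le_of_norm_deriv_le_segment' (a := 0) (b := t) (C := ‖yosida G n f‖)
    (f := fun s : ℝ => exp (s • yosida G n) f)
    (fun s _ => ((hasDerivAt_exp_smul_const (𝕂 := ℝ) (yosida G n) s).clm_apply
      (hasDerivAt_const s f)).hasDerivWithinAt) (fun s hs => ?_) t ⟨ht, le_rfl⟩
  · simpa [mul_comm] using h
  · simpa using hG.norm_exp_apply_le n hs.1 (yosida G n f)

theorem norm_semigroup_sub_le (hG : IsResolventFamily G) (t : ℝ≥0) (h : X) :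
    ‖hG.semigroup t (G 1 h) - G 1 h‖ ≤ t * ‖G 1 h - h‖ :=
  le_of_tendsto ((hG.tendsto_semigroup t _).sub_const _).norm
    (Eventually.of_forall fun n => (hG.norm_exp_sub_self_le n t.coe_nonneg _).trans
      (mul_le_mul_of_nonneg_left (hG.norm_yosida_le n h) t.coe_nonneg))

theorem isContractionSemigroup_semigroup (hG : IsResolventFamily G) :
    IsContractionSemigroup hG.semigroup where
  zero := by
    ext f
    refine tendsto_nhds_unique (hG.tendsto_semigroup 0 f) ?_
    simp [exp_zero]
  add s t := by
    let _ : NormedAlgebra ℚ (X →L[ℝ] X) := NormedAlgebra.restrictScalars ℚ ℝ _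
    ext f
    refine tendsto_nhds_unique (hG.tendsto_semigroup (s + t) f) ?_
    have h1 := hG.tendsto_semigroup s (hG.semigroup t f)
    have h2 : Tendsto (fun n => exp ((s : ℝ) • yosida G n)
        (exp ((t : ℝ) • yosida G n) f - hG.semigroup t f)) atTop (𝓝 0) := by
      refine squeeze_zero_norm (fun n => hG.norm_exp_apply_le n s.coe_nonneg _) ?_
      simpa using ((hG.tendsto_semigroup t f).sub_const (hG.semigroup t f)).norm
    have h3 := h2.add h1
    simp only [map_sub, sub_add_cancel, zero_add] at h3
    refine h3.congr fun n => ?_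
    rw [NNReal.coe_add, add_smul, exp_add_of_commute
      (((Commute.refl (yosida G n)).smul_left _).smul_right _)]
    rfl
  contraction t := ContinuousLinearMap.opNorm_le_bound _ zero_le_one
    fun f => by simpa using hG.norm_semigroup_apply_le t f
  continuous f := by
    rw [Metric.tendsto_nhds]
    intro ε hε
    obtain ⟨h, hh⟩ := hG.dense.exists_dist_lt f (show (0 : ℝ) < ε / 3 by positivity)
    have h0 : Tendsto (fun t : ℝ≥0 => (t : ℝ) * ‖G 1 h - h‖) (𝓝 0) (𝓝 0) := by
      have : Continuous fun t : ℝ≥0 => (t : ℝ) * ‖G 1 h - h‖ := by fun_prop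
      simpa using this.tendsto 0
    filter_upwards [h0.eventually (gt_mem_nhds (show (0 : ℝ) < ε / 3 by positivity))] with t ht
    have h1 := (hG.norm_semigroup_sub_le t h).trans_lt ht
    have h2 : dist (hG.semigroup t f) (hG.semigroup t (G 1 h)) ≤ dist f (G 1 h) := by
      rw [dist_eq_norm, dist_eq_norm, ← map_sub]
      exact hG.norm_semigroup_apply_le t _
    rw [← dist_eq_norm] at h1
    have h3 := dist_triangle4 (hG.semigroup t f) (hG.semigroup t (G 1 h)) (G 1 h) f
    rw [dist_comm (G 1 h) f] at h3
    linarith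

/-- A quantitative form of differentiability at time zero. The expected derivative `G 1 h - h` need
not lie in the range of `G 1`; `G 1 k` is a nearby element that does, and the approximating
semigroups move it by at most `t * ‖G 1 k - k‖` up to time `t`. -/
theorem norm_semigroup_sub_sub_le (hG : IsResolventFamily G) (t : ℝ≥0) (h k : X) :
    ‖hG.semigroup t (G 1 h) - G 1 h - (t : ℝ) • (G 1 h - h)‖
      ≤ t * (2 * ‖G 1 h - h - G 1 k‖ + t * ‖G 1 k - k‖) := by
  have key : ∀ n, ‖exp ((t : ℝ) • yosida G n) (G 1 h) - G 1 h - (t : ℝ) • (G 1 h - h)‖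
      ≤ t * (‖yosida G n (G 1 h) - (G 1 h - h)‖ + (2 * ‖G 1 h - h - G 1 k‖ + t * ‖G 1 k - k‖)) := by
    intro n
    have hd := norm_image_sub_le_of_norm_deriv_le_segment' (a := 0) (b := (t : ℝ))
      (C := ‖yosida G n (G 1 h) - (G 1 h - h)‖ + (2 * ‖G 1 h - h - G 1 k‖ + t * ‖G 1 k - k‖))
      (f := fun s : ℝ => exp (s • yosida G n) (G 1 h) - s • (G 1 h - h))
      (f' := fun s : ℝ => exp (s • yosida G n) (yosida G n (G 1 h)) - (G 1 h - h))
      (fun s _ => ?_) (fun s hs => ?_) t ⟨t.coe_nonneg, le_rfl⟩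
    · have : exp ((t : ℝ) • yosida G n) (G 1 h) - G 1 h - (t : ℝ) • (G 1 h - h)
        = exp ((t : ℝ) • yosida G n) (G 1 h) - (t : ℝ) • (G 1 h - h)
          - (exp ((0 : ℝ) • yosida G n) (G 1 h) - (0 : ℝ) • (G 1 h - h)) := by
        simp only [zero_smul, exp_zero, one_apply_eq_self]
        abel
      rw [this, mul_comm]
      simpa using hd
    · have h1 := ((hasDerivAt_exp_smul_const (𝕂 := ℝ) (yosida G n) s).clm_apply
        (hasDerivAt_const s (G 1 h))).sub ((hasDerivAt_id s).smul_const (G 1 h - h))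
      refine (h1.congr_deriv ?_).hasDerivWithinAt
      simp
    · set A := G 1 h - h
      set e := exp (s • yosida G n)
      have hs0 : 0 ≤ s := hs.1
      have e1 : e (yosida G n (G 1 h)) - A = e (yosida G n (G 1 h) - A) + e (A - G 1 k)
          + (e (G 1 k) - G 1 k) + (G 1 k - A) := by
        simp only [map_sub]
        abel
      have n1 := hG.norm_exp_apply_le n hs0 (yosida G n (G 1 h) - A)
      have n2 := hG.norm_exp_apply_le n hs0 (A - G 1 k)
      have n3 := (hG.norm_exp_sub_self_le n hs0 (G 1 k)).trans
        (mul_le_mul hs.2.le (hG.norm_yosida_le n k) (norm_nonneg _) t.coe_nonneg)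
      have n4 := norm_sub_rev (G 1 k) A
      rw [e1]
      refine (norm_add₄_le).trans ?_
      linarith
  have hlim := (((hG.tendsto_yosida h).sub_const (G 1 h - h)).norm.add_const
    (2 * ‖G 1 h - h - G 1 k‖ + t * ‖G 1 k - k‖)).const_mul (t : ℝ)
  simp only [sub_self, norm_zero, zero_add] at hlim
  exact le_of_tendsto_of_tendsto (((hG.tendsto_semigroup t _).sub_const _).sub_const _).norm hlim
    (Eventually.of_forall key)

theorem isGeneratorAt_semigroup (hG : IsResolventFamily G) (h : X) :
    IsGeneratorAt hG.semigroup (G 1 h) (G 1 h - h) := by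
  rw [IsGeneratorAt, Metric.tendsto_nhds]
  intro ε hε
  obtain ⟨k, hk⟩ := hG.dense.exists_dist_lt (G 1 h - h) (show (0 : ℝ) < ε / 4 by positivity)
  have h0 : Tendsto (fun t : ℝ≥0 => (t : ℝ) * ‖G 1 k - k‖) (𝓝 0) (𝓝 0) := by
    have : Continuous fun t : ℝ≥0 => (t : ℝ) * ‖G 1 k - k‖ := by fun_prop
    simpa using this.tendsto 0
  filter_upwards [nhdsWithin_le_nhds (h0.eventually
    (gt_mem_nhds (show (0 : ℝ) < ε / 2 by positivity))), self_mem_nhdsWithin] with t ht ht0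
  have ht0' : (0 : ℝ) < t := ht0
  have h1 := hG.norm_semigroup_sub_sub_le t h k
  have h2 : (t : ℝ)⁻¹ • (hG.semigroup t (G 1 h) - G 1 h) - (G 1 h - h)
      = (t : ℝ)⁻¹ • (hG.semigroup t (G 1 h) - G 1 h - (t : ℝ) • (G 1 h - h)) := by
    rw [smul_sub _ _ ((t : ℝ) • _), smul_smul, inv_mul_cancel₀ ht0'.ne', one_smul]
  rw [dist_eq_norm, h2, norm_smul, norm_inv, Real.norm_of_nonneg ht0'.le, inv_mul_lt_iff₀ ht0']
  refine h1.trans_lt (mul_lt_mul_of_pos_left ?_ ht0')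
  rw [dist_eq_norm] at hk
  linarith

end IsResolventFamily

theorem IsContractionSemigroup.norm_apply_le {T : ℝ≥0 → X →L[ℝ] X} (hT : IsContractionSemigroup T)
    (t : ℝ≥0) (f : X) : ‖T t f‖ ≤ ‖f‖ := by
  simpa using (T t).le_of_opNorm_le (hT.contraction t) f

/-- The number `1` is not an eigenvalue of the generator: contractivity gives `‖T t z - (1 + t) z‖ ≥
t ‖z‖`, while the difference quotient minus `z` tends to zero. -/
theorem IsContractionSemigroup.eq_zero_of_isGeneratorAt_self {T : ℝ≥0 → X →L[ℝ] X}
    (hT : IsContractionSemigroup T) {z : X} (hz : IsGeneratorAt T z z) : z = 0 := by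
  have h1 : ∀ᶠ t : ℝ≥0 in 𝓝[>] 0, ‖z‖ ≤ ‖(t : ℝ)⁻¹ • (T t z - z) - z‖ := by
    filter_upwards [self_mem_nhdsWithin] with t ht
    have ht' : (0 : ℝ) < t := ht
    have e : (t : ℝ)⁻¹ • (T t z - z) - z = (t : ℝ)⁻¹ • (T t z - (1 + t : ℝ) • z) := by
      rw [add_smul, one_smul, smul_sub, smul_sub, smul_add, smul_smul, inv_mul_cancel₀ ht'.ne']
      module
    rw [e, norm_smul, norm_inv, Real.norm_of_nonneg ht'.le, le_inv_mul_iff₀ ht']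
    have h2 := norm_sub_norm_le ((1 + t : ℝ) • z) (T t z)
    rw [norm_sub_rev, norm_smul, Real.norm_of_nonneg (by positivity)] at h2
    linarith [hT.norm_apply_le t z]
  have h2 := ge_of_tendsto (hz.sub_const z).norm h1
  simpa using h2

theorem IsGeneratorAt.sub {T : ℝ≥0 → X →L[ℝ] X} {u v u' v' : X} (h : IsGeneratorAt T u v)
    (h' : IsGeneratorAt T u' v') : IsGeneratorAt T (u - u') (v - v') := by
  refine (Tendsto.sub h h').congr fun t => ?_
  rw [← smul_sub, map_sub]
  congr 1
  abel

/-- The domain of the generator is no larger than the range of `G 1`: for `u` in the domain, `u - G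
1 (u - f)` would be an eigenvector for the eigenvalue `1`, hence it vanishes. -/
theorem IsResolventFamily.isGeneratorAt_iff [CompleteSpace X] {G : ℝ → X →L[ℝ] X}
    (hG : IsResolventFamily G) (u f : X) :
    IsGeneratorAt hG.semigroup u f ↔ G 1 (u - f) = u := by
  constructor
  · intro h
    have h1 := h.sub (hG.isGeneratorAt_semigroup (u - f))
    have h2 : f - (G 1 (u - f) - (u - f)) = u - G 1 (u - f) := by abel
    rw [h2] at h1
    exact (sub_eq_zero.1 (hG.isContractionSemigroup_semigroup.eq_zero_of_isGeneratorAt_self h1)).symm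
  · intro h
    have h1 := hG.isGeneratorAt_semigroup (u - f)
    rw [h] at h1
    simpa using h1

end Semigroups

/-! ### Continuity and right derivatives of orbits -/

section Orbits

variable {X : Type*} [NormedAddCommGroup X] [NormedSpace ℝ X] {T : ℝ≥0 → X →L[ℝ] X}

theorem IsContractionSemigroup.add_apply (hT : IsContractionSemigroup T) (s t : ℝ≥0) (f : X) :
    T (s + t) f = T s (T t f) := by
  rw [hT.add]; rfl

theorem IsContractionSemigroup.comm_apply (hT : IsContractionSemigroup T) (s t : ℝ≥0) (f : X) :
    T s (T t f) = T t (T s f) := by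
  rw [← hT.add_apply, add_comm, hT.add_apply]

theorem IsContractionSemigroup.zero_apply (hT : IsContractionSemigroup T) (f : X) :
    T 0 f = f := by
  rw [hT.zero]; rfl

theorem IsContractionSemigroup.continuous_orbit (hT : IsContractionSemigroup T) (f : X) :
    Continuous fun t => T t f := by
  rw [continuous_iff_continuousAt]
  intro s
  rw [ContinuousAt, tendsto_iff_norm_sub_tendsto_zero]
  -- With truncated subtraction this sum is the distance of `t` and `s`: one of the summands is
  -- zero.
  have hd : Tendsto (fun t : ℝ≥0 => (t - s) + (s - t)) (𝓝 s) (𝓝 0) := by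
    have : Continuous fun t : ℝ≥0 => (t - s) + (s - t) := by fun_prop
    simpa using this.tendsto s
  refine squeeze_zero (fun _ => norm_nonneg _) (g := fun t => ‖T ((t - s) + (s - t)) f - f‖)
    (fun t => ?_) ?_
  · rcases le_total s t with h | h
    · have h1 : T t f - T s f = T s (T (t - s) f - f) := by
        rw [map_sub, ← hT.add_apply, add_tsub_cancel_of_le h]
      rw [h1, tsub_eq_zero_of_le h, add_zero]
      exact hT.norm_apply_le _ _
    · have h1 : T s f - T t f = T t (T (s - t) f - f) := by
        rw [map_sub, ← hT.add_apply, add_tsub_cancel_of_le h]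
      rw [norm_sub_rev, h1, tsub_eq_zero_of_le h, zero_add]
      exact hT.norm_apply_le _ _
  · simpa using (((hT.continuous f).comp hd).sub_const f).norm

theorem IsContractionSemigroup.isGeneratorAt_apply (hT : IsContractionSemigroup T) {u v : X}
    (h : IsGeneratorAt T u v) (s : ℝ≥0) : IsGeneratorAt T (T s u) (T s v) := by
  refine (((T s).continuous.tendsto v).comp h).congr fun t => ?_
  simp only [Function.comp_apply, map_smul, map_sub]
  rw [hT.comm_apply]

theorem IsContractionSemigroup.hasDerivWithinAt_orbit (hT : IsContractionSemigroup T) {u v : X}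
    (h : IsGeneratorAt T u v) {x : ℝ} (hx : 0 ≤ x) :
    HasDerivWithinAt (fun r : ℝ => T r.toNNReal u) (T x.toNNReal v) (Set.Ici x) x := by
  rw [hasDerivWithinAt_iff_tendsto_slope, Set.Ici_sdiff_left]
  have hmap : Tendsto (fun y : ℝ => (y - x).toNNReal) (𝓝[>] x) (𝓝[>] 0) := by
    refine tendsto_nhdsWithin_iff.2 ⟨?_, ?_⟩
    · have : Continuous fun y : ℝ => (y - x).toNNReal := by fun_prop
      simpa using (this.tendsto x).mono_left nhdsWithin_le_nhds
    · filter_upwards [self_mem_nhdsWithin] with y hy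
      simpa using hy
  have h1 := (hT.isGeneratorAt_apply h x.toNNReal).comp hmap
  refine h1.congr' ?_
  filter_upwards [self_mem_nhdsWithin] with y hy
  have hy' : x < y := hy
  have h2 : y.toNNReal = (y - x).toNNReal + x.toNNReal := by
    rw [← Real.toNNReal_add (by linarith) hx, sub_add_cancel]
  simp only [Function.comp_apply, slope_def_module, h2, hT.add_apply]
  rw [Real.coe_toNNReal _ (by linarith)]

end Orbits

/-! ### Uniqueness of the semigroup with a given generator -/

section Uniqueness

variable {H : Type*} [NormedAddCommGroup H] [InnerProductSpace ℝ H]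

theorem IsContractionSemigroup.inner_generator_nonpos {T : ℝ≥0 → H →L[ℝ] H}
    (hT : IsContractionSemigroup T) {u v : H} (h : IsGeneratorAt T u v) : inner ℝ u v ≤ 0 := by
  refine le_of_tendsto (tendsto_const_nhds.inner (𝕜 := ℝ) (x := u) h) ?_
  filter_upwards with t
  rw [real_inner_smul_right, inner_sub_right, real_inner_self_eq_norm_sq]
  have h1 := (real_inner_le_norm u (T t u)).trans
    (mul_le_mul_of_nonneg_left (hT.norm_apply_le t u) (norm_nonneg u))
  exact mul_nonpos_of_nonneg_of_nonpos (by positivity) (by linarith [sq ‖u‖])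

/-- A contraction semigroup on a Hilbert space is determined by its generator. -/
theorem IsContractionSemigroup.eq_of_isGeneratorAt {T S : ℝ≥0 → H →L[ℝ] H}
    (hT : IsContractionSemigroup T) (hS : IsContractionSemigroup S)
    (hd : Dense (generatorDomain T)) (h : ∀ u v, IsGeneratorAt T u v → IsGeneratorAt S u v) :
    T = S := by
  funext t
  refine ContinuousLinearMap.ext fun f => ?_
  refine congrFun (Continuous.ext_on hd (T t).continuous (S t).continuous ?_) f
  rintro u ⟨v, huv⟩
  -- The squared distance of the two orbits starts at zero, and its right derivative is nonpositive
  -- because the generator of `S` is dissipative.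
  have key := image_le_of_deriv_right_le_deriv_boundary (a := 0) (b := (t : ℝ))
    (f := fun r : ℝ => ‖T r.toNNReal u - S r.toNNReal u‖ ^ 2)
    (f' := fun r : ℝ => 2 * inner ℝ (T r.toNNReal u - S r.toNNReal u)
      (T r.toNNReal v - S r.toNNReal v)) (B := fun _ => 0) (B' := fun _ => 0)
    (Continuous.continuousOn ?_) (fun x hx => ?_) (by simp [hT.zero_apply, hS.zero_apply])
    continuousOn_const (fun x _ => hasDerivWithinAt_const _ _ _) (fun x hx => ?_)
    (x := t) ⟨t.coe_nonneg, le_rfl⟩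
  · have : ‖T t u - S t u‖ ^ 2 ≤ 0 := by simpa using key
    rw [← sub_eq_zero, ← norm_eq_zero]
    exact pow_eq_zero_iff two_ne_zero |>.1 (le_antisymm this (sq_nonneg _))
  · exact ((((hT.continuous_orbit u).comp continuous_real_toNNReal).sub
      ((hS.continuous_orbit u).comp continuous_real_toNNReal)).norm).pow 2
  · exact ((hT.hasDerivWithinAt_orbit huv hx.1).sub
      (hS.hasDerivWithinAt_orbit (h u v huv) hx.1)).norm_sq
  · have h1 := (h _ _ (hT.isGeneratorAt_apply huv x.toNNReal)).sub
      (hS.isGeneratorAt_apply (h u v huv) x.toNNReal)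
    linarith [hS.inner_generator_nonpos h1]

end Uniqueness

/-! ### The resolvents and the semigroup of a Dirichlet form on `L²` -/

section Resolvent

variable {E : Type*} [MeasurableSpace E] {μ : Measure E}

namespace DirichletForm

/-- The form domain, to be normed by `𝓔(u, u) + a ‖u‖²`. -/
def FormSpace (𝓔 : DirichletForm μ) (_a : ℝ) : Type _ := 𝓔.domain

instance (𝓔 : DirichletForm μ) (a : ℝ) : AddCommGroup (𝓔.FormSpace a) :=
  inferInstanceAs (AddCommGroup 𝓔.domain)

instance (𝓔 : DirichletForm μ) (a : ℝ) : Module ℝ (𝓔.FormSpace a) :=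
  inferInstanceAs (Module ℝ 𝓔.domain)

/-- The identity from the normed form domain to the form domain. -/
def FormSpace.toDomain (𝓔 : DirichletForm μ) (a : ℝ) : 𝓔.FormSpace a ≃ₗ[ℝ] 𝓔.domain :=
  LinearEquiv.refl ℝ 𝓔.domain

open FormSpace

/-- The inner product `𝓔(u, v) + a ⟨u, v⟩` on the form domain. -/
@[reducible]
def core (𝓔 : DirichletForm μ) {a : ℝ} (ha : 0 < a) :
    InnerProductSpace.Core ℝ (𝓔.FormSpace a) where
  inner u v := 𝓔.form (toDomain 𝓔 a u) (toDomain 𝓔 a v)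
    + a * inner ℝ (toDomain 𝓔 a u : Lp ℝ 2 μ) (toDomain 𝓔 a v : Lp ℝ 2 μ)
  conj_inner_symm u v := by
    simp only [conj_trivial]
    rw [𝓔.symm, real_inner_comm]
  re_inner_nonneg u := by
    have := 𝓔.nonneg (toDomain 𝓔 a u)
    simp only [RCLike.re_to_real]
    have h2 : (0 : ℝ) ≤ inner ℝ (toDomain 𝓔 a u : Lp ℝ 2 μ) (toDomain 𝓔 a u : Lp ℝ 2 μ) :=
      real_inner_self_nonneg
    positivity
  add_left u v w := by
    rw [map_add, map_add, Submodule.coe_add, inner_add_left, LinearMap.add_apply]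
    ring
  smul_left u v r := by
    rw [map_smul, map_smul, Submodule.coe_smul, inner_smul_left, LinearMap.smul_apply,
      smul_eq_mul, conj_trivial]
    ring
  definite u h := by
    have h1 := 𝓔.nonneg (toDomain 𝓔 a u)
    have h2 : (0 : ℝ) ≤ inner ℝ (toDomain 𝓔 a u : Lp ℝ 2 μ) (toDomain 𝓔 a u : Lp ℝ 2 μ) :=
      real_inner_self_nonneg
    have h3 : inner ℝ (toDomain 𝓔 a u : Lp ℝ 2 μ) (toDomain 𝓔 a u : Lp ℝ 2 μ) = (0 : ℝ) := by
      have := mul_nonneg ha.le h2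
      have h4 : a * inner ℝ (toDomain 𝓔 a u : Lp ℝ 2 μ) (toDomain 𝓔 a u : Lp ℝ 2 μ) = 0 := by
        linarith
      exact (mul_eq_zero.1 h4).resolve_left ha.ne'
    exact (toDomain 𝓔 a).map_eq_zero_iff.1 (Subtype.ext (inner_self_eq_zero.1 h3))

/-- Riesz representation of `v ↦ ⟨f, v⟩` in the form domain with inner product `𝓔 + a ⟨·, ·⟩`; this
space is complete because the form is closed. -/
theorem exists_resolvent (𝓔 : DirichletForm μ) {a : ℝ} (ha : 0 < a) (f : Lp ℝ 2 μ) :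
    ∃ u : 𝓔.domain, ∀ v : 𝓔.domain,
      𝓔.form u v + a * inner ℝ (u : Lp ℝ 2 μ) (v : Lp ℝ 2 μ) = inner ℝ f (v : Lp ℝ 2 μ) := by
  let _ : NormedAddCommGroup (𝓔.FormSpace a) :=
    @InnerProductSpace.Core.toNormedAddCommGroup ℝ _ _ _ _ (𝓔.core ha)
  let _ : InnerProductSpace ℝ (𝓔.FormSpace a) := InnerProductSpace.ofCore (𝓔.core ha).toCore
  set D := toDomain 𝓔 a with hD
  have hn : ∀ u : 𝓔.FormSpace a, ‖u‖ ^ 2 = 𝓔.form (D u) (D u) + a * ‖(D u : Lp ℝ 2 μ)‖ ^ 2 := by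
    intro u
    rw [← real_inner_self_eq_norm_sq, ← real_inner_self_eq_norm_sq]
    rfl
  have _ : CompleteSpace (𝓔.FormSpace a) := by
    refine Metric.complete_of_cauchySeq_tendsto fun w hw => ?_
    -- Closedness is stated for the weight `1`; the factors `1 + a⁻¹` here and `1 + a` below compare
    -- it with the weight `a`.
    have hle : ∀ u : 𝓔.FormSpace a, 𝓔.form (D u) (D u) + ‖(D u : Lp ℝ 2 μ)‖ ^ 2
        ≤ (1 + a⁻¹) * ‖u‖ ^ 2 := by
      intro u
      rw [hn, add_mul, one_mul, mul_add, inv_mul_cancel_left₀ ha.ne']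
      have := 𝓔.nonneg (D u)
      have : 0 ≤ a⁻¹ * 𝓔.form (D u) (D u) := by positivity
      have : 0 ≤ a * ‖(D u : Lp ℝ 2 μ)‖ ^ 2 := by positivity
      linarith
    obtain ⟨v, hv⟩ := 𝓔.closed (fun n => D (w n)) fun ε hε => by
      obtain ⟨N, hN⟩ := Metric.cauchySeq_iff.1 hw (√(ε / (1 + a⁻¹))) (by positivity)
      refine ⟨N, fun m hm n hn' => ?_⟩
      rw [← map_sub]
      refine (hle (w m - w n)).trans_lt ?_
      have h1 := hN m hm n hn'
      rw [dist_eq_norm, Real.lt_sqrt (norm_nonneg _), lt_div_iff₀ (by positivity)] at h1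
      rwa [mul_comm]
    refine ⟨D.symm v, ?_⟩
    rw [tendsto_iff_norm_sub_tendsto_zero]
    have h0 : Tendsto (fun n => √((1 + a) * (𝓔.form (D (w n) - v) (D (w n) - v)
        + ‖((D (w n) - v : 𝓔.domain) : Lp ℝ 2 μ)‖ ^ 2))) atTop (𝓝 0) := by
      simpa using (hv.const_mul (1 + a)).sqrt
    refine squeeze_zero (fun _ => norm_nonneg _) (fun n => ?_) h0
    refine Real.le_sqrt_of_sq_le ?_
    rw [hn, map_sub, LinearEquiv.apply_symm_apply]
    have h2 := 𝓔.nonneg (D (w n) - v)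
    have h3 : 0 ≤ ‖((D (w n) - v : 𝓔.domain) : Lp ℝ 2 μ)‖ ^ 2 := by positivity
    nlinarith
  let l : 𝓔.FormSpace a →ₗ[ℝ] ℝ :=
    (innerₗ (Lp ℝ 2 μ) f).comp (𝓔.domain.subtype.comp D.toLinearMap)
  have hl : ∀ v, ‖l v‖ ≤ (‖f‖ * (√a)⁻¹) * ‖v‖ := by
    intro v
    have h1 : ‖l v‖ ≤ ‖f‖ * ‖(D v : Lp ℝ 2 μ)‖ := norm_inner_le_norm (𝕜 := ℝ) f _
    refine h1.trans ?_
    rw [mul_assoc]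
    refine mul_le_mul_of_nonneg_left ?_ (norm_nonneg f)
    rw [le_inv_mul_iff₀ (Real.sqrt_pos.2 ha)]
    refine abs_le_of_sq_le_sq' ?_ (norm_nonneg _) |>.2
    rw [mul_pow, Real.sq_sqrt ha.le, hn]
    linarith [𝓔.nonneg (D v)]
  refine ⟨D ((InnerProductSpace.toDual ℝ (𝓔.FormSpace a)).symm (l.mkContinuous _ hl)),
    fun v => ?_⟩
  exact InnerProductSpace.toDual_symm_apply (𝕜 := ℝ) (E := 𝓔.FormSpace a) (x := D.symm v)
    (y := l.mkContinuous _ hl)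

theorem resolvent_unique (𝓔 : DirichletForm μ) {a : ℝ} (ha : 0 < a) {u u' : 𝓔.domain}
    (h : ∀ v : 𝓔.domain, 𝓔.form u v + a * inner ℝ (u : Lp ℝ 2 μ) (v : Lp ℝ 2 μ)
      = 𝓔.form u' v + a * inner ℝ (u' : Lp ℝ 2 μ) (v : Lp ℝ 2 μ)) : u = u' := by
  have h1 := h (u - u')
  have h2 := 𝓔.nonneg (u - u')
  rw [map_sub 𝓔.form, LinearMap.sub_apply] at h2
  have h3 : a * ‖(u : Lp ℝ 2 μ) - u'‖ ^ 2 ≤ 0 := by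
    rw [← real_inner_self_eq_norm_sq, inner_sub_left]
    simp only [Submodule.coe_sub] at h1
    linarith
  have h4 : ‖(u : Lp ℝ 2 μ) - u'‖ ^ 2 = 0 :=
    le_antisymm (nonpos_of_mul_nonpos_right h3 ha) (sq_nonneg _)
  exact Subtype.ext (sub_eq_zero.1 (norm_eq_zero.1 ((pow_eq_zero_iff two_ne_zero).1 h4)))

/-- The element `(a - L)⁻¹ f` of the form domain, where `L` is the operator of the form. -/
def resolventElt (𝓔 : DirichletForm μ) {a : ℝ} (ha : 0 < a) (f : Lp ℝ 2 μ) : 𝓔.domain :=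
  (𝓔.exists_resolvent ha f).choose

theorem resolventElt_spec (𝓔 : DirichletForm μ) {a : ℝ} (ha : 0 < a) (f : Lp ℝ 2 μ)
    (v : 𝓔.domain) : 𝓔.form (𝓔.resolventElt ha f) v
      + a * inner ℝ (𝓔.resolventElt ha f : Lp ℝ 2 μ) (v : Lp ℝ 2 μ) = inner ℝ f (v : Lp ℝ 2 μ) :=
  (𝓔.exists_resolvent ha f).choose_spec v

theorem eq_resolventElt (𝓔 : DirichletForm μ) {a : ℝ} (ha : 0 < a) {f : Lp ℝ 2 μ} {u : 𝓔.domain}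
    (h : ∀ v : 𝓔.domain, 𝓔.form u v + a * inner ℝ (u : Lp ℝ 2 μ) (v : Lp ℝ 2 μ)
      = inner ℝ f (v : Lp ℝ 2 μ)) : u = 𝓔.resolventElt ha f :=
  𝓔.resolvent_unique ha fun v => by rw [h, 𝓔.resolventElt_spec ha]

theorem norm_resolventElt_le (𝓔 : DirichletForm μ) {a : ℝ} (ha : 0 < a) (f : Lp ℝ 2 μ) :
    a * ‖(𝓔.resolventElt ha f : Lp ℝ 2 μ)‖ ≤ ‖f‖ := by
  have h1 := 𝓔.resolventElt_spec ha f (𝓔.resolventElt ha f)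
  rw [real_inner_self_eq_norm_sq] at h1
  have h2 := real_inner_le_norm f (𝓔.resolventElt ha f : Lp ℝ 2 μ)
  have h3 := 𝓔.nonneg (𝓔.resolventElt ha f)
  rcases (norm_nonneg (𝓔.resolventElt ha f : Lp ℝ 2 μ)).eq_or_lt with h | h
  · rw [← h]; simp
  · refine le_of_mul_le_mul_right ?_ h
    linarith [mul_assoc a ‖(𝓔.resolventElt ha f : Lp ℝ 2 μ)‖ ‖(𝓔.resolventElt ha f : Lp ℝ 2 μ)‖,
      sq ‖(𝓔.resolventElt ha f : Lp ℝ 2 μ)‖]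

/-- The resolvent `(a - L)⁻¹` of the operator of the form. -/
def resolvent (𝓔 : DirichletForm μ) (a : ℝ) : Lp ℝ 2 μ →L[ℝ] Lp ℝ 2 μ :=
  if ha : 0 < a then
    LinearMap.mkContinuous
      { toFun := fun f => (𝓔.resolventElt ha f : Lp ℝ 2 μ)
        map_add' := fun f g => by
          rw [← Submodule.coe_add]
          congr 1
          refine (𝓔.eq_resolventElt ha fun v => ?_).symm
          rw [inner_add_left, ← 𝓔.resolventElt_spec ha f, ← 𝓔.resolventElt_spec ha g, map_add,
            LinearMap.add_apply, Submodule.coe_add, inner_add_left]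
          ring
        map_smul' := fun r f => by
          rw [RingHom.id_apply, ← Submodule.coe_smul]
          congr 1
          refine (𝓔.eq_resolventElt ha fun v => ?_).symm
          rw [inner_smul_left, ← 𝓔.resolventElt_spec ha f, map_smul,
            LinearMap.smul_apply, Submodule.coe_smul, inner_smul_left, smul_eq_mul]
          simp only [conj_trivial]
          ring }
      a⁻¹ fun f => by
        rw [le_inv_mul_iff₀ ha]
        exact 𝓔.norm_resolventElt_le ha f
  else 0

theorem resolvent_apply (𝓔 : DirichletForm μ) {a : ℝ} (ha : 0 < a) (f : Lp ℝ 2 μ) :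
    𝓔.resolvent a f = 𝓔.resolventElt ha f := by
  rw [resolvent, dif_pos ha]; rfl

theorem inner_resolvent (𝓔 : DirichletForm μ) {a : ℝ} (ha : 0 < a) (f g : Lp ℝ 2 μ) :
    inner ℝ (𝓔.resolvent a f) g = inner ℝ f (𝓔.resolvent a g) := by
  rw [resolvent_apply _ ha, resolvent_apply _ ha, ← 𝓔.resolventElt_spec ha f, real_inner_comm,
    ← 𝓔.resolventElt_spec ha g, 𝓔.symm, real_inner_comm]

theorem isResolventFamily (𝓔 : DirichletForm μ) : IsResolventFamily 𝓔.resolvent where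
  resolvent_eq a b ha hb := by
    refine ContinuousLinearMap.ext fun f => ?_
    change 𝓔.resolvent a f = 𝓔.resolvent b f + (b - a) • 𝓔.resolvent a (𝓔.resolvent b f)
    rw [← map_smul, ← sub_eq_iff_eq_add, ← map_sub, 𝓔.resolvent_apply ha, 𝓔.resolvent_apply hb]
    refine congrArg Subtype.val (𝓔.eq_resolventElt ha fun v => ?_).symm
    rw [inner_sub_left, ← 𝓔.resolventElt_spec hb f, inner_smul_left]
    simp only [conj_trivial]
    ring
  contraction a ha := by
    refine ContinuousLinearMap.opNorm_le_bound _ zero_le_one fun f => ?_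
    change ‖a • 𝓔.resolvent a f‖ ≤ _
    rw [norm_smul, Real.norm_of_nonneg ha.le, one_mul, 𝓔.resolvent_apply ha]
    exact 𝓔.norm_resolventElt_le ha f
  dense := by
    have h : (LinearMap.range (𝓔.resolvent 1).toLinearMap).topologicalClosure = ⊤ := by
      rw [Submodule.topologicalClosure_eq_top_iff, Submodule.eq_bot_iff]
      intro h hh
      -- A vector `h` orthogonal to the range is in particular orthogonal to its own resolvent. This
      -- forces the resolvent of `h` to vanish, so `h` is orthogonal to the dense form domain.
      have h1 : inner ℝ (𝓔.resolvent 1 h) h = 0 :=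
        (Submodule.mem_orthogonal _ _).1 hh _ ⟨h, rfl⟩
      have h2 := 𝓔.resolventElt_spec one_pos h (𝓔.resolventElt one_pos h)
      rw [← 𝓔.resolvent_apply one_pos, real_inner_comm _ h, h1, one_mul,
        real_inner_self_eq_norm_sq] at h2
      have h3 := 𝓔.nonneg (𝓔.resolventElt one_pos h)
      have h4 : 𝓔.resolvent 1 h = 0 := by
        rw [← norm_eq_zero, ← pow_eq_zero_iff two_ne_zero]
        exact le_antisymm (by linarith) (sq_nonneg _)
      have h5 : 𝓔.resolventElt one_pos h = 0 := Subtype.ext (by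
        rw [← 𝓔.resolvent_apply one_pos, h4]; rfl)
      have h6 : ∀ v : 𝓔.domain, inner ℝ h (v : Lp ℝ 2 μ) = 0 := fun v => by
        rw [← 𝓔.resolventElt_spec one_pos h v, h5]
        simp
      exact 𝓔.dense_domain.eq_zero_of_inner_left (𝕜 := ℝ) (fun v hv => h6 ⟨v, hv⟩)
    have := Submodule.dense_iff_topologicalClosure_eq_top.2 h
    exact this

theorem isL2Semigroup_semigroup (𝓔 : DirichletForm μ) :
    IsL2Semigroup 𝓔 𝓔.isResolventFamily.semigroup := by
  refine ⟨𝓔.isResolventFamily.isContractionSemigroup_semigroup, fun u f => ?_⟩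
  rw [𝓔.isResolventFamily.isGeneratorAt_iff, 𝓔.resolvent_apply one_pos]
  constructor
  · intro h
    have hu : u ∈ 𝓔.domain := h ▸ Submodule.coe_mem _
    refine ⟨hu, fun v => ?_⟩
    have h1 : 𝓔.resolventElt one_pos (u - f) = ⟨u, hu⟩ := Subtype.ext h
    have h2 := 𝓔.resolventElt_spec one_pos (u - f) v
    rw [h1, inner_sub_left] at h2
    linarith
  · rintro ⟨hu, h⟩
    refine (congrArg Subtype.val (𝓔.eq_resolventElt one_pos (u := ⟨u, hu⟩) fun v => ?_)).symm
    rw [h, inner_sub_left]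
    ring

/-- The semigroup of the form is the limit of the exponentials of its Yosida approximations. -/
theorem l2Semigroup_eq (𝓔 : DirichletForm μ) :
    l2Semigroup 𝓔 = 𝓔.isResolventFamily.semigroup := by
  have h : IsL2Semigroup 𝓔 (l2Semigroup 𝓔) :=
    Classical.epsilon_spec (p := IsL2Semigroup 𝓔) ⟨_, 𝓔.isL2Semigroup_semigroup⟩
  have h' := 𝓔.isL2Semigroup_semigroup
  refine (h'.1.eq_of_isGeneratorAt h.1 ?_ fun u v huv => (h.2 u v).2 ((h'.2 u v).1 huv)).symm
  refine 𝓔.isResolventFamily.dense.mono ?_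
  rintro _ ⟨g, rfl⟩
  exact ⟨_, 𝓔.isResolventFamily.isGeneratorAt_semigroup g⟩

/-- Sub-Markov property: the functions with values in `[0, 1]` are mapped to such functions. -/
def unitOrderInterval (μ : Measure E) : Set (Lp ℝ 2 μ) :=
  {f | ∀ᵐ x ∂μ, 0 ≤ f x ∧ f x ≤ 1}

/-- The function `u = a (a - L)⁻¹ f` is the unique minimiser of `w ↦ 𝓔(w, w) + a ‖w - f‖²`. Cutting
`u` off at `0` and `1` increases neither the energy nor the distance to a function `f` with values
in `[0, 1]`, so `u` coincides with its truncation. -/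
theorem smul_resolvent_mem (𝓔 : DirichletForm μ) {a : ℝ} (ha : 0 < a) {f : Lp ℝ 2 μ}
    (hf : f ∈ unitOrderInterval μ) : a • 𝓔.resolvent a f ∈ unitOrderInterval μ := by
  set u : 𝓔.domain := a • 𝓔.resolventElt ha f with hu
  have hspec : ∀ v : 𝓔.domain, 𝓔.form u v + a * inner ℝ (u : Lp ℝ 2 μ) (v : Lp ℝ 2 μ)
      = a * inner ℝ f (v : Lp ℝ 2 μ) := fun v => by
    rw [← 𝓔.resolventElt_spec ha f v, hu, map_smul, LinearMap.smul_apply, Submodule.coe_smul,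
      inner_smul_left, smul_eq_mul, conj_trivial]
    ring
  obtain ⟨v, hv, hvu⟩ := 𝓔.markov u
  have hdist : ‖(v : Lp ℝ 2 μ) - f‖ ≤ ‖(u : Lp ℝ 2 μ) - f‖ := by
    refine Lp.norm_le_norm_of_ae_le ?_
    filter_upwards [hv, hf, Lp.coeFn_sub (v : Lp ℝ 2 μ) f, Lp.coeFn_sub (u : Lp ℝ 2 μ) f]
      with x h1 h2 h3 h4
    rw [h3, h4, Pi.sub_apply, Pi.sub_apply, h1, Real.norm_eq_abs, Real.norm_eq_abs]
    rcases le_total ((u : Lp ℝ 2 μ) x) 0 with h | h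
    · rw [max_eq_right h, min_eq_left zero_le_one]
      exact abs_le_abs_of_nonpos (by linarith [h2.1]) (by linarith)
    · rw [max_eq_left h]
      rcases le_total ((u : Lp ℝ 2 μ) x) 1 with h' | h'
      · rw [min_eq_left h']
      · rw [min_eq_right h']
        exact abs_le_abs_of_nonneg (by linarith [h2.2]) (by linarith)
  have hmin : 𝓔.form (v - u) (v - u) + a * ‖(v : Lp ℝ 2 μ) - u‖ ^ 2 ≤ 0 := by
    have e1 := hspec (v - u)
    have e2 : 𝓔.form (v - u) (v - u) = 𝓔.form v v - 𝓔.form u u - 2 * 𝓔.form u (v - u) := by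
      simp only [map_sub, LinearMap.sub_apply, 𝓔.symm v u]
      ring
    have e3 : ‖(v : Lp ℝ 2 μ) - u‖ ^ 2 = ‖(v : Lp ℝ 2 μ) - f‖ ^ 2 - ‖(u : Lp ℝ 2 μ) - f‖ ^ 2
        - 2 * inner ℝ ((u : Lp ℝ 2 μ) - f) ((v : Lp ℝ 2 μ) - u) := by
      rw [show (v : Lp ℝ 2 μ) - f = ((u : Lp ℝ 2 μ) - f) + ((v : Lp ℝ 2 μ) - u) by abel,
        norm_add_sq_real]
      ring
    rw [e2, e3, inner_sub_left]
    rw [Submodule.coe_sub] at e1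
    have e4 := pow_le_pow_left₀ (norm_nonneg _) hdist 2
    nlinarith
  have h0 : ‖(v : Lp ℝ 2 μ) - u‖ ^ 2 = 0 := by
    have := 𝓔.nonneg (v - u)
    exact le_antisymm (nonpos_of_mul_nonpos_right (by linarith) ha) (sq_nonneg _)
  have huv : (v : Lp ℝ 2 μ) = u :=
    sub_eq_zero.1 (norm_eq_zero.1 ((pow_eq_zero_iff two_ne_zero).1 h0))
  have e : a • 𝓔.resolvent a f = (v : Lp ℝ 2 μ) := by
    rw [huv, hu, 𝓔.resolvent_apply ha]; rfl
  rw [e]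
  filter_upwards [hv] with x hx
  rw [hx]
  exact ⟨le_min (le_max_right _ _) zero_le_one, min_le_right _ _⟩

end DirichletForm

end Resolvent

/-! ### Stein interpolation for finite matrices -/

section Interpolation

open Complex.HadamardThreeLines

variable {ι κ : Type*} [Fintype ι] [Fintype κ]

/-- The analytic family `sgn(a) |a|^w` through `a`. -/
def signPow (a : ℝ) (w : ℂ) : ℂ := ((a / |a| : ℝ) : ℂ) * ((|a| : ℝ) : ℂ) ^ w

theorem norm_signPow {a : ℝ} (ha : a ≠ 0) (w : ℂ) : ‖signPow a w‖ = |a| ^ w.re := by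
  rw [signPow, norm_mul, Complex.norm_real, norm_div, Real.norm_eq_abs, Real.norm_eq_abs, abs_abs,
    div_self (abs_ne_zero.2 ha), one_mul, Complex.norm_cpow_eq_rpow_re_of_pos (abs_pos.2 ha)]

theorem signPow_one {a : ℝ} (ha : a ≠ 0) : signPow a 1 = a := by
  rw [signPow, Complex.cpow_one, ← Complex.ofReal_mul, div_mul_cancel₀ _ (abs_ne_zero.2 ha)]

theorem differentiable_signPow {a : ℝ} (ha : a ≠ 0) : Differentiable ℂ (signPow a) := by
  unfold signPow
  intro w
  refine (differentiableAt_id.const_cpow (Or.inl ?_)).const_mul _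
  exact_mod_cast abs_ne_zero.2 ha

/-- Stein interpolation for an entire family of matrices that is bounded `L¹ → L¹` on the positive
half-line and `L² → L²` on the right half-plane. -/
theorem norm_sum_le_of_interpolation {k : ι → κ → ℂ → ℂ} (hk : ∀ i j, Differentiable ℂ (k i j))
    {α : ι → ℝ} {β : κ → ℝ} (hβ : ∀ j, 0 ≤ β j)
    (h1 : ∀ t : ℝ, 0 ≤ t → ∀ i, ∑ j, ‖k i j t‖ ≤ α i)
    (h2 : ∀ ζ : ℂ, 0 ≤ ζ.re → ∀ (a : ι → ℂ) (b : κ → ℂ), ‖∑ i, ∑ j, a i * b j * k i j ζ‖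
      ≤ √(∑ i, ‖a i‖ ^ 2 * α i) * √(∑ j, ‖b j‖ ^ 2 * β j))
    {p q : ℝ} (hpq : p.HolderConjugate q) (hp2 : p ≤ 2) {ζ : ℂ} (hζ : |ζ.arg| ≤ Real.pi / q)
    {a : ι → ℝ} {b : κ → ℝ} (ha : ∀ i, a i ≠ 0) (hb : ∀ j, b j ≠ 0) :
    ‖∑ i, ∑ j, (a i : ℂ) * b j * k i j ζ‖
      ≤ (∑ i, |a i| ^ p * α i) ^ (1 / p) * (∑ j, |b j| ^ q * β j) ^ (1 / q) := by
  have hp0 : 0 < p := hpq.pos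
  have hq0 : 0 < q := hpq.symm.pos
  have hq2 : 2 ≤ q := by
    have h := hpq.inv_add_inv_eq_one
    have h3 : (2 : ℝ)⁻¹ ≤ p⁻¹ := inv_anti₀ hp0 hp2
    have h4 : q⁻¹ ≤ (2 : ℝ)⁻¹ := by linarith
    exact (inv_le_inv₀ hq0 two_pos).1 h4
  have hα : ∀ i, 0 ≤ α i := fun i =>
    -- Nonnegativity of the weights `α i` is already contained in the `L¹` bound at time zero.
    (Finset.sum_nonneg fun j _ => norm_nonneg _).trans (h1 0 le_rfl i)
  set τ : ℝ := 2 / q with hτ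
  -- The point `τ = 2 / q` of the strip is where the exponents interpolate to `p` and `q`: `1 - τ /
  -- 2 = 1 / p` and `τ / 2 = 1 / q`.
  have hτ0 : 0 < τ := by positivity
  have hτ1 : τ ≤ 1 := (div_le_one hq0).2 hq2
  set θ : ℝ := ζ.arg / τ with hθ
  have hθ2 : |θ| ≤ Real.pi / 2 := by
    rw [hθ, abs_div, abs_of_pos hτ0, div_le_iff₀ hτ0]
    refine hζ.trans (le_of_eq ?_)
    rw [hτ]; field_simp
  -- The argument of `Z z` is `θ` times the real part of `z`. Thus `Z` maps the line `Re z = 0` to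
  -- the half-line of nonnegative numbers and the strip to the closed right half-plane, and `θ = arg
  -- ζ / τ` is chosen so that `Z τ = ζ`.
  set Z : ℂ → ℂ := fun z => ‖ζ‖ * Complex.exp (θ * z * Complex.I) with hZ
  have hZre : ∀ z : ℂ, 0 ≤ z.re → z.re ≤ 1 → 0 ≤ (Z z).re := by
    intro z hz0 hz1
    have : (Z z).re = ‖ζ‖ * (Real.exp (-(θ * z.im)) * Real.cos (θ * z.re)) := by
      rw [hZ, Complex.re_ofReal_mul, Complex.exp_re]
      simp
    rw [this]
    have hc : 0 ≤ Real.cos (θ * z.re) := by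
      refine Real.cos_nonneg_of_mem_Icc (abs_le.1 ?_)
      rw [abs_mul, abs_of_nonneg hz0]
      exact (mul_le_of_le_one_right (abs_nonneg _) hz1).trans hθ2
    positivity
  set A : ι → ℂ → ℂ := fun i z => signPow (a i) (p * (1 - z / 2)) with hA
  set B : κ → ℂ → ℂ := fun j z => signPow (b j) (q * z / 2) with hB
  have hAn : ∀ i z, ‖A i z‖ = |a i| ^ (p * (1 - z.re / 2)) := fun i z => by
    rw [hA, norm_signPow (ha i), Complex.re_ofReal_mul]
    simp
  have hBn : ∀ j z, ‖B j z‖ = |b j| ^ (q * z.re / 2) := fun j z => by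
    rw [hB, norm_signPow (hb j)]
    simp
  set F : ℂ → ℂ := fun z => ∑ i, ∑ j, A i z * B j z * k i j (Z z) with hF
  have hFd : Differentiable ℂ F := by
    have hZd : Differentiable ℂ Z := by rw [hZ]; fun_prop
    have hAd : ∀ i, Differentiable ℂ (A i) := fun i =>
      (differentiable_signPow (ha i)).comp (by fun_prop)
    have hBd : ∀ j, Differentiable ℂ (B j) := fun j =>
      (differentiable_signPow (hb j)).comp (by fun_prop)
    exact Differentiable.fun_sum fun i _ => Differentiable.fun_sum fun j _ =>
      ((hAd i).mul (hBd j)).mul ((hk i j).comp hZd)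
  set SA := ∑ i, |a i| ^ p * α i with hSA
  set SB := ∑ j, |b j| ^ q * β j with hSB
  have hSA0 : 0 ≤ SA := Finset.sum_nonneg fun i _ => mul_nonneg (by positivity) (hα i)
  have hSB0 : 0 ≤ SB := Finset.sum_nonneg fun j _ => mul_nonneg (by positivity) (hβ j)
  set Ψ : ℝ → ℝ := fun x => √(∑ i, (|a i| ^ (p * (1 - x / 2))) ^ 2 * α i)
    * √(∑ j, (|b j| ^ (q * x / 2)) ^ 2 * β j) with hΨ
  -- The `L²` bound applies on the whole strip and depends only on the real part; it supplies the
  -- boundedness that the three lines theorem requires.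
  have hFΨ : ∀ z : ℂ, 0 ≤ z.re → z.re ≤ 1 → ‖F z‖ ≤ Ψ z.re := fun z hz0 hz1 => by
    have := h2 (Z z) (hZre z hz0 hz1) (fun i => A i z) (fun j => B j z)
    simpa only [hAn, hBn] using this
  have hΨc : Continuous Ψ := by
    have e1 : ∀ i, Continuous fun x : ℝ => |a i| ^ (p * (1 - x / 2)) := fun i =>
      Continuous.rpow continuous_const (by fun_prop) fun _ => Or.inl (abs_ne_zero.2 (ha i))
    have e2 : ∀ j, Continuous fun x : ℝ => |b j| ^ (q * x / 2) := fun j =>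
      Continuous.rpow continuous_const (by fun_prop) fun _ => Or.inl (abs_ne_zero.2 (hb j))
    rw [hΨ]
    fun_prop
  have hbdd : BddAbove (norm ∘ F '' verticalClosedStrip 0 1) := by
    obtain ⟨C, hC⟩ := (isCompact_Icc (a := (0 : ℝ)) (b := 1)).bddAbove_image hΨc.continuousOn
    refine ⟨C, ?_⟩
    rintro _ ⟨z, hz, rfl⟩
    exact (hFΨ z hz.1 hz.2).trans (hC ⟨z.re, hz, rfl⟩)
  have h0line : ∀ z ∈ Complex.re ⁻¹' {0}, ‖F z‖ ≤ SA := by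
    intro z hz
    have hz0 : z.re = 0 := hz
    have hZz : Z z = ((‖ζ‖ * Real.exp (-(θ * z.im)) : ℝ) : ℂ) := by
      have : (θ : ℂ) * z * Complex.I = ((-(θ * z.im) : ℝ) : ℂ) := by
        apply Complex.ext <;> simp [hz0]
      simp only [hZ, this]
      push_cast
      rfl
    refine (norm_sum_le _ _).trans (Finset.sum_le_sum fun i _ => ?_)
    refine (norm_sum_le _ _).trans ?_
    have hA0 : ‖A i z‖ = |a i| ^ p := by rw [hAn, hz0]; simp
    have hB0 : ∀ j, ‖B j z‖ = 1 := fun j => by rw [hBn, hz0]; simp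
    simp only [norm_mul, hA0, hB0, mul_one, ← Finset.mul_sum]
    refine mul_le_mul_of_nonneg_left ?_ (by positivity)
    rw [hZz]
    exact h1 _ (by positivity) i
  have h1line : ∀ z ∈ Complex.re ⁻¹' {1}, ‖F z‖ ≤ √SA * √SB := by
    intro z hz
    have hz1 : z.re = 1 := hz
    refine (hFΨ z (by rw [hz1]; exact zero_le_one) hz1.le).trans (le_of_eq ?_)
    simp only [hΨ, hz1]
    have e : ∀ (x r : ℝ), 0 ≤ x → (x ^ (r / 2)) ^ 2 = x ^ r := fun x r hx => by
      rw [← Real.rpow_natCast, ← Real.rpow_mul hx]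
      norm_num
    have e1 : p * (1 - 1 / 2) = p / 2 := by ring
    simp only [e1, mul_one, e _ _ (abs_nonneg _)]
    rfl
  have hmain := norm_le_interp_of_mem_verticalClosedStrip₀₁' F (z := (τ : ℂ))
    (by exact ⟨hτ0.le, hτ1⟩) hFd.diffContOnCl hbdd h0line h1line
  have hFτ : F τ = ∑ i, ∑ j, (a i : ℂ) * b j * k i j ζ := by
    have hqc : (q : ℂ) ≠ 0 := by exact_mod_cast hq0.ne'
    have eZ : Z τ = ζ := by
      have : (θ : ℂ) * τ * Complex.I = ζ.arg * Complex.I := by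
        rw [hθ, ← Complex.ofReal_mul, div_mul_cancel₀ _ hτ0.ne']
      simp only [hZ, this]
      exact Complex.norm_mul_exp_arg_mul_I ζ
    have eA : ∀ i, A i τ = a i := fun i => by
      have : (p : ℂ) * (1 - (τ : ℂ) / 2) = 1 := by
        have : p * (1 - τ / 2) = 1 := by
          have h := hpq.inv_add_inv_eq_one
          have e : 1 - τ / 2 = p⁻¹ := by rw [hτ, div_div, mul_comm, ← div_div]; linarith [div_self (two_ne_zero (α := ℝ)), inv_eq_one_div q]
          rw [e, mul_inv_cancel₀ hp0.ne']
        exact_mod_cast this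
      simp only [hA, this, signPow_one (ha i)]
    have eB : ∀ j, B j τ = b j := fun j => by
      have : (q : ℂ) * (τ : ℂ) / 2 = 1 := by
        rw [hτ]; push_cast; field_simp
      simp only [hB, this, signPow_one (hb j)]
    simp only [hF, eZ, eA, eB]
  rw [hFτ, Complex.ofReal_re] at hmain
  refine hmain.trans (le_of_eq ?_)
  -- The interpolated bound is `SA ^ (1 - τ) * (√SA * √SB) ^ τ`; it remains to collect the
  -- exponents.
  have hp' : 1 / p = 1 - τ + 1 / 2 * τ := by
    have h := hpq.inv_add_inv_eq_one
    rw [hτ, one_div, ← sub_eq_zero]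
    field_simp
    field_simp at h
    linarith
  have hq' : 1 / q = 1 / 2 * τ := by rw [hτ]; field_simp
  rw [Real.mul_rpow (Real.sqrt_nonneg _) (Real.sqrt_nonneg _), Real.sqrt_eq_rpow, Real.sqrt_eq_rpow,
    ← Real.rpow_mul hSA0, ← Real.rpow_mul hSB0, ← mul_assoc,
    ← Real.rpow_add_of_nonneg hSA0 (by linarith) (by positivity), ← hp', ← hq']

end Interpolation

/-! ### Cauchy estimates in a sector -/

section Cauchy

/-- This radius is at most `t / 2`, so `‖ζ‖ ≥ t / 2` and the sine of the argument is at most `sin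
θ`. Cauchy's estimates can therefore be used on a disc whose radius is proportional to `t`. -/
theorem abs_arg_le_of_norm_sub_le {θ t : ℝ} (hθ0 : 0 < θ) (hθ : θ ≤ Real.pi / 2) (ht : 0 < t)
    {ζ : ℂ} (h : ‖ζ - t‖ ≤ Real.sin θ / 2 * t) : |ζ.arg| ≤ θ := by
  have hs1 : Real.sin θ ≤ 1 := Real.sin_le_one θ
  have hre : t / 2 ≤ ζ.re := by
    have := (Complex.abs_re_le_norm (ζ - t)).trans h
    rw [Complex.sub_re, Complex.ofReal_re, abs_le] at this
    nlinarith [this.1]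
  have him : |ζ.im| ≤ Real.sin θ / 2 * t := by
    have := (Complex.abs_im_le_norm (ζ - t)).trans h
    simpa using this
  have hn : t / 2 ≤ ‖ζ‖ := hre.trans (Complex.re_le_norm ζ)
  have hn0 : 0 < ‖ζ‖ := by linarith
  have hb : |ζ.im / ‖ζ‖| ≤ Real.sin θ := by
    rw [abs_div, abs_of_pos hn0, div_le_iff₀ hn0]
    have hs : 0 ≤ Real.sin θ := Real.sin_nonneg_of_nonneg_of_le_pi hθ0.le (by linarith [Real.pi_pos])
    nlinarith
  rw [Complex.arg_of_re_nonneg (by linarith)]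
  rw [abs_le] at hb ⊢
  have e : Real.arcsin (Real.sin θ) = θ := Real.arcsin_sin (by linarith) hθ
  constructor
  · rw [← e, ← Real.arcsin_neg]
    exact Real.monotone_arcsin hb.1
  · conv_rhs => rw [← e]
    exact Real.monotone_arcsin hb.2

variable {φ : ℂ → ℂ} {θ M : ℝ}

theorem norm_iteratedDeriv_le_of_sector (hφ : Differentiable ℂ φ) (hθ0 : 0 < θ)
    (hθ : θ ≤ Real.pi / 2) (hM : ∀ ζ : ℂ, |ζ.arg| ≤ θ → ‖φ ζ‖ ≤ M) (n : ℕ) {t : ℝ} (ht : 0 < t) :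
    ‖iteratedDeriv n φ t‖ ≤ n.factorial * M / (Real.sin θ / 2 * t) ^ n := by
  have hs : 0 < Real.sin θ := Real.sin_pos_of_pos_of_lt_pi hθ0 (by linarith [Real.pi_pos])
  refine Complex.norm_iteratedDeriv_le_of_forall_mem_sphere_norm_le n (by positivity)
    hφ.diffContOnCl fun ζ hζ => hM ζ (abs_arg_le_of_norm_sub_le hθ0 hθ ht ?_)
  rw [mem_sphere_iff_norm] at hζ
  exact hζ.le

theorem norm_sub_le_of_sector (hφ : Differentiable ℂ φ) (hθ0 : 0 < θ)
    (hθ : θ ≤ Real.pi / 2) (hM : ∀ ζ : ℂ, |ζ.arg| ≤ θ → ‖φ ζ‖ ≤ M) {t h : ℝ} (ht : 0 < t)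
    (hh : 0 ≤ h) : ‖φ (t + h : ℝ) - φ t‖ ≤ M / (Real.sin θ / 2 * t) * h := by
  have hs : 0 < Real.sin θ := Real.sin_pos_of_pos_of_lt_pi hθ0 (by linarith [Real.pi_pos])
  have hM0 : 0 ≤ M := (norm_nonneg _).trans (hM 1 (by simp [hθ0.le]))
  have key := norm_image_sub_le_of_norm_deriv_le_segment' (a := t) (b := t + h)
    (f := fun s : ℝ => φ s) (f' := fun s : ℝ => deriv φ s) (C := M / (Real.sin θ / 2 * t))
    (fun s _ => (hφ s).hasDerivAt.comp_ofReal.hasDerivWithinAt) (fun s hs' => ?_) (t + h)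
    ⟨by linarith, le_rfl⟩
  · simpa using key
  · have := norm_iteratedDeriv_le_of_sector hφ hθ0 hθ hM 1 (ht.trans_le hs'.1)
    rw [iteratedDeriv_one] at this
    refine this.trans ?_
    simp only [Nat.factorial_one, Nat.cast_one, one_mul, pow_one]
    gcongr
    exact hs'.1

/-- Each difference quotient is compared with the derivative at `t`; the error is controlled by the
bound on the second derivative to the right of `t`. The operator version of this estimate makes the
difference quotients of an orbit a Cauchy family. -/
theorem norm_slope_sub_slope_le_of_sector (hφ : Differentiable ℂ φ) (hθ0 : 0 < θ)
    (hθ : θ ≤ Real.pi / 2) (hM : ∀ ζ : ℂ, |ζ.arg| ≤ θ → ‖φ ζ‖ ≤ M) {t h l : ℝ} (ht : 0 < t)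
    (hh : 0 < h) (hl : 0 < l) :
    ‖(h⁻¹ : ℂ) * (φ (t + h : ℝ) - φ t) - (l⁻¹ : ℂ) * (φ (t + l : ℝ) - φ t)‖
      ≤ 2 * M / (Real.sin θ / 2 * t) ^ 2 * (h + l) := by
  have hs : 0 < Real.sin θ := Real.sin_pos_of_pos_of_lt_pi hθ0 (by linarith [Real.pi_pos])
  have hM0 : 0 ≤ M := (norm_nonneg _).trans (hM 1 (by simp [hθ0.le]))
  set K := 2 * M / (Real.sin θ / 2 * t) ^ 2 with hK
  have hK0 : 0 ≤ K := by positivity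
  have hφ' : Differentiable ℂ (deriv φ) := (hφ.contDiff (n := 2)).differentiable_deriv_two
  have h1 : ∀ s ≥ t, ‖deriv φ s - deriv φ t‖ ≤ K * (s - t) := by
    intro s hs'
    refine norm_image_sub_le_of_norm_deriv_le_segment' (a := t) (b := s)
      (f := fun s : ℝ => deriv φ s) (f' := fun s : ℝ => deriv (deriv φ) s)
      (fun s _ => (hφ' s).hasDerivAt.comp_ofReal.hasDerivWithinAt) (fun r hr => ?_) s
      ⟨hs', le_rfl⟩
    have := norm_iteratedDeriv_le_of_sector hφ hθ0 hθ hM 2 (ht.trans_le hr.1)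
    rw [iteratedDeriv_succ, iteratedDeriv_one] at this
    refine this.trans ?_
    simp only [Nat.factorial_two, Nat.cast_ofNat, hK]
    gcongr
    exact hr.1
  have h2 : ∀ s : ℝ, 0 < s → ‖(s⁻¹ : ℂ) * (φ (t + s : ℝ) - φ t) - deriv φ t‖ ≤ K * s := by
    intro s hs'
    have hsc : (s : ℂ) ≠ 0 := by exact_mod_cast hs'.ne'
    have key := norm_image_sub_le_of_norm_deriv_le_segment' (a := t) (b := t + s)
      (f := fun r : ℝ => φ r - (r : ℂ) * deriv φ t)
      (f' := fun r : ℝ => deriv φ r - 1 * deriv φ t) (C := K * s)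
      (fun r _ => ((hφ r).hasDerivAt.comp_ofReal.sub
        ((hasDerivAt_id (r : ℂ)).comp_ofReal.mul_const (deriv φ t))).hasDerivWithinAt)
      (fun r hr => ?_) (t + s) ⟨by linarith, le_rfl⟩
    · have e : (s⁻¹ : ℂ) * (φ (t + s : ℝ) - φ t) - deriv φ t
          = (s⁻¹ : ℂ) * (φ (t + s : ℝ) - ((t + s : ℝ) : ℂ) * deriv φ t
            - (φ t - (t : ℂ) * deriv φ t)) := by
        push_cast
        field_simp
        ring
      rw [e, norm_mul, norm_inv, Complex.norm_real, Real.norm_of_nonneg hs'.le,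
        inv_mul_le_iff₀ hs']
      refine key.trans (le_of_eq ?_)
      ring
    · rw [one_mul]
      refine (h1 r hr.1).trans (mul_le_mul_of_nonneg_left ?_ hK0)
      linarith [hr.2]
  have h3 := norm_sub_le_norm_sub_add_norm_sub ((h⁻¹ : ℂ) * (φ (t + h : ℝ) - φ t)) (deriv φ t)
    ((l⁻¹ : ℂ) * (φ (t + l : ℝ) - φ t))
  rw [norm_sub_rev (deriv φ t)] at h3
  linarith [h2 h hh, h2 l hl]

end Cauchy

/-! ### Complex time: complexified operators on `L²` -/

section Complexification

open NormedSpace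

variable {E : Type*} [MeasurableSpace E] {μ : Measure E}

/-- The real part of a complex `L²` function. -/
def lpRe (μ : Measure E) : Lp ℂ 2 μ →L[ℝ] Lp ℝ 2 μ := Complex.reCLM.compLpL 2 μ

/-- The imaginary part of a complex `L²` function. -/
def lpIm (μ : Measure E) : Lp ℂ 2 μ →L[ℝ] Lp ℝ 2 μ := Complex.imCLM.compLpL 2 μ

/-- A real `L²` function as a complex one. -/
def lpOfReal (μ : Measure E) : Lp ℝ 2 μ →L[ℝ] Lp ℂ 2 μ := Complex.ofRealCLM.compLpL 2 μ

theorem coeFn_lpRe (u : Lp ℂ 2 μ) : lpRe μ u =ᵐ[μ] fun x => (u x).re :=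
  Complex.reCLM.coeFn_compLpL u

theorem coeFn_lpIm (u : Lp ℂ 2 μ) : lpIm μ u =ᵐ[μ] fun x => (u x).im :=
  Complex.imCLM.coeFn_compLpL u

theorem coeFn_lpOfReal (f : Lp ℝ 2 μ) : lpOfReal μ f =ᵐ[μ] fun x => ((f x : ℝ) : ℂ) :=
  Complex.ofRealCLM.coeFn_compLpL f

theorem lpRe_lpOfReal (f : Lp ℝ 2 μ) : lpRe μ (lpOfReal μ f) = f := by
  refine Lp.ext ?_
  filter_upwards [coeFn_lpRe (lpOfReal μ f), coeFn_lpOfReal f] with x h1 h2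
  rw [h1, h2, Complex.ofReal_re]

theorem lpIm_lpOfReal (f : Lp ℝ 2 μ) : lpIm μ (lpOfReal μ f) = 0 := by
  refine Lp.ext ?_
  filter_upwards [coeFn_lpIm (lpOfReal μ f), coeFn_lpOfReal f, Lp.coeFn_zero ℝ 2 μ]
    with x h1 h2 h3
  rw [h1, h2, h3, Complex.ofReal_im, Pi.zero_apply]

theorem eq_lpOfReal_add (u : Lp ℂ 2 μ) :
    u = lpOfReal μ (lpRe μ u) + Complex.I • lpOfReal μ (lpIm μ u) := by
  refine Lp.ext ?_
  filter_upwards [coeFn_lpRe u, coeFn_lpIm u, coeFn_lpOfReal (lpRe μ u), coeFn_lpOfReal (lpIm μ u),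
    Lp.coeFn_add (lpOfReal μ (lpRe μ u)) (Complex.I • lpOfReal μ (lpIm μ u)),
    Lp.coeFn_smul Complex.I (lpOfReal μ (lpIm μ u))] with x h1 h2 h3 h4 h5 h6
  rw [h5, Pi.add_apply, h6, Pi.smul_apply, h3, h4, h1, h2, smul_eq_mul, mul_comm,
    Complex.re_add_im]

theorem lpRe_smul (c : ℂ) (u : Lp ℂ 2 μ) :
    lpRe μ (c • u) = c.re • lpRe μ u - c.im • lpIm μ u := by
  refine Lp.ext ?_
  filter_upwards [coeFn_lpRe (c • u), coeFn_lpRe u, coeFn_lpIm u, Lp.coeFn_smul c u,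
    Lp.coeFn_sub (c.re • lpRe μ u) (c.im • lpIm μ u), Lp.coeFn_smul c.re (lpRe μ u),
    Lp.coeFn_smul c.im (lpIm μ u)] with x h1 h2 h3 h4 h5 h6 h7
  rw [h1, h4, h5, Pi.sub_apply, h6, h7]
  simp [h2, h3]

theorem lpIm_smul (c : ℂ) (u : Lp ℂ 2 μ) :
    lpIm μ (c • u) = c.re • lpIm μ u + c.im • lpRe μ u := by
  refine Lp.ext ?_
  filter_upwards [coeFn_lpIm (c • u), coeFn_lpRe u, coeFn_lpIm u, Lp.coeFn_smul c u,
    Lp.coeFn_add (c.re • lpIm μ u) (c.im • lpRe μ u), Lp.coeFn_smul c.re (lpIm μ u),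
    Lp.coeFn_smul c.im (lpRe μ u)] with x h1 h2 h3 h4 h5 h6 h7
  rw [h1, h4, h5, Pi.add_apply, h6, h7]
  simp [h2, h3]

theorem lpOfReal_smul (r : ℝ) (f : Lp ℝ 2 μ) : lpOfReal μ (r • f) = (r : ℂ) • lpOfReal μ f := by
  refine Lp.ext ?_
  filter_upwards [coeFn_lpOfReal (r • f), coeFn_lpOfReal f, Lp.coeFn_smul r f,
    Lp.coeFn_smul (r : ℂ) (lpOfReal μ f)] with x h1 h2 h3 h4
  rw [h1, h4, Pi.smul_apply, h2, h3]
  simp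

theorem inner_lpOfReal (f g : Lp ℝ 2 μ) :
    inner ℂ (lpOfReal μ f) (lpOfReal μ g) = ((inner ℝ f g : ℝ) : ℂ) := by
  rw [L2.inner_def, L2.inner_def, ← integral_complex_ofReal]
  refine integral_congr_ae ?_
  filter_upwards [coeFn_lpOfReal f, coeFn_lpOfReal g] with x h1 h2
  rw [h1, h2]
  simp

/-- The complex linear extension of an operator on real `L²`. -/
def complexify (S : Lp ℝ 2 μ →L[ℝ] Lp ℝ 2 μ) : Lp ℂ 2 μ →L[ℂ] Lp ℂ 2 μ where
  toFun u := lpOfReal μ (S (lpRe μ u)) + Complex.I • lpOfReal μ (S (lpIm μ u))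
  map_add' u v := by
    simp only [map_add, smul_add]
    abel
  map_smul' c u := by
    have hS : ∀ (r : ℝ) (f : Lp ℝ 2 μ), lpOfReal μ (S (r • f)) = (r : ℂ) • lpOfReal μ (S f) :=
      fun r f => by rw [map_smul, lpOfReal_smul]
    simp only [lpRe_smul, lpIm_smul, map_add, map_sub, hS, RingHom.id_apply]
    generalize lpOfReal μ (S (lpRe μ u)) = X
    generalize lpOfReal μ (S (lpIm μ u)) = Y
    conv_rhs => rw [← Complex.re_add_im c]
    match_scalars
    · ring
    · linear_combination (-(c.im : ℂ)) * Complex.I_mul_I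
  cont := by fun_prop

theorem complexify_lpOfReal (S : Lp ℝ 2 μ →L[ℝ] Lp ℝ 2 μ) (f : Lp ℝ 2 μ) :
    complexify S (lpOfReal μ f) = lpOfReal μ (S f) := by
  change lpOfReal μ (S (lpRe μ (lpOfReal μ f))) + Complex.I • lpOfReal μ (S (lpIm μ _)) = _
  rw [lpRe_lpOfReal, lpIm_lpOfReal]
  simp

/-- The cross terms between the real and imaginary parts cancel by symmetry of `S`, so the quadratic
form is real. -/
theorem inner_complexify_self {S : Lp ℝ 2 μ →L[ℝ] Lp ℝ 2 μ}
    (hS : ∀ f g, inner ℝ (S f) g = inner ℝ f (S g)) (u : Lp ℂ 2 μ) :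
    inner ℂ u (complexify S u)
      = ((inner ℝ (lpRe μ u) (S (lpRe μ u)) + inner ℝ (lpIm μ u) (S (lpIm μ u)) : ℝ) : ℂ) := by
  conv_lhs => rw [eq_lpOfReal_add u]
  simp only [map_add, map_smul, complexify_lpOfReal, inner_add_left, inner_add_right,
    inner_smul_left, inner_smul_right, inner_lpOfReal, Complex.conj_I]
  rw [← hS (lpIm μ u) (lpRe μ u), real_inner_comm (lpRe μ u)]
  push_cast
  ring_nf
  simp

theorem inner_self_eq_ofReal (u : Lp ℂ 2 μ) : inner ℂ u u = ((‖u‖ ^ 2 : ℝ) : ℂ) := by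
  rw [inner_self_eq_norm_sq_to_K]
  push_cast
  rfl

theorem norm_sq_eq_lpRe_add_lpIm (u : Lp ℂ 2 μ) :
    ‖u‖ ^ 2 = ‖lpRe μ u‖ ^ 2 + ‖lpIm μ u‖ ^ 2 := by
  have h := inner_complexify_self (S := 1) (fun _ _ => rfl) u
  have h1 : complexify 1 u = u := (eq_lpOfReal_add u).symm
  rw [h1, inner_self_eq_ofReal] at h
  simp only [one_apply_eq_self, real_inner_self_eq_norm_sq] at h
  exact_mod_cast h

/-- The quadratic form of `S - 1` is real and nonpositive, so multiplying it by `ζ` with `Re ζ ≥ 0`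
leaves the real part nonpositive. Hence `‖exp (s A) u‖²` is decreasing in `s`. -/
theorem norm_exp_complexify_apply_le {S : Lp ℝ 2 μ →L[ℝ] Lp ℝ 2 μ}
    (hS : ∀ f g, inner ℝ (S f) g = inner ℝ f (S g)) (hS1 : ‖S‖ ≤ 1) {ζ : ℂ} (hζ : 0 ≤ ζ.re)
    (u : Lp ℂ 2 μ) : ‖exp (ζ • (complexify S - 1)) u‖ ≤ ‖u‖ := by
  set A := ζ • (complexify S - 1) with hA
  have hdiss : ∀ w : Lp ℂ 2 μ, (inner ℂ w (A w)).re ≤ 0 := by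
    intro w
    have h1 : inner ℂ w (A w) = ζ * (((inner ℝ (lpRe μ w) (S (lpRe μ w))
        + inner ℝ (lpIm μ w) (S (lpIm μ w)) - ‖w‖ ^ 2 : ℝ)) : ℂ) := by
      change inner ℂ w (ζ • (complexify S w - w)) = _
      rw [inner_smul_right, inner_sub_right, inner_complexify_self hS, inner_self_eq_ofReal]
      push_cast
      rfl
    rw [h1, Complex.re_mul_ofReal]
    refine mul_nonpos_of_nonneg_of_nonpos hζ ?_
    have h2 : ∀ f : Lp ℝ 2 μ, inner ℝ f (S f) ≤ ‖f‖ ^ 2 := fun f => by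
      refine (real_inner_le_norm _ _).trans ?_
      rw [sq]
      refine mul_le_mul_of_nonneg_left ?_ (norm_nonneg _)
      simpa using S.le_of_opNorm_le hS1 f
    rw [norm_sq_eq_lpRe_add_lpIm]
    linarith [h2 (lpRe μ w), h2 (lpIm μ w)]
  have hder : ∀ s : ℝ, HasDerivAt (fun s : ℝ => exp ((s : ℂ) • A) u)
      (A (exp ((s : ℂ) • A) u)) s := fun s => by
    have := ((hasDerivAt_exp_smul_const' (𝕂 := ℂ) A (s : ℂ)).clm_apply
      (hasDerivAt_const (s : ℂ) u)).scomp s Complex.ofRealCLM.hasDerivAt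
    refine this.congr_deriv ?_
    simp
  have hanti : Antitone fun s : ℝ => (inner ℂ (exp ((s : ℂ) • A) u) (exp ((s : ℂ) • A) u)).re := by
    have hd : ∀ s : ℝ, HasDerivAt
        (fun s : ℝ => (inner ℂ (exp ((s : ℂ) • A) u) (exp ((s : ℂ) • A) u)).re)
        ((inner ℂ (exp ((s : ℂ) • A) u) (A (exp ((s : ℂ) • A) u))
          + inner ℂ (A (exp ((s : ℂ) • A) u)) (exp ((s : ℂ) • A) u)).re) s := fun s =>
      Complex.reCLM.hasFDerivAt.comp_hasDerivAt s ((hder s).inner ℂ (hder s))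
    refine antitone_of_deriv_nonpos (fun s => (hd s).differentiableAt) fun s => ?_
    rw [(hd s).deriv, Complex.add_re]
    have h2 := hdiss (exp ((s : ℂ) • A) u)
    have h3 : (inner ℂ (A (exp ((s : ℂ) • A) u)) (exp ((s : ℂ) • A) u)).re
        = (inner ℂ (exp ((s : ℂ) • A) u) (A (exp ((s : ℂ) • A) u))).re := inner_re_symm (𝕜 := ℂ) _ _
    linarith
  have h := hanti zero_le_one
  simp only [inner_self_eq_ofReal, Complex.ofReal_re, Complex.ofReal_zero, Complex.ofReal_one, zero_smul,
    one_smul, exp_zero, one_apply_eq_self] at h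
  exact le_of_sq_le_sq h (norm_nonneg _)

theorem exp_complexify_lpOfReal (S : Lp ℝ 2 μ →L[ℝ] Lp ℝ 2 μ) (r : ℝ) (f : Lp ℝ 2 μ) :
    exp ((r : ℂ) • (complexify S - 1)) (lpOfReal μ f) = lpOfReal μ (exp (r • (S - 1)) f) := by
  have hpow : ∀ n : ℕ, (((r : ℂ) • (complexify S - 1)) ^ n) (lpOfReal μ f)
      = lpOfReal μ (((r • (S - 1)) ^ n) f) := by
    intro n
    induction n with
    | zero => simp
    | succ n ih =>
      rw [pow_succ', pow_succ']
      change ((r : ℂ) • (complexify S - 1)) ((((r : ℂ) • (complexify S - 1)) ^ n) (lpOfReal μ f))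
        = lpOfReal μ (r • (S (((r • (S - 1)) ^ n) f) - ((r • (S - 1)) ^ n) f))
      rw [ih, lpOfReal_smul, map_sub, ← complexify_lpOfReal S]
      rfl
  have h1 := (exp_series_hasSum_exp' (𝕂 := ℂ) ((r : ℂ) • (complexify S - 1))).mapL
    (ContinuousLinearMap.apply ℂ _ (lpOfReal μ f))
  have h2 := ((exp_series_hasSum_exp' (𝕂 := ℝ) (r • (S - 1))).mapL
    (ContinuousLinearMap.apply ℝ _ f)).mapL (lpOfReal μ)
  refine h1.unique ?_
  convert h2 using 2 with n
  · change ((n.factorial : ℂ)⁻¹) • (((r : ℂ) • (complexify S - 1)) ^ n) (lpOfReal μ f)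
      = lpOfReal μ (((n.factorial : ℝ)⁻¹) • ((r • (S - 1)) ^ n) f)
    rw [hpow, lpOfReal_smul]
    push_cast
    rfl
  · rfl

end Complexification

/-! ### Matrix elements between systems of indicator functions -/

section StepSystems

open NormedSpace DirichletForm

variable {E : Type*} [MeasurableSpace E] {μ : Measure E} {ι κ : Type*}

/-- A finite system of indicator functions of disjoint sets of measures `α i`. -/
structure IsStepSystem [Fintype ι] (e : ι → Lp ℝ 2 μ) (α : ι → ℝ) : Prop where
  inner_eq : ∀ i, inner ℝ (e i) (e i) = α i
  inner_ne : ∀ i j, i ≠ j → inner ℝ (e i) (e j) = 0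
  mem : ∀ i, e i ∈ unitOrderInterval μ
  sum_mem : ∑ i, e i ∈ unitOrderInterval μ
  inner_le : ∀ i, ∀ w ∈ unitOrderInterval μ, inner ℝ w (e i) ≤ α i

/-- A symmetric sub-Markov contraction of `L²`. -/
structure IsSymmSubMarkov (S : Lp ℝ 2 μ →L[ℝ] Lp ℝ 2 μ) : Prop where
  symm : ∀ f g, inner ℝ (S f) g = inner ℝ f (S g)
  contraction : ‖S‖ ≤ 1
  mem : ∀ f ∈ unitOrderInterval μ, S f ∈ unitOrderInterval μ

theorem convex_unitOrderInterval : Convex ℝ (unitOrderInterval μ) := by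
  intro f hf g hg a b ha hb hab
  filter_upwards [hf, hg, Lp.coeFn_add (a • f) (b • g), Lp.coeFn_smul a f, Lp.coeFn_smul b g]
    with x h1 h2 h3 h4 h5
  rw [h3, Pi.add_apply, h4, h5, Pi.smul_apply, Pi.smul_apply, smul_eq_mul, smul_eq_mul]
  have := mul_le_mul_of_nonneg_left h1.2 ha
  have := mul_le_mul_of_nonneg_left h2.2 hb
  exact ⟨add_nonneg (mul_nonneg ha h1.1) (mul_nonneg hb h2.1), by linarith⟩

theorem isClosed_unitOrderInterval : IsClosed (unitOrderInterval μ) := by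
  refine IsSeqClosed.isClosed fun f g hf hfg => ?_
  obtain ⟨φ, -, hφ⟩ := (tendstoInMeasure_of_tendsto_Lp hfg).exists_seq_tendsto_ae
  have h : ∀ᵐ x ∂μ, ∀ n, 0 ≤ f n x ∧ f n x ≤ 1 := ae_all_iff.2 hf
  filter_upwards [hφ, h] with x h1 h2
  exact ⟨ge_of_tendsto' h1 fun n => (h2 _).1, le_of_tendsto' h1 fun n => (h2 _).2⟩

theorem zero_mem_unitOrderInterval : (0 : Lp ℝ 2 μ) ∈ unitOrderInterval μ := by
  filter_upwards [Lp.coeFn_zero ℝ 2 μ] with x hx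
  rw [hx]
  simp

theorem inner_nonneg_of_mem {f g : Lp ℝ 2 μ} (hf : f ∈ unitOrderInterval μ)
    (hg : g ∈ unitOrderInterval μ) : 0 ≤ inner ℝ f g := by
  rw [L2.inner_def]
  refine integral_nonneg_of_ae ?_
  filter_upwards [hf, hg] with x h1 h2
  exact mul_nonneg h2.1 h1.1

theorem IsSymmSubMarkov.exp {S : Lp ℝ 2 μ →L[ℝ] Lp ℝ 2 μ} (hS : IsSymmSubMarkov S) {r : ℝ}
    (hr : 0 ≤ r) : IsSymmSubMarkov (NormedSpace.exp (r • (S - 1))) where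
  symm := by
    have h1 : IsSelfAdjoint (r • (S - 1)) := by
      refine IsSelfAdjoint.smul (IsSelfAdjoint.all r) (IsSelfAdjoint.sub ?_ (IsSelfAdjoint.one _))
      exact (ContinuousLinearMap.isSelfAdjoint_iff_isSymmetric).2 hS.symm
    exact ContinuousLinearMap.isSelfAdjoint_iff_isSymmetric.1 h1.exp
  contraction := ContinuousLinearMap.opNorm_le_bound _ zero_le_one fun f => by
    simpa using norm_exp_smul_sub_one_apply_le hS.contraction hr f
  mem f hf := exp_smul_sub_one_mem convex_unitOrderInterval isClosed_unitOrderInterval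
    zero_mem_unitOrderInterval hS.mem hr hf

theorem IsStepSystem.norm_sum_sq [Fintype ι] {e : ι → Lp ℝ 2 μ} {α : ι → ℝ} (he : IsStepSystem e α)
    (a : ι → ℂ) : ‖∑ i, a i • lpOfReal μ (e i)‖ ^ 2 = ∑ i, ‖a i‖ ^ 2 * α i := by
  classical
  have h : inner ℂ (∑ i, a i • lpOfReal μ (e i)) (∑ i, a i • lpOfReal μ (e i))
      = ((∑ i, ‖a i‖ ^ 2 * α i : ℝ) : ℂ) := by
    rw [sum_inner]
    push_cast
    refine Finset.sum_congr rfl fun i _ => ?_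
    rw [inner_sum, Finset.sum_eq_single i]
    · rw [inner_smul_left, inner_smul_right, inner_lpOfReal, he.inner_eq, ← mul_assoc,
        Complex.conj_mul']
    · intro j _ hj
      rw [inner_smul_left, inner_smul_right, inner_lpOfReal, he.inner_ne i j hj.symm]
      simp
    · simp
  rw [inner_self_eq_ofReal] at h
  exact_mod_cast h

/-- The `L¹` bound by duality with `L^∞`: all terms are nonnegative, and by symmetry their sum is
the pairing of `e i` with the image of `∑ e' j`, a function with values in `[0, 1]`. -/
theorem IsSymmSubMarkov.sum_inner_le [Fintype ι] [Fintype κ] {S : Lp ℝ 2 μ →L[ℝ] Lp ℝ 2 μ} (hS : IsSymmSubMarkov S)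
    {e : ι → Lp ℝ 2 μ} {α : ι → ℝ} (he : IsStepSystem e α) {e' : κ → Lp ℝ 2 μ} {β : κ → ℝ}
    (he' : IsStepSystem e' β) (i : ι) : ∑ j, |inner ℝ (e' j) (S (e i))| ≤ α i := by
  have h1 : ∀ j, |inner ℝ (e' j) (S (e i))| = inner ℝ (e' j) (S (e i)) := fun j =>
    abs_of_nonneg (inner_nonneg_of_mem (he'.mem j) (hS.mem _ (he.mem i)))
  simp only [h1]
  rw [← sum_inner, ← hS.symm]
  exact he.inner_le i _ (hS.mem _ he'.sum_mem)

/-- The matrix of the semigroup `exp (ζ c (S - 1))` with respect to two step systems. -/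
def stepMatrix (S : Lp ℝ 2 μ →L[ℝ] Lp ℝ 2 μ) (c : ℝ) (e : ι → Lp ℝ 2 μ) (e' : κ → Lp ℝ 2 μ)
    (i : ι) (j : κ) (ζ : ℂ) : ℂ :=
  inner ℂ (lpOfReal μ (e' j)) (NormedSpace.exp ((ζ * c) • (complexify S - 1)) (lpOfReal μ (e i)))

theorem stepMatrix_ofReal (S : Lp ℝ 2 μ →L[ℝ] Lp ℝ 2 μ) (c : ℝ) (e : ι → Lp ℝ 2 μ)
    (e' : κ → Lp ℝ 2 μ) (i : ι) (j : κ) (t : ℝ) : stepMatrix S c e e' i j t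
      = ((inner ℝ (e' j) (NormedSpace.exp ((t * c) • (S - 1)) (e i)) : ℝ) : ℂ) := by
  rw [stepMatrix, ← Complex.ofReal_mul, exp_complexify_lpOfReal, inner_lpOfReal]

theorem differentiable_stepMatrix (S : Lp ℝ 2 μ →L[ℝ] Lp ℝ 2 μ) (c : ℝ) (e : ι → Lp ℝ 2 μ)
    (e' : κ → Lp ℝ 2 μ) (i : ι) (j : κ) : Differentiable ℂ (stepMatrix S c e e' i j) := by
  have h : Differentiable ℂ fun w : ℂ => NormedSpace.exp (w • (complexify S - 1)) := fun w =>
    (hasDerivAt_exp_smul_const (𝕂 := ℂ) (complexify S - 1) w).differentiableAt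
  have h2 : Differentiable ℂ fun ζ : ℂ => NormedSpace.exp ((ζ * c) • (complexify S - 1)) :=
    h.comp (by fun_prop)
  exact (innerSL ℂ (lpOfReal μ (e' j))).differentiable.comp
    (h2.clm_apply (differentiable_const _))

theorem sum_stepMatrix_ofReal [Fintype ι] [Fintype κ] (S : Lp ℝ 2 μ →L[ℝ] Lp ℝ 2 μ) (c : ℝ)
    (e : ι → Lp ℝ 2 μ) (e' : κ → Lp ℝ 2 μ) (a : ι → ℝ) (b : κ → ℝ) (t : ℝ) :
    ∑ i, ∑ j, (a i : ℂ) * b j * stepMatrix S c e e' i j t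
      = ((inner ℝ (NormedSpace.exp ((t * c) • (S - 1)) (∑ i, a i • e i)) (∑ j, b j • e' j) : ℝ)
        : ℂ) := by
  simp only [stepMatrix_ofReal, map_sum, map_smul, sum_inner, inner_sum, inner_smul_left,
    inner_smul_right, Finset.mul_sum]
  refine Finset.sum_comm.trans ?_
  push_cast
  refine Finset.sum_congr rfl fun j _ => Finset.sum_congr rfl fun i _ => ?_
  rw [real_inner_comm]
  simp only [conj_trivial]
  ring

theorem IsSymmSubMarkov.norm_sum_stepMatrix_le [Fintype ι] [Fintype κ] {S : Lp ℝ 2 μ →L[ℝ] Lp ℝ 2 μ}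
    (hS : IsSymmSubMarkov S) {c : ℝ} (hc : 0 ≤ c) {e : ι → Lp ℝ 2 μ} {α : ι → ℝ}
    (he : IsStepSystem e α) {e' : κ → Lp ℝ 2 μ} {β : κ → ℝ} (he' : IsStepSystem e' β) {p q : ℝ}
    (hpq : p.HolderConjugate q) (hp2 : p ≤ 2) {ζ : ℂ} (hζ : |ζ.arg| ≤ Real.pi / q)
    {a : ι → ℝ} {b : κ → ℝ} (ha : ∀ i, a i ≠ 0) (hb : ∀ j, b j ≠ 0) :
    ‖∑ i, ∑ j, (a i : ℂ) * b j * stepMatrix S c e e' i j ζ‖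
      ≤ (∑ i, |a i| ^ p * α i) ^ (1 / p) * (∑ j, |b j| ^ q * β j) ^ (1 / q) := by
  refine norm_sum_le_of_interpolation (differentiable_stepMatrix S c e e')
    (fun j => ?_) (fun t ht i => ?_) (fun ζ hζ a b => ?_) hpq hp2 hζ ha hb
  · rw [← he'.inner_eq]
    exact real_inner_self_nonneg
  · simp only [stepMatrix_ofReal, Complex.norm_real, Real.norm_eq_abs]
    exact (hS.exp (mul_nonneg ht hc)).sum_inner_le he he' i
  -- The coefficients `b j` are conjugated because the inner product is conjugate linear in its
  -- first argument; their norms do not change.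
  · have h1 : ∑ i, ∑ j, a i * b j * stepMatrix S c e e' i j ζ
        = inner ℂ (∑ j, (starRingEnd ℂ) (b j) • lpOfReal μ (e' j))
          (NormedSpace.exp ((ζ * c) • (complexify S - 1)) (∑ i, a i • lpOfReal μ (e i))) := by
      simp only [stepMatrix, map_sum, map_smul, sum_inner, inner_sum, inner_smul_left,
        inner_smul_right, Complex.conj_conj]
      simp only [Finset.mul_sum]
      refine Finset.sum_congr rfl fun i _ => Finset.sum_congr rfl fun j _ => ?_
      ring
    have h3 : ∑ j, ‖b j‖ ^ 2 * β j
        = ‖∑ j, (starRingEnd ℂ) (b j) • lpOfReal μ (e' j)‖ ^ 2 := by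
      rw [he'.norm_sum_sq]
      simp only [RCLike.norm_conj]
    rw [h1, mul_comm (√_), ← he.norm_sum_sq, h3, Real.sqrt_sq (norm_nonneg _),
      Real.sqrt_sq (norm_nonneg _)]
    refine (norm_inner_le_norm _ _).trans (mul_le_mul_of_nonneg_left ?_ (norm_nonneg _))
    exact norm_exp_complexify_apply_le hS.symm hS.contraction
      (by rw [Complex.re_mul_ofReal]; exact mul_nonneg hζ hc) _

end StepSystems

open DirichletForm

/-! ### Simple functions as combinations of step systems -/

section SimpleFunctions

variable {E : Type*} [MeasurableSpace E] {μ : Measure E}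

theorem ne_zero_of_holderConjugate {p q : ℝ≥0∞} (h : p.toReal.HolderConjugate q.toReal) :
    p ≠ 0 := fun h0 => by simpa [h0] using h.pos

theorem ne_top_of_holderConjugate {p q : ℝ≥0∞} (h : p.toReal.HolderConjugate q.toReal) :
    p ≠ ∞ := fun h0 => by simpa [h0] using h.pos

/-- The nonzero values of a simple function. -/
abbrev nonzeroValues (s : SimpleFunc E ℝ) : Finset ℝ := s.range.filter (· ≠ 0)

/-- The indicator functions of the level sets of a simple function. -/
def stepIndicator {s : SimpleFunc E ℝ} (hs : MemLp s 2 μ) (y : nonzeroValues s) : Lp ℝ 2 μ :=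
  indicatorConstLp 2 (s.measurableSet_fiber y)
    (s.measure_preimage_lt_top_of_memLp two_ne_zero ENNReal.ofNat_ne_top hs y
      (Finset.mem_filter.1 y.2).2).ne (1 : ℝ)

theorem coeFn_stepIndicator {s : SimpleFunc E ℝ} (hs : MemLp s 2 μ) (y : nonzeroValues s) :
    stepIndicator hs y =ᵐ[μ] (s ⁻¹' {(y : ℝ)}).indicator fun _ => 1 :=
  indicatorConstLp_coeFn

theorem ae_forall_stepIndicator {s : SimpleFunc E ℝ} (hs : MemLp s 2 μ) :
    ∀ᵐ x ∂μ, ∀ y : nonzeroValues s,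
      stepIndicator hs y x = (s ⁻¹' {(y : ℝ)}).indicator (fun _ => (1 : ℝ)) x :=
  ae_all_iff.2 fun y => coeFn_stepIndicator hs y

theorem coeFn_sum_smul {ι : Type*} [Fintype ι] (a : ι → ℝ) (e : ι → Lp ℝ 2 μ) :
    ∀ᵐ x ∂μ, (∑ i, a i • e i : Lp ℝ 2 μ) x = ∑ i, a i * e i x := by
  have h1 := Lp.coeFn_finsetSum (μ := μ) (p := 2) Finset.univ fun i => a i • e i
  have h2 : ∀ᵐ x ∂μ, ∀ i, (a i • e i : Lp ℝ 2 μ) x = a i * e i x :=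
    ae_all_iff.2 fun i => Lp.coeFn_smul (a i) (e i)
  filter_upwards [h1, h2] with x h1 h2
  rw [h1, Finset.sum_apply]
  exact Finset.sum_congr rfl fun i _ => h2 i

/-- The general `c` serves two purposes: the identity recovers the simple function, and the
indicator of the nonzero numbers gives the sum of the step functions. -/
theorem sum_nonzeroValues_indicator {x : E} (s : SimpleFunc E ℝ) (c : ℝ → ℝ)
    (h0 : s x = 0 → c 0 = 0) :
    ∑ y : nonzeroValues s, c y * (s ⁻¹' {(y : ℝ)}).indicator (fun _ => (1 : ℝ)) x = c (s x) := by
  by_cases h : s x = 0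
  · rw [h, h0 h]
    refine Finset.sum_eq_zero fun y _ => ?_
    rw [Set.indicator_of_notMem, mul_zero]
    intro hy
    have : s x = y := hy
    exact (Finset.mem_filter.1 y.2).2 (this ▸ h)
  · rw [Finset.sum_eq_single ⟨s x, Finset.mem_filter.2 ⟨s.mem_range_self x, h⟩⟩]
    · rw [Set.indicator_of_mem (by rfl), mul_one]
    · intro y _ hy
      rw [Set.indicator_of_notMem, mul_zero]
      intro hy'
      exact hy (Subtype.ext (show (y : ℝ) = s x from (show s x = y from hy').symm))
    · simp

theorem isStepSystem_stepIndicator {s : SimpleFunc E ℝ} (hs : MemLp s 2 μ) :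
    IsStepSystem (stepIndicator hs) fun y => μ.real (s ⁻¹' {(y : ℝ)}) where
  inner_eq y := by
    have hfin := (s.measure_preimage_lt_top_of_memLp two_ne_zero ENNReal.ofNat_ne_top hs y
      (Finset.mem_filter.1 y.2).2).ne
    rw [stepIndicator, L2.inner_indicatorConstLp_indicatorConstLp _ _ hfin hfin]
    simp
  inner_ne y z hyz := by
    have hfin := fun y : nonzeroValues s => (s.measure_preimage_lt_top_of_memLp two_ne_zero
      ENNReal.ofNat_ne_top hs y (Finset.mem_filter.1 y.2).2).ne
    rw [stepIndicator, stepIndicator,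
      L2.inner_indicatorConstLp_indicatorConstLp _ _ (hfin y) (hfin z)]
    have : s ⁻¹' {(y : ℝ)} ∩ s ⁻¹' {(z : ℝ)} = ∅ := by
      rw [← Set.preimage_inter, Set.singleton_inter_eq_empty.2, Set.preimage_empty]
      exact fun h => hyz (Subtype.ext h)
    simp [this]
  mem y := by
    filter_upwards [coeFn_stepIndicator hs y] with x hx
    rw [hx]
    exact ⟨Set.indicator_nonneg (fun _ _ => zero_le_one) x,
      Set.indicator_le_self' (fun _ _ => zero_le_one) x⟩
  sum_mem := by
    filter_upwards [coeFn_sum_smul (fun _ => (1 : ℝ)) (stepIndicator hs),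
      ae_forall_stepIndicator hs] with x h1 h2
    simp only [one_smul] at h1
    rw [h1]
    simp only [h2]
    have h3 := sum_nonzeroValues_indicator (x := x) s (fun y => if y = 0 then 0 else 1) (by simp)
    rw [Finset.sum_congr rfl fun y _ => by rw [if_neg (Finset.mem_filter.1 y.2).2]] at h3
    rw [h3]
    split_ifs <;> simp
  inner_le y w hw := by
    have hfin : μ (s ⁻¹' {(y : ℝ)}) < ∞ := s.measure_preimage_lt_top_of_memLp two_ne_zero
      ENNReal.ofNat_ne_top hs y (Finset.mem_filter.1 y.2).2
    rw [real_inner_comm, stepIndicator, L2.inner_indicatorConstLp_one]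
    have : IsFiniteMeasure (μ.restrict (s ⁻¹' {(y : ℝ)})) := ⟨by simpa using hfin⟩
    have h1 : ∫ x in s ⁻¹' {(y : ℝ)}, w x ∂μ ≤ ∫ _ in s ⁻¹' {(y : ℝ)}, (1 : ℝ) ∂μ := by
      refine integral_mono_of_nonneg ?_ (integrable_const _) ?_
      · filter_upwards [ae_restrict_of_ae hw] with x hx using hx.1
      · filter_upwards [ae_restrict_of_ae hw] with x hx using hx.2
    simpa using h1

theorem sum_smul_stepIndicator {s : SimpleFunc E ℝ} (hs : MemLp s 2 μ) :
    ∑ y : nonzeroValues s, (y : ℝ) • stepIndicator hs y = hs.toLp s := by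
  refine Lp.ext ?_
  filter_upwards [coeFn_sum_smul (fun y : nonzeroValues s => (y : ℝ)) (stepIndicator hs),
    ae_forall_stepIndicator hs, hs.coeFn_toLp] with x h1 h2 h3
  rw [h1, h3]
  simp only [h2]
  exact sum_nonzeroValues_indicator s (fun y => y) (fun _ => rfl)

theorem sum_rpow_measure_eq {s : SimpleFunc E ℝ} (hs : MemLp s 2 μ) {p : ℝ≥0∞} (hp0 : p ≠ 0)
    (hp : p ≠ ∞) : (∑ y : nonzeroValues s, |(y : ℝ)| ^ p.toReal * μ.real (s ⁻¹' {(y : ℝ)}))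
      ^ (1 / p.toReal) = (eLpNorm s p μ).toReal := by
  have hpr : 0 < p.toReal := ENNReal.toReal_pos hp0 hp
  rw [eLpNorm_eq_eLpNorm' hp0 hp, SimpleFunc.eLpNorm'_eq, ← ENNReal.toReal_rpow]
  congr 1
  have h1 : ∑ y ∈ s.range, ‖y‖ₑ ^ p.toReal * μ (s ⁻¹' {y})
      = ∑ y ∈ nonzeroValues s, ‖y‖ₑ ^ p.toReal * μ (s ⁻¹' {y}) := by
    refine (Finset.sum_filter_of_ne (p := (· ≠ 0)) fun y _ hy h => hy ?_).symm
    rw [h, enorm_zero, ENNReal.zero_rpow_of_pos hpr, zero_mul]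
  rw [h1, ENNReal.toReal_sum, Finset.sum_coe_sort (nonzeroValues s)
    fun y : ℝ => |y| ^ p.toReal * μ.real (s ⁻¹' {y})]
  · refine Finset.sum_congr rfl fun y _ => ?_
    rw [ENNReal.toReal_mul, ← ENNReal.toReal_rpow, toReal_enorm, Real.norm_eq_abs]
    rfl
  · intro y hy
    exact ENNReal.mul_ne_top (ENNReal.rpow_ne_top_of_nonneg hpr.le enorm_ne_top)
      (s.measure_preimage_lt_top_of_memLp two_ne_zero ENNReal.ofNat_ne_top hs y
        (Finset.mem_filter.1 hy).2).ne

end SimpleFunctions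

/-! ### Bounds on `L^p` tested against simple functions -/

section BilinearBounds

variable {E : Type*} [MeasurableSpace E] {μ : Measure E}

/-- `Q` is bounded by `M` from `L^p` to `L^p` when tested against simple functions. -/
def BilinearBound (Q : Lp ℝ 2 μ →L[ℝ] Lp ℝ 2 μ) (p q : ℝ≥0∞) (M : ℝ) : Prop :=
  ∀ (s s' : SimpleFunc E ℝ) (hs : MemLp s 2 μ) (hs' : MemLp s' 2 μ),
    |inner ℝ (Q (hs.toLp s)) (hs'.toLp s')|
      ≤ M * ((eLpNorm s p μ).toReal * (eLpNorm s' q μ).toReal)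

theorem BilinearBound.swap {Q : Lp ℝ 2 μ →L[ℝ] Lp ℝ 2 μ}
    (hQ : ∀ f g, inner ℝ (Q f) g = inner ℝ f (Q g)) {p q : ℝ≥0∞} {M : ℝ}
    (h : BilinearBound Q p q M) : BilinearBound Q q p M := fun s s' hs hs' => by
  rw [hQ, real_inner_comm, mul_comm (eLpNorm s q μ).toReal]
  exact h s' s hs' hs

/-- Each instance is an inequality between numbers whose left side is continuous under strong
convergence in `L²`; no convergence in `L^p` is needed. -/
theorem BilinearBound.of_tendsto {Q : ℕ → Lp ℝ 2 μ →L[ℝ] Lp ℝ 2 μ} {Q' : Lp ℝ 2 μ →L[ℝ] Lp ℝ 2 μ}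
    {p q : ℝ≥0∞} {M : ℝ} (h : ∀ n, BilinearBound (Q n) p q M)
    (hQ : ∀ f, Tendsto (fun n => Q n f) atTop (𝓝 (Q' f))) : BilinearBound Q' p q M :=
  fun s s' hs hs' => le_of_tendsto ((hQ _).inner tendsto_const_nhds).abs
    (Eventually.of_forall fun n => h n s s' hs hs')

variable {S : Lp ℝ 2 μ →L[ℝ] Lp ℝ 2 μ} {c : ℝ} {p q : ℝ≥0∞}

/-- The matrix element `⟨exp (ζ c (S - 1)) s, s'⟩` as an entire function of `ζ`. -/
theorem IsSymmSubMarkov.exists_entire (hS : IsSymmSubMarkov S) (hc : 0 ≤ c)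
    (hpq : p.toReal.HolderConjugate q.toReal) (hp2 : p.toReal ≤ 2) {s s' : SimpleFunc E ℝ}
    (hs : MemLp s 2 μ) (hs' : MemLp s' 2 μ) :
    ∃ φ : ℂ → ℂ, Differentiable ℂ φ ∧
      (∀ ζ : ℂ, |ζ.arg| ≤ Real.pi / q.toReal →
        ‖φ ζ‖ ≤ (eLpNorm s p μ).toReal * (eLpNorm s' q μ).toReal) ∧
      ∀ t : ℝ, φ t = ((inner ℝ (NormedSpace.exp ((t * c) • (S - 1)) (hs.toLp s)) (hs'.toLp s') : ℝ)
        : ℂ) := by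
  refine ⟨fun ζ => ∑ y : nonzeroValues s, ∑ z : nonzeroValues s', ((y : ℝ) : ℂ) * ((z : ℝ) : ℂ)
    * stepMatrix S c (stepIndicator hs) (stepIndicator hs') y z ζ, ?_, ?_, ?_⟩
  · exact Differentiable.fun_sum fun i _ => Differentiable.fun_sum fun j _ =>
      (differentiable_stepMatrix _ _ _ _ _ _).const_mul _
  · intro ζ hζ
    have h := hS.norm_sum_stepMatrix_le hc (isStepSystem_stepIndicator hs)
      (isStepSystem_stepIndicator hs') hpq hp2 hζ (a := fun y => (y : ℝ)) (b := fun z => (z : ℝ))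
      (fun y => (Finset.mem_filter.1 y.2).2) (fun z => (Finset.mem_filter.1 z.2).2)
    rwa [sum_rpow_measure_eq hs (ne_zero_of_holderConjugate hpq) (ne_top_of_holderConjugate hpq),
      sum_rpow_measure_eq hs' (ne_zero_of_holderConjugate hpq.symm)
        (ne_top_of_holderConjugate hpq.symm)] at h
  · intro t
    rw [← sum_smul_stepIndicator hs, ← sum_smul_stepIndicator hs']
    exact sum_stepMatrix_ofReal S c (stepIndicator hs) (stepIndicator hs') (fun y => (y : ℝ))
      (fun z => (z : ℝ)) t

/-- Half the sine of the angle of analyticity on `L^p` for `1 < p ≤ 2`, with `q` the conjugate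
exponent. -/
def sectorConst (q : ℝ≥0∞) : ℝ := Real.sin (Real.pi / q.toReal) / 2

theorem angle_bounds (hpq : p.toReal.HolderConjugate q.toReal) (hp2 : p.toReal ≤ 2) :
    0 < Real.pi / q.toReal ∧ Real.pi / q.toReal ≤ Real.pi / 2 := by
  have hq : 2 ≤ q.toReal := by
    have h3 : (2 : ℝ)⁻¹ ≤ p.toReal⁻¹ := inv_anti₀ hpq.pos hp2
    exact (inv_le_inv₀ hpq.symm.pos two_pos).1 (by linarith [hpq.inv_add_inv_eq_one])
  exact ⟨div_pos Real.pi_pos hpq.symm.pos,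
    div_le_div_of_nonneg_left Real.pi_pos.le two_pos hq⟩

theorem sectorConst_pos (hpq : p.toReal.HolderConjugate q.toReal) (hp2 : p.toReal ≤ 2) :
    0 < sectorConst q := by
  have h := angle_bounds hpq hp2
  have := Real.sin_pos_of_pos_of_lt_pi h.1 (by linarith [Real.pi_pos])
  unfold sectorConst
  positivity

theorem IsSymmSubMarkov.bilinearBound_exp (hS : IsSymmSubMarkov S) (hc : 0 ≤ c)
    (hpq : p.toReal.HolderConjugate q.toReal) (hp2 : p.toReal ≤ 2) {t : ℝ} (ht : 0 ≤ t) :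
    BilinearBound (NormedSpace.exp ((t * c) • (S - 1))) p q 1 := by
  intro s s' hs hs'
  obtain ⟨φ, -, h2, h3⟩ := hS.exists_entire hc hpq hp2 hs hs'
  have h := h2 t (by rw [Complex.arg_ofReal_of_nonneg ht, abs_zero]; exact (angle_bounds hpq hp2).1.le)
  rw [h3, Complex.norm_real, Real.norm_eq_abs] at h
  rwa [one_mul]

theorem IsSymmSubMarkov.bilinearBound_exp_sub (hS : IsSymmSubMarkov S) (hc : 0 ≤ c)
    (hpq : p.toReal.HolderConjugate q.toReal) (hp2 : p.toReal ≤ 2) {t h : ℝ} (ht : 0 < t)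
    (hh : 0 ≤ h) :
    BilinearBound (NormedSpace.exp (((t + h) * c) • (S - 1)) - NormedSpace.exp ((t * c) • (S - 1)))
      p q (h / (sectorConst q * t)) := by
  intro s s' hs hs'
  obtain ⟨φ, h1, h2, h3⟩ := hS.exists_entire hc hpq hp2 hs hs'
  have ha := angle_bounds hpq hp2
  have hφ := norm_sub_le_of_sector h1 ha.1 ha.2 h2 ht hh
  rw [h3, h3, ← Complex.ofReal_sub, Complex.norm_real, Real.norm_eq_abs, ← inner_sub_left] at hφ
  refine hφ.trans (le_of_eq ?_)
  rw [sectorConst]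
  ring

theorem IsSymmSubMarkov.bilinearBound_exp_slope (hS : IsSymmSubMarkov S) (hc : 0 ≤ c)
    (hpq : p.toReal.HolderConjugate q.toReal) (hp2 : p.toReal ≤ 2) {t h l : ℝ} (ht : 0 < t)
    (hh : 0 < h) (hl : 0 < l) :
    BilinearBound (h⁻¹ • (NormedSpace.exp (((t + h) * c) • (S - 1))
        - NormedSpace.exp ((t * c) • (S - 1)))
      - l⁻¹ • (NormedSpace.exp (((t + l) * c) • (S - 1)) - NormedSpace.exp ((t * c) • (S - 1))))
      p q (2 * (h + l) / (sectorConst q * t) ^ 2) := by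
  intro s s' hs hs'
  obtain ⟨φ, h1, h2, h3⟩ := hS.exists_entire hc hpq hp2 hs hs'
  have ha := angle_bounds hpq hp2
  have hφ := norm_slope_sub_slope_le_of_sector h1 ha.1 ha.2 h2 ht hh hl
  rw [h3, h3, h3, ← Complex.ofReal_sub, ← Complex.ofReal_sub, ← Complex.ofReal_inv,
    ← Complex.ofReal_inv, ← Complex.ofReal_mul, ← Complex.ofReal_mul, ← Complex.ofReal_sub,
    Complex.norm_real, Real.norm_eq_abs, ← inner_sub_left, ← inner_sub_left,
    ← real_inner_smul_left, ← real_inner_smul_left, ← inner_sub_left] at hφ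
  refine hφ.trans (le_of_eq ?_)
  rw [sectorConst]
  ring

end BilinearBounds

/-! ### Sub-Markovianity and analytic bounds for the semigroup of the form -/

section Semigroup

variable {E : Type*} [MeasurableSpace E] {μ : Measure E}
variable (𝓔 : DirichletForm μ)

theorem isSymmSubMarkov_smul_resolvent {a : ℝ} (ha : 0 < a) :
    IsSymmSubMarkov (a • 𝓔.resolvent a) where
  symm f g := by
    change inner ℝ (a • 𝓔.resolvent a f) g = inner ℝ f (a • 𝓔.resolvent a g)
    rw [real_inner_smul_left, real_inner_smul_right, 𝓔.inner_resolvent ha]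
  contraction := 𝓔.isResolventFamily.contraction a ha
  mem f hf := 𝓔.smul_resolvent_mem ha hf

theorem isContractionSemigroup_l2Semigroup : IsContractionSemigroup (l2Semigroup 𝓔) := by
  rw [𝓔.l2Semigroup_eq]
  exact 𝓔.isResolventFamily.isContractionSemigroup_semigroup

theorem tendsto_l2Semigroup (t : ℝ≥0) (f : Lp ℝ 2 μ) :
    Tendsto (fun n : ℕ => NormedSpace.exp ((t * ((n : ℝ) + 1)) •
      (((n : ℝ) + 1) • 𝓔.resolvent ((n : ℝ) + 1) - 1)) f) atTop (𝓝 (l2Semigroup 𝓔 t f)) := by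
  rw [𝓔.l2Semigroup_eq]
  simpa only [smul_yosida] using 𝓔.isResolventFamily.tendsto_semigroup t f

theorem isSymmSubMarkov_l2Semigroup (t : ℝ≥0) : IsSymmSubMarkov (l2Semigroup 𝓔 t) where
  symm f g := by
    refine tendsto_nhds_unique ((tendsto_l2Semigroup 𝓔 t f).inner tendsto_const_nhds) ?_
    refine (tendsto_const_nhds.inner (tendsto_l2Semigroup 𝓔 t g)).congr fun n => ?_
    exact (((isSymmSubMarkov_smul_resolvent 𝓔 (by positivity)).exp (by positivity)).symm f g).symm
  contraction := (isContractionSemigroup_l2Semigroup 𝓔).contraction t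
  mem f hf := isClosed_unitOrderInterval.mem_of_tendsto (tendsto_l2Semigroup 𝓔 t f)
    (Eventually.of_forall fun n =>
      ((isSymmSubMarkov_smul_resolvent 𝓔 (by positivity)).exp (by positivity)).mem f hf)

/-- The bounds on `L^p` of an analytic contraction semigroup, tested against simple functions. -/
structure AnalyticBounds (T : ℝ≥0 → Lp ℝ 2 μ →L[ℝ] Lp ℝ 2 μ) (p q : ℝ≥0∞) (C : ℝ) : Prop where
  contraction : ∀ t, BilinearBound (T t) p q 1
  lipschitz : ∀ t h : ℝ≥0, 0 < t → BilinearBound (T (t + h) - T t) p q (h / (C * t))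
  slope : ∀ t h l : ℝ≥0, 0 < t → 0 < h → 0 < l →
    BilinearBound ((h : ℝ)⁻¹ • (T (t + h) - T t) - (l : ℝ)⁻¹ • (T (t + l) - T t)) p q
      (2 * (h + l) / (C * t) ^ 2)

/-- A sector is invariant under multiplication of `ζ` by the positive factor `c = n + 1`, so the
bounds for the Yosida approximations are uniform in `n` and pass to the limit. -/
theorem analyticBounds_of_le_two {p q : ℝ≥0∞} (hpq : p.toReal.HolderConjugate q.toReal)
    (hp2 : p.toReal ≤ 2) : AnalyticBounds (l2Semigroup 𝓔) p q (sectorConst q) where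
  contraction t := by
    refine .of_tendsto (fun n => ?_) (tendsto_l2Semigroup 𝓔 t)
    exact (isSymmSubMarkov_smul_resolvent 𝓔 (by positivity)).bilinearBound_exp (by positivity)
      hpq hp2 t.coe_nonneg
  lipschitz t h ht := by
    refine .of_tendsto (fun n => (isSymmSubMarkov_smul_resolvent 𝓔
      (a := (n : ℝ) + 1) (by positivity)).bilinearBound_exp_sub (c := (n : ℝ) + 1) (by positivity)
      hpq hp2 (t := t) (h := h) ht h.coe_nonneg) fun f => ?_
    simp only [← NNReal.coe_add]
    exact (tendsto_l2Semigroup 𝓔 (t + h) f).sub (tendsto_l2Semigroup 𝓔 t f)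
  slope t h l ht hh hl := by
    refine .of_tendsto (fun n => (isSymmSubMarkov_smul_resolvent 𝓔
      (a := (n : ℝ) + 1) (by positivity)).bilinearBound_exp_slope (c := (n : ℝ) + 1)
      (by positivity) hpq hp2 (t := t) (h := h) (l := l) ht hh hl) fun f => ?_
    have h1 := tendsto_l2Semigroup 𝓔 t f
    have h2 := (((tendsto_l2Semigroup 𝓔 (t + h) f).sub h1).const_smul (h : ℝ)⁻¹).sub
      (((tendsto_l2Semigroup 𝓔 (t + l) f).sub h1).const_smul (l : ℝ)⁻¹)
    simp only [NNReal.coe_add] at h2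
    exact h2

/-- Interpolation covers `p ≤ 2`. For `p ≥ 2` the conjugate exponent is at most `2`, and symmetry of
the operators interchanges the two exponents. -/
theorem exists_analyticBounds {p q : ℝ≥0∞} (hpq : p.toReal.HolderConjugate q.toReal) :
    ∃ C > 0, AnalyticBounds (l2Semigroup 𝓔) p q C := by
  rcases le_total p.toReal 2 with hp2 | hp2
  · exact ⟨_, sectorConst_pos hpq hp2, analyticBounds_of_le_two 𝓔 hpq hp2⟩
  · have hq2 : q.toReal ≤ 2 := by
      have h3 : p.toReal⁻¹ ≤ (2 : ℝ)⁻¹ := inv_anti₀ two_pos hp2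
      exact (inv_le_inv₀ two_pos hpq.symm.pos).1 (by linarith [hpq.inv_add_inv_eq_one])
    have h := analyticBounds_of_le_two 𝓔 hpq.symm hq2
    have hs := fun t => (isSymmSubMarkov_l2Semigroup 𝓔 t).symm
    have hs2 : ∀ t h f g, inner ℝ ((l2Semigroup 𝓔 (t + h) - l2Semigroup 𝓔 t) f) g
        = inner ℝ f ((l2Semigroup 𝓔 (t + h) - l2Semigroup 𝓔 t) g) := fun t h f g => by
      rw [sub_apply, sub_apply, inner_sub_left, inner_sub_right, hs, hs]
    refine ⟨_, sectorConst_pos hpq.symm hq2, fun t => (h.contraction t).swap (hs t),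
      fun t r ht => (h.lipschitz t r ht).swap (hs2 t r),
      fun t r l ht hr hl => (h.slope t r l ht hr hl).swap fun f g => ?_⟩
    rw [sub_apply, sub_apply, smul_apply, smul_apply, smul_apply, smul_apply, inner_sub_left,
      inner_sub_right, real_inner_smul_left, real_inner_smul_left, real_inner_smul_right,
      real_inner_smul_right, hs2, hs2]

end Semigroup

/-! ### From tested bounds to norm bounds in `L^p` -/

section Duality

variable {E : Type*} [MeasurableSpace E] {μ : Measure E}

theorem memLp_of_memLp_simpleFunc {s : SimpleFunc E ℝ} {r r' : ℝ≥0∞} (hr0 : r ≠ 0) (hr : r ≠ ∞)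
    (hs : MemLp s r μ) (hr0' : r' ≠ 0) (hr' : r' ≠ ∞) : MemLp s r' μ :=
  (SimpleFunc.memLp_iff hr0' hr').2 ((SimpleFunc.memLp_iff hr0 hr).1 hs)

/-- The sequence is fixed before the exponent: the same simple functions converge in every `L^r`, `r
< ∞`, to which `f` belongs. This permits simultaneous limits in `L²` and `L^p`. -/
theorem exists_simpleFunc_tendsto {f : E → ℝ}
    (hf : Measurable f) :
    ∃ s : ℕ → SimpleFunc E ℝ, ∀ r : ℝ≥0∞, ∀ _ : Fact (1 ≤ r), r ≠ ∞ → ∀ hfr : MemLp f r μ,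
      ∃ hs : ∀ n, MemLp (s n) r μ, Tendsto (fun n => (hs n).toLp (s n)) atTop (𝓝 (hfr.toLp f)) := by
  refine ⟨fun n => SimpleFunc.approxOn f hf (Set.range f ∪ {0}) 0 (by simp) n,
    fun r _ hr hfr => ?_⟩
  exact ⟨SimpleFunc.memLp_approxOn_range hf hfr, SimpleFunc.tendsto_approxOn_range_Lp hr hf hfr⟩

theorem BilinearBound.abs_inner_le {Q : Lp ℝ 2 μ →L[ℝ] Lp ℝ 2 μ} {p q : ℝ≥0∞} {M : ℝ}
    (h : BilinearBound Q p q M) [Fact (1 ≤ p)] [Fact (1 ≤ q)] (hp : p ≠ ∞) (hq : q ≠ ∞)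
    {f g : Lp ℝ 2 μ} (hf : MemLp f p μ) (hg : MemLp g q μ) :
    |inner ℝ (Q f) g| ≤ M * ((eLpNorm f p μ).toReal * (eLpNorm g q μ).toReal) := by
  obtain ⟨s, hs⟩ := exists_simpleFunc_tendsto (μ := μ) (Lp.stronglyMeasurable f).measurable
  obtain ⟨s', hs'⟩ := exists_simpleFunc_tendsto (μ := μ) (Lp.stronglyMeasurable g).measurable
  obtain ⟨h1, h1'⟩ := hs 2 inferInstance ENNReal.ofNat_ne_top (Lp.memLp f)
  obtain ⟨h2, h2'⟩ := hs p inferInstance hp hf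
  obtain ⟨h3, h3'⟩ := hs' 2 inferInstance ENNReal.ofNat_ne_top (Lp.memLp g)
  obtain ⟨h4, h4'⟩ := hs' q inferInstance hq hg
  rw [Lp.toLp_coeFn] at h1' h3'
  have h2n := h2'.norm
  have h4n := h4'.norm
  simp only [Lp.norm_toLp] at h2n h4n
  exact le_of_tendsto_of_tendsto ((((Q.continuous.tendsto f).comp h1').inner h3').abs)
    ((h2n.mul h4n).const_mul M) (Eventually.of_forall fun n => h (s n) (s' n) (h1 n) (h3 n))

theorem rpow_inv_le_of_le_mul_rpow {P Q x M : ℝ} (hPQ : P.HolderConjugate Q) (hx : 0 ≤ x)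
    (hM : 0 ≤ M) (h : x ≤ M * x ^ (1 / Q)) : x ^ (1 / P) ≤ M := by
  rcases hx.eq_or_lt with rfl | hx
  · rw [Real.zero_rpow (one_div_ne_zero hPQ.ne_zero)]
    exact hM
  · have h1 : x = x ^ (1 / P) * x ^ (1 / Q) := by
      rw [← Real.rpow_add hx, one_div, one_div, hPQ.inv_add_inv_eq_one, Real.rpow_one]
    refine le_of_mul_le_mul_right ?_ (Real.rpow_pos_of_pos hx (1 / Q))
    rwa [← h1]

/-- The converse of Hölder's inequality for a function in `L²`. -/
theorem eLpNorm_le_of_abs_inner_le {p q : ℝ≥0∞} (hpq : p.toReal.HolderConjugate q.toReal)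
    {h : Lp ℝ 2 μ} {M : ℝ} (hM : 0 ≤ M)
    (H : ∀ g : Lp ℝ 2 μ, MemLp g q μ → |inner ℝ h g| ≤ M * (eLpNorm g q μ).toReal) :
    eLpNorm h p μ ≤ ENNReal.ofReal M := by
  set P := p.toReal with hP
  set Q := q.toReal with hQ
  have hP0 : 0 < P := hpq.pos
  have hQ0 : 0 < Q := hpq.symm.pos
  have hm : Measurable h := (Lp.stronglyMeasurable h).measurable
  -- On these sets `h` is bounded and bounded away from zero. They have finite measure because `h ∈
  -- L²`, and they exhaust the set where `h ≠ 0`.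
  let A : ℕ → Set E := fun n => {x | 1 / ((n : ℝ) + 1) ≤ |h x| ∧ |h x| ≤ n}
  have hAm : ∀ n, MeasurableSet (A n) := fun n =>
    (measurableSet_le measurable_const hm.abs).inter (measurableSet_le hm.abs measurable_const)
  have hAfin : ∀ n, μ (A n) < ∞ := fun n => by
    refine (measure_mono ?_).trans_lt ((Lp.memLp h).meas_ge_lt_top' two_ne_zero
      ENNReal.ofNat_ne_top (ε := ENNReal.ofReal (1 / ((n : ℝ) + 1)))
      (ENNReal.ofReal_pos.2 (by positivity)).ne')
    intro x hx
    change ENNReal.ofReal _ ≤ ‖h x‖ₑ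
    rw [← ofReal_norm, Real.norm_eq_abs]
    exact ENNReal.ofReal_le_ofReal hx.1
  -- The extremal function for Hölder's inequality, truncated to `A n`. With `I n` the integral of
  -- `|h| ^ P` over `A n`, pairing with `h` gives `I n` and the `L^q` norm is `I n ^ (1 / Q)`; as `I
  -- n` is finite, it can be cancelled.
  let G : ℕ → E → ℝ := fun n => (A n).indicator fun x => SignType.sign (h x) * |h x| ^ (P - 1)
  have hGm : Measurable fun x => (SignType.sign (h x) : ℝ) * |h x| ^ (P - 1) := by
    have : Measurable fun x : ℝ => ((SignType.sign x : SignType) : ℝ) := by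
      have : (fun x : ℝ => ((SignType.sign x : SignType) : ℝ))
          = fun x => if 0 < x then 1 else if x < 0 then -1 else 0 := by
        funext x
        simp only [sign_apply]
        split_ifs <;> simp
      rw [this]
      exact Measurable.ite measurableSet_Ioi measurable_const
        (Measurable.ite measurableSet_Iio measurable_const measurable_const)
    exact (this.comp hm).mul (hm.abs.pow_const _)
  have hP1 : 0 ≤ P - 1 := by linarith [hpq.lt]
  have hGmem : ∀ n, ∀ r : ℝ≥0∞, MemLp (G n) r μ := fun n r => by
    rw [memLp_indicator_iff_restrict (hAm n)]
    have : IsFiniteMeasure (μ.restrict (A n)) := ⟨by simpa using hAfin n⟩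
    refine MemLp.of_bound hGm.aestronglyMeasurable ((n : ℝ) ^ (P - 1)) ?_
    filter_upwards [ae_restrict_mem (hAm n)] with x hx
    rw [norm_mul, Real.norm_of_nonneg (by positivity : 0 ≤ |h x| ^ (P - 1))]
    have h1 : ‖((SignType.sign (h x) : SignType) : ℝ)‖ ≤ 1 := by
      rcases lt_trichotomy (h x) 0 with h' | h' | h' <;> simp [h']
    calc _ ≤ 1 * |h x| ^ (P - 1) := by gcongr
      _ ≤ _ := by rw [one_mul]; exact Real.rpow_le_rpow (abs_nonneg _) hx.2 hP1
  let I : ℕ → ℝ≥0∞ := fun n => ∫⁻ x in A n, ‖h x‖ₑ ^ P ∂μ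
  have hpos : ∀ n, ∀ x ∈ A n, 0 < |h x| := fun n x hx =>
    lt_of_lt_of_le (by positivity) hx.1
  have hIfin : ∀ n, I n ≠ ∞ := fun n => by
    refine ne_top_of_le_ne_top (b := ENNReal.ofReal n ^ P * μ (A n)) (ENNReal.mul_ne_top
      (ENNReal.rpow_ne_top_of_nonneg hP0.le ENNReal.ofReal_ne_top) (hAfin n).ne) ?_
    rw [← setLIntegral_const]
    refine setLIntegral_mono measurable_const fun x hx => ?_
    rw [← ofReal_norm, Real.norm_eq_abs]
    exact ENNReal.rpow_le_rpow (ENNReal.ofReal_le_ofReal hx.2) hP0.le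
  have hinner : ∀ n, inner ℝ h ((hGmem n 2).toLp (G n)) = (I n).toReal := fun n => by
    rw [L2.inner_def]
    have h1 : ∫ x, inner ℝ (h x) ((hGmem n 2).toLp (G n) x) ∂μ
        = ∫ x, (A n).indicator (fun x => |h x| ^ P) x ∂μ := by
      refine integral_congr_ae ?_
      filter_upwards [(hGmem n 2).coeFn_toLp] with x hx
      rw [hx]
      by_cases hxA : x ∈ A n
      · simp only [G, Set.indicator_of_mem hxA]
        change (SignType.sign (h x) * |h x| ^ (P - 1)) * h x = _
        rw [mul_right_comm, sign_mul_self, mul_comm, ← Real.rpow_add_one (hpos n x hxA).ne',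
          sub_add_cancel]
      · simp only [G, Set.indicator_of_notMem hxA, inner_zero_right]
    rw [h1, integral_indicator (hAm n), integral_eq_lintegral_of_nonneg_ae
      (Eventually.of_forall fun x => by positivity) (hm.abs.pow_const _).aestronglyMeasurable]
    congr 1
    refine lintegral_congr fun x => ?_
    rw [← ENNReal.ofReal_rpow_of_nonneg (abs_nonneg _) hP0.le, ← ofReal_norm,
      Real.norm_eq_abs]
  have hnorm : ∀ n, (eLpNorm (G n) q μ).toReal = (I n).toReal ^ (1 / Q) := fun n => by
    rw [eLpNorm_eq_lintegral_rpow_enorm_toReal (ne_zero_of_holderConjugate hpq.symm)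
      (ne_top_of_holderConjugate hpq.symm), ← ENNReal.toReal_rpow]
    congr 2
    simp only [I]
    rw [← lintegral_indicator (hAm n)]
    refine lintegral_congr fun x => ?_
    by_cases hxA : x ∈ A n
    · simp only [G, Set.indicator_of_mem hxA]
      have h1 : ‖((SignType.sign (h x) : SignType) : ℝ)‖ = 1 := by
        rcases lt_or_gt_of_ne (abs_pos.1 (hpos n x hxA)) with h' | h' <;> simp [h']
      rw [← ofReal_norm, ← ofReal_norm, norm_mul, h1, one_mul,
        Real.norm_of_nonneg (by positivity : 0 ≤ |h x| ^ (P - 1)),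
        ENNReal.ofReal_rpow_of_nonneg (by positivity) hQ0.le,
        ENNReal.ofReal_rpow_of_nonneg (norm_nonneg _) hP0.le, ← Real.rpow_mul (abs_nonneg _),
        hpq.sub_one_mul_conj, Real.norm_eq_abs]
    · simp only [G, Set.indicator_of_notMem hxA, enorm_zero]
      exact ENNReal.zero_rpow_of_pos hQ0
  have hIle : ∀ n, I n ≤ ENNReal.ofReal M ^ P := fun n => by
    have h1 := H ((hGmem n 2).toLp (G n)) (((hGmem n q).ae_eq (hGmem n 2).coeFn_toLp.symm))
    rw [hinner, eLpNorm_congr_ae (hGmem n 2).coeFn_toLp, hnorm,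
      abs_of_nonneg ENNReal.toReal_nonneg] at h1
    have h2 := rpow_inv_le_of_le_mul_rpow hpq ENNReal.toReal_nonneg hM h1
    rw [ENNReal.toReal_rpow] at h2
    have h3 := (ENNReal.le_ofReal_iff_toReal_le (ENNReal.rpow_ne_top_of_nonneg
      (by positivity) (hIfin n)) hM).2 h2
    have h4 := ENNReal.rpow_le_rpow h3 hP0.le
    rwa [← ENNReal.rpow_mul, one_div_mul_cancel hP0.ne', ENNReal.rpow_one] at h4
  have hsup : ∫⁻ x, ‖h x‖ₑ ^ P ∂μ ≤ ENNReal.ofReal M ^ P := by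
    have hmono : Monotone A := fun m n hmn x hx => by
      have hmn' : (m : ℝ) ≤ n := by exact_mod_cast hmn
      exact ⟨(one_div_le_one_div_of_le (by positivity) (by linarith)).trans hx.1,
        hx.2.trans hmn'⟩
    have h1 : ∫⁻ x, ‖h x‖ₑ ^ P ∂μ = ∫⁻ x in ⋃ n, A n, ‖h x‖ₑ ^ P ∂μ := by
      rw [← lintegral_indicator (MeasurableSet.iUnion hAm)]
      refine lintegral_congr fun x => ?_
      by_cases hx : h x = 0
      · by_cases hxA : x ∈ ⋃ n, A n
        · rw [Set.indicator_of_mem hxA]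
        · rw [Set.indicator_of_notMem hxA, hx, enorm_zero, ENNReal.zero_rpow_of_pos hP0]
      · rw [Set.indicator_of_mem]
        obtain ⟨m, hm⟩ := exists_nat_one_div_lt (abs_pos.2 hx)
        obtain ⟨k, hk⟩ := exists_nat_ge |h x|
        have hkx : |h x| ≤ ((max m k : ℕ) : ℝ) := hk.trans (by exact_mod_cast le_max_right m k)
        have hmx : 1 / (((max m k : ℕ) : ℝ) + 1) ≤ |h x| := by
          refine le_trans (one_div_le_one_div_of_le (by positivity) ?_) hm.le
          have : (m : ℝ) ≤ ((max m k : ℕ) : ℝ) := by exact_mod_cast le_max_left m k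
          linarith
        exact Set.mem_iUnion.2 ⟨max m k, hmx, hkx⟩
    rw [h1, setLIntegral_iUnion_of_directed _ hmono.directed_le]
    exact iSup_le hIle
  rw [eLpNorm_eq_lintegral_rpow_enorm_toReal (ne_zero_of_holderConjugate hpq)
    (ne_top_of_holderConjugate hpq)]
  refine (ENNReal.rpow_le_rpow hsup (by positivity)).trans (le_of_eq ?_)
  rw [← ENNReal.rpow_mul, mul_one_div_cancel hP0.ne', ENNReal.rpow_one]

theorem fact_one_le {p q : ℝ≥0∞} (hpq : p.toReal.HolderConjugate q.toReal) : Fact (1 ≤ p) :=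
  ⟨by
    rw [← ENNReal.ofReal_toReal (ne_top_of_holderConjugate hpq), ← ENNReal.ofReal_one]
    exact ENNReal.ofReal_le_ofReal hpq.lt.le⟩

theorem BilinearBound.eLpNorm_le {Q : Lp ℝ 2 μ →L[ℝ] Lp ℝ 2 μ} {p q : ℝ≥0∞} {M : ℝ}
    (h : BilinearBound Q p q M) (hM : 0 ≤ M) (hpq : p.toReal.HolderConjugate q.toReal)
    {f : Lp ℝ 2 μ} (hf : MemLp f p μ) :
    eLpNorm (Q f) p μ ≤ ENNReal.ofReal (M * (eLpNorm f p μ).toReal) := by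
  have := fact_one_le hpq
  have := fact_one_le hpq.symm
  refine eLpNorm_le_of_abs_inner_le hpq (by positivity) fun g hg => ?_
  rw [mul_assoc]
  exact h.abs_inner_le (ne_top_of_holderConjugate hpq) (ne_top_of_holderConjugate hpq.symm) hf hg

theorem BilinearBound.memLp {Q : Lp ℝ 2 μ →L[ℝ] Lp ℝ 2 μ} {p q : ℝ≥0∞} {M : ℝ}
    (h : BilinearBound Q p q M) (hM : 0 ≤ M) (hpq : p.toReal.HolderConjugate q.toReal)
    {f : Lp ℝ 2 μ} (hf : MemLp f p μ) : MemLp (Q f) p μ :=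
  ⟨Lp.aestronglyMeasurable _, (h.eLpNorm_le hM hpq hf).trans_lt ENNReal.ofReal_lt_top⟩

end Duality

/-! ### Extension of operators from `L² ∩ L^p` to `L^p` -/

section Extension

variable {E : Type*} [MeasurableSpace E] {μ : Measure E}
variable (p : ℝ≥0∞)

/-- The intersection of `L²` and `L^p`, as a subspace of `L²`. -/
def interLp (μ : Measure E) : Submodule ℝ (Lp ℝ 2 μ) where
  carrier := {f | MemLp f p μ}
  add_mem' {f g} hf hg := (MemLp.add hf hg).ae_eq (Lp.coeFn_add f g).symm
  zero_mem' := (MemLp.zero' (p := p)).ae_eq (Lp.coeFn_zero ℝ 2 μ).symm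
  smul_mem' c f hf := (MemLp.const_smul hf c).ae_eq (Lp.coeFn_smul c f).symm

theorem memLp_interLp {p : ℝ≥0∞} (f : interLp p μ) : MemLp (f : Lp ℝ 2 μ) p μ := f.2

/-- The embedding of `L² ∩ L^p` into `L^p`. -/
def interToLp (μ : Measure E) : interLp p μ →ₗ[ℝ] Lp ℝ p μ where
  toFun f := (memLp_interLp f).toLp
  map_add' f g := ((MemLp.toLp_congr _ ((memLp_interLp f).add (memLp_interLp g))
    (Lp.coeFn_add (f : Lp ℝ 2 μ) g)).trans (MemLp.toLp_add _ _))
  map_smul' c f := ((MemLp.toLp_congr _ ((memLp_interLp f).const_smul c)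
    (Lp.coeFn_smul c (f : Lp ℝ 2 μ))).trans (MemLp.toLp_const_smul c _))

variable {p}

theorem coeFn_interToLp (f : interLp p μ) : interToLp p μ f =ᵐ[μ] (f : Lp ℝ 2 μ) :=
  MemLp.coeFn_toLp (memLp_interLp f)

theorem norm_interToLp [Fact (1 ≤ p)] (f : interLp p μ) :
    ‖interToLp p μ f‖ = (eLpNorm (f : Lp ℝ 2 μ) p μ).toReal :=
  Lp.norm_toLp _ (memLp_interLp f)

theorem interToLp_eq {f : interLp p μ} {g : Lp ℝ p μ} (h : g =ᵐ[μ] (f : Lp ℝ 2 μ)) :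
    interToLp p μ f = g :=
  Lp.ext ((coeFn_interToLp f).trans h.symm)

/-- The class in `L² ∩ L^p` of a simple function. -/
def simpleInter {s : SimpleFunc E ℝ} (hs : MemLp s 2 μ) (hs' : MemLp s p μ) : interLp p μ :=
  ⟨hs.toLp s, hs'.ae_eq hs.coeFn_toLp.symm⟩

theorem interToLp_simpleInter {s : SimpleFunc E ℝ} (hs : MemLp s 2 μ) (hs' : MemLp s p μ) :
    interToLp p μ (simpleInter hs hs') = hs'.toLp s :=
  interToLp_eq (hs'.coeFn_toLp.trans hs.coeFn_toLp.symm)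

theorem dense_simple [Fact (1 ≤ p)] (hp : p ≠ ∞) : Dense {f : Lp ℝ p μ | ∃ (s : SimpleFunc E ℝ)
    (hs : MemLp s 2 μ) (hs' : MemLp s p μ), f = interToLp p μ (simpleInter hs hs')} := by
  intro f
  have hp0 : p ≠ 0 := (zero_lt_one.trans_le (Fact.out : (1 : ℝ≥0∞) ≤ p)).ne'
  obtain ⟨s, hs⟩ := exists_simpleFunc_tendsto (μ := μ) (Lp.stronglyMeasurable f).measurable
  obtain ⟨h1, h2⟩ := hs p inferInstance hp (Lp.memLp f)
  rw [Lp.toLp_coeFn] at h2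
  refine mem_closure_of_tendsto h2 (Eventually.of_forall fun n => ⟨s n,
    memLp_of_memLp_simpleFunc hp0 hp (h1 n) two_ne_zero ENNReal.ofNat_ne_top, h1 n, ?_⟩)
  rw [interToLp_simpleInter]

theorem denseRange_interToLp [Fact (1 ≤ p)] (hp : p ≠ ∞) : DenseRange (interToLp p μ) := by
  refine (dense_simple hp).mono ?_
  rintro _ ⟨s, hs, hs', rfl⟩
  exact ⟨_, rfl⟩

theorem exists_continuousLinearMap_of_denseRange {V X : Type*} [AddCommGroup V] [Module ℝ V]
    [NormedAddCommGroup X] [NormedSpace ℝ X] [CompleteSpace X] {e F : V →ₗ[ℝ] X}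
    (he : DenseRange e) {M : ℝ} (hF : ∀ f, ‖F f‖ ≤ M * ‖e f‖) :
    ∃ T : X →L[ℝ] X, ∀ f : V, T (e f) = F f :=
  ⟨F.extendOfNorm e, fun f => LinearMap.extendOfNorm_eq he ⟨M, hF⟩ f⟩

theorem exists_extension [Fact (1 ≤ p)] {Q : Lp ℝ 2 μ →L[ℝ] Lp ℝ 2 μ} {q : ℝ≥0∞} {M : ℝ}
    (h : BilinearBound Q p q M) (hM : 0 ≤ M) (hpq : p.toReal.HolderConjugate q.toReal) :
    ∃ T : Lp ℝ p μ →L[ℝ] Lp ℝ p μ, ∀ f : interLp p μ, T (interToLp p μ f) =ᵐ[μ] Q f := by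
  have hQ : ∀ f ∈ interLp p μ, Q f ∈ interLp p μ := fun f hf => h.memLp hM hpq hf
  let R : interLp p μ →ₗ[ℝ] interLp p μ := (Q : Lp ℝ 2 μ →ₗ[ℝ] Lp ℝ 2 μ).restrict hQ
  let F : interLp p μ →ₗ[ℝ] Lp ℝ p μ := (interToLp p μ).comp R
  have hF : ∀ f, ‖F f‖ ≤ M * ‖interToLp p μ f‖ := fun f => by
    rw [norm_interToLp]
    have h1 : F f = interToLp p μ (R f) := rfl
    rw [h1, norm_interToLp]
    exact ENNReal.toReal_le_of_le_ofReal (by positivity) (h.eLpNorm_le hM hpq (memLp_interLp f))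
  obtain ⟨T, hT⟩ := exists_continuousLinearMap_of_denseRange
    (denseRange_interToLp (ne_top_of_holderConjugate hpq)) hF
  exact ⟨T, fun f => by rw [hT]; exact coeFn_interToLp (R f)⟩

/-- A bound on `L^p` for an extension, from the bound tested against simple functions. -/
theorem BilinearBound.norm_le [Fact (1 ≤ p)] {Q : Lp ℝ 2 μ →L[ℝ] Lp ℝ 2 μ} {q : ℝ≥0∞} {M : ℝ}
    (h : BilinearBound Q p q M) (hM : 0 ≤ M) (hpq : p.toReal.HolderConjugate q.toReal)
    {T : Lp ℝ p μ →L[ℝ] Lp ℝ p μ} (hT : ∀ f : interLp p μ, T (interToLp p μ f) =ᵐ[μ] Q f)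
    (f : Lp ℝ p μ) : ‖T f‖ ≤ M * ‖f‖ := by
  refine (denseRange_interToLp (ne_top_of_holderConjugate hpq)).induction_on
    (p := fun f => ‖T f‖ ≤ M * ‖f‖) f (isClosed_le (by fun_prop) (by fun_prop)) fun g => ?_
  have h1 : T (interToLp p μ g) = interToLp p μ ⟨Q g, h.memLp hM hpq (memLp_interLp g)⟩ :=
    (interToLp_eq (hT g)).symm
  rw [h1, norm_interToLp, norm_interToLp]
  exact ENNReal.toReal_le_of_le_ofReal (by positivity) (h.eLpNorm_le hM hpq (memLp_interLp g))

end Extension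

/-! ### Interpolation of convergence between `L²` and `L^p` -/

section StrongContinuity

variable {E : Type*} [MeasurableSpace E] {μ : Measure E}

/-- Every `p ∈ (1, ∞)` lies between `2` and some `p' ∈ (1, ∞)`, and differs from `p'`. -/
theorem exists_exponent {p : ℝ} (hp : 1 < p) :
    ∃ p' a b : ℝ, 1 < p' ∧ 0 ≤ a ∧ 0 < b ∧ a + b = 1 ∧ p = p' * a + 2 * b := by
  rcases le_total 2 p with h | h
  -- Here `p' = p + 1` lies beyond `p`; in the other case `p'` is the midpoint of `1` and `p`. The
  -- weight `b` of the exponent `2` is positive in both cases.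
  · refine ⟨p + 1, (p - 2) / (p - 1), 1 / (p - 1), by linarith,
      div_nonneg (by linarith) (by linarith), one_div_pos.2 (by linarith), ?_, ?_⟩
    all_goals
      have : p - 1 ≠ 0 := by linarith
      field_simp
      ring
  · refine ⟨(1 + p) / 2, 2 * (2 - p) / (3 - p), (p - 1) / (3 - p), by linarith,
      div_nonneg (by linarith) (by linarith), div_pos (by linarith) (by linarith), ?_, ?_⟩
    all_goals
      have : 3 - p ≠ 0 := by linarith
      field_simp
      ring

theorem lintegral_enorm_rpow_le {p p' a b : ℝ} (hp' : 0 < p') (ha : 0 ≤ a) (hb : 0 < b)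
    (hab : a + b = 1) (hp : p = p' * a + 2 * b) {h : E → ℝ} (hm : AEStronglyMeasurable h μ) :
    ∫⁻ x, ‖h x‖ₑ ^ p ∂μ ≤ (∫⁻ x, ‖h x‖ₑ ^ p' ∂μ) ^ a * (∫⁻ x, ‖h x‖ₑ ^ (2 : ℝ) ∂μ) ^ b := by
  refine le_trans (le_of_eq ?_) (ENNReal.lintegral_mul_norm_pow_le
    (hm.enorm.pow_const _) (hm.enorm.pow_const _) ha hb.le hab)
  refine lintegral_congr fun x => ?_
  rw [← ENNReal.rpow_mul, ← ENNReal.rpow_mul, ← ENNReal.rpow_add_of_nonneg _ _ (by positivity)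
    (by positivity), ← hp]

/-- A family that is bounded in all `L^{p'}` and tends to zero in `L²` tends to zero in `L^p`. -/
theorem tendsto_eLpNorm_zero {ι : Type*} {l : Filter ι} {h : ι → E → ℝ} {p : ℝ≥0∞}
    (hp1 : 1 < p) (hp : p ≠ ∞) (hm : ∀ i, AEStronglyMeasurable (h i) μ)
    (h2 : Tendsto (fun i => eLpNorm (h i) 2 μ) l (𝓝 0))
    (hb : ∀ r : ℝ≥0∞, 1 < r → r ≠ ∞ → ∃ K : ℝ≥0∞, K ≠ ∞ ∧ ∀ i, eLpNorm (h i) r μ ≤ K) :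
    Tendsto (fun i => eLpNorm (h i) p μ) l (𝓝 0) := by
  have hp0 : p ≠ 0 := (zero_lt_one.trans hp1).ne'
  have hpr : 1 < p.toReal := by
    rw [← ENNReal.toReal_one]
    exact (ENNReal.toReal_lt_toReal ENNReal.one_ne_top hp).2 hp1
  obtain ⟨p', a, b, hp', ha, hb0, hab, hpe⟩ := exists_exponent hpr
  obtain ⟨K, hK, hKb⟩ := hb (ENNReal.ofReal p') (by
    rw [← ENNReal.ofReal_one]; exact (ENNReal.ofReal_lt_ofReal_iff (by linarith)).2 hp')
    ENNReal.ofReal_ne_top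
  have hp'0 : 0 < p' := by linarith
  have hnorm : ∀ (i : ι) (r : ℝ≥0∞), r ≠ 0 → r ≠ ∞ →
      ∫⁻ x, ‖h i x‖ₑ ^ r.toReal ∂μ = eLpNorm (h i) r μ ^ r.toReal := fun i r hr0 hr => by
    rw [eLpNorm_eq_eLpNorm' hr0 hr, lintegral_rpow_enorm_eq_rpow_eLpNorm'
      (ENNReal.toReal_pos hr0 hr)]
  have hle : ∀ i, eLpNorm (h i) p μ
      ≤ ((K ^ p') ^ a * (eLpNorm (h i) 2 μ ^ (2 : ℝ)) ^ b) ^ (1 / p.toReal) := fun i => by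
    have h1 := lintegral_enorm_rpow_le hp'0 ha hb0 hab hpe (hm i)
    have e1 := hnorm i (ENNReal.ofReal p') (ENNReal.ofReal_pos.2 hp'0).ne' ENNReal.ofReal_ne_top
    have e2 := hnorm i 2 two_ne_zero ENNReal.ofNat_ne_top
    rw [ENNReal.toReal_ofReal hp'0.le] at e1
    rw [ENNReal.toReal_ofNat] at e2
    rw [e1, e2] at h1
    rw [eLpNorm_eq_lintegral_rpow_enorm_toReal hp0 hp]
    refine ENNReal.rpow_le_rpow (h1.trans ?_) (by positivity)
    gcongr
    exact hKb i
  have hlim : Tendsto (fun i => ((K ^ p') ^ a * (eLpNorm (h i) 2 μ ^ (2 : ℝ)) ^ b)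
      ^ (1 / p.toReal)) l (𝓝 (((K ^ p') ^ a * ((0 : ℝ≥0∞) ^ (2 : ℝ)) ^ b) ^ (1 / p.toReal))) := by
    refine Tendsto.ennrpow_const _ (ENNReal.Tendsto.const_mul
      (Tendsto.ennrpow_const _ (Tendsto.ennrpow_const _ h2)) (Or.inr ?_))
    exact ENNReal.rpow_ne_top_of_nonneg ha (ENNReal.rpow_ne_top_of_nonneg hp'0.le hK)
  -- It is `b > 0` that carries the convergence in `L²` over to `L^p`.
  rw [ENNReal.zero_rpow_of_pos two_pos, ENNReal.zero_rpow_of_pos hb0, mul_zero,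
    ENNReal.zero_rpow_of_pos (by positivity)] at hlim
  exact tendsto_of_tendsto_of_tendsto_of_le_of_le tendsto_const_nhds hlim (fun _ => zero_le) hle

end StrongContinuity

/-! ### The semigroup on `L^p` and its analyticity -/

section LrSemigroup

variable {E : Type*} [MeasurableSpace E] {μ : Measure E}
variable (𝓔 : DirichletForm μ) {p : ℝ≥0∞}

theorem exists_holderConjugate (hp1 : 1 < p) (hp : p ≠ ∞) :
    ∃ q : ℝ≥0∞, p.toReal.HolderConjugate q.toReal := by
  have hpr : 1 < p.toReal := by
    rw [← ENNReal.toReal_one]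
    exact (ENNReal.toReal_lt_toReal ENNReal.one_ne_top hp).2 hp1
  refine ⟨ENNReal.ofReal p.toReal.conjExponent, ?_⟩
  have h := Real.HolderConjugate.conjExponent hpr
  rwa [ENNReal.toReal_ofReal h.symm.nonneg]

/-- `T` extends the semigroup `(T²_t)` from `L² ∩ L^p` to `L^p`. -/
def ExtendsL2Semigroup [Fact (1 ≤ p)] (T : ℝ≥0 → Lp ℝ p μ →L[ℝ] Lp ℝ p μ) : Prop :=
  ∀ t, ∀ f : interLp p μ, T t (interToLp p μ f) =ᵐ[μ] l2Semigroup 𝓔 t f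

theorem exists_extendsL2Semigroup [Fact (1 ≤ p)] (hp1 : 1 < p) (hp : p ≠ ∞) :
    ∃ T : ℝ≥0 → Lp ℝ p μ →L[ℝ] Lp ℝ p μ, ExtendsL2Semigroup 𝓔 T := by
  obtain ⟨q, hpq⟩ := exists_holderConjugate hp1 hp
  obtain ⟨C, -, hC⟩ := exists_analyticBounds 𝓔 hpq
  choose T hT using fun t => exists_extension (hC.contraction t) zero_le_one hpq
  exact ⟨T, hT⟩

variable {𝓔}

theorem ExtendsL2Semigroup.norm_le [Fact (1 ≤ p)] {T : ℝ≥0 → Lp ℝ p μ →L[ℝ] Lp ℝ p μ}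
    (hT : ExtendsL2Semigroup 𝓔 T) (hp1 : 1 < p) (hp : p ≠ ∞) (t : ℝ≥0) (f : Lp ℝ p μ) :
    ‖T t f‖ ≤ ‖f‖ := by
  obtain ⟨q, hpq⟩ := exists_holderConjugate hp1 hp
  obtain ⟨C, -, hC⟩ := exists_analyticBounds 𝓔 hpq
  simpa using (hC.contraction t).norm_le zero_le_one hpq (hT t) f

theorem ExtendsL2Semigroup.apply_eq [Fact (1 ≤ p)] {T : ℝ≥0 → Lp ℝ p μ →L[ℝ] Lp ℝ p μ}
    (hT : ExtendsL2Semigroup 𝓔 T) (t : ℝ≥0) (f : interLp p μ) :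
    ∃ g : interLp p μ, (g : Lp ℝ 2 μ) = l2Semigroup 𝓔 t f ∧
      T t (interToLp p μ f) = interToLp p μ g := by
  have h : MemLp (l2Semigroup 𝓔 t f) p μ := (Lp.memLp _).ae_eq (hT t f)
  exact ⟨⟨_, h⟩, rfl, (interToLp_eq (f := ⟨_, h⟩) (hT t f)).symm⟩

/-- A simple function in `L²` lies in every `L^r`, and the semigroup is contractive there for `1 < r
< ∞`. So the differences stay bounded in all these spaces and tend to zero in `L²`. -/
theorem tendsto_extension_simple [Fact (1 ≤ p)] {T : ℝ≥0 → Lp ℝ p μ →L[ℝ] Lp ℝ p μ}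
    (hT : ExtendsL2Semigroup 𝓔 T) (hp1 : 1 < p) (hp : p ≠ ∞) {s : SimpleFunc E ℝ}
    (hs : MemLp s 2 μ) (hs' : MemLp s p μ) :
    Tendsto (fun t => T t (interToLp p μ (simpleInter hs hs'))) (𝓝 0)
      (𝓝 (interToLp p μ (simpleInter hs hs'))) := by
  rw [Lp.tendsto_Lp_iff_tendsto_eLpNorm']
  set f : Lp ℝ 2 μ := hs.toLp s with hf
  have hae : ∀ t, (T t (interToLp p μ (simpleInter hs hs')) : E → ℝ)
      - (interToLp p μ (simpleInter hs hs') : E → ℝ)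
      =ᵐ[μ] (l2Semigroup 𝓔 t f : E → ℝ) - (f : E → ℝ) := fun t =>
    (hT t _).sub (coeFn_interToLp _)
  refine (tendsto_congr fun t => eLpNorm_congr_ae (hae t)).2 ?_
  refine tendsto_eLpNorm_zero hp1 hp
    (fun t => (Lp.aestronglyMeasurable _).sub (Lp.aestronglyMeasurable _)) ?_ fun r hr1 hr => ?_
  · exact (Lp.tendsto_Lp_iff_tendsto_eLpNorm' _ _).1
      ((isContractionSemigroup_l2Semigroup 𝓔).continuous f)
  · obtain ⟨q, hrq⟩ := exists_holderConjugate hr1 hr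
    obtain ⟨C, -, hC⟩ := exists_analyticBounds 𝓔 hrq
    have hsr : MemLp s r μ := memLp_of_memLp_simpleFunc two_ne_zero ENNReal.ofNat_ne_top hs
      (ne_zero_of_holderConjugate hrq) hr
    have hfr : MemLp f r μ := hsr.ae_eq hs.coeFn_toLp.symm
    refine ⟨ENNReal.ofReal (1 * (eLpNorm f r μ).toReal) + eLpNorm f r μ,
      ENNReal.add_ne_top.2 ⟨ENNReal.ofReal_ne_top, hfr.eLpNorm_ne_top⟩, fun t => ?_⟩
    exact (eLpNorm_sub_le (Lp.aestronglyMeasurable _) (Lp.aestronglyMeasurable _) hr1.le).trans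
      (add_le_add_left ((hC.contraction t).eLpNorm_le zero_le_one hrq hfr) _)

theorem ExtendsL2Semigroup.isContractionSemigroup [Fact (1 ≤ p)]
    {T : ℝ≥0 → Lp ℝ p μ →L[ℝ] Lp ℝ p μ} (hT : ExtendsL2Semigroup 𝓔 T) (hp1 : 1 < p) (hp : p ≠ ∞) :
    IsContractionSemigroup T where
  zero := by
    refine ContinuousLinearMap.ext fun f => ?_
    refine (denseRange_interToLp hp).induction_on (p := fun f => T 0 f = f) f
      (isClosed_eq (by fun_prop) (by fun_prop)) fun g => ?_
    obtain ⟨g', h1, h2⟩ := hT.apply_eq 0 g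
    rw [(isContractionSemigroup_l2Semigroup 𝓔).zero_apply] at h1
    rw [h2, Subtype.ext h1]
  add s t := by
    refine ContinuousLinearMap.ext fun f => ?_
    refine (denseRange_interToLp hp).induction_on (p := fun f => T (s + t) f = T s (T t f)) f
      (isClosed_eq (by fun_prop) (by fun_prop)) fun g => ?_
    obtain ⟨g1, h1, h1'⟩ := hT.apply_eq (s + t) g
    obtain ⟨g2, h2, h2'⟩ := hT.apply_eq t g
    obtain ⟨g3, h3, h3'⟩ := hT.apply_eq s g2
    rw [h1', h2', h3']
    congr 1
    exact Subtype.ext (by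
      rw [h1, h3, h2, (isContractionSemigroup_l2Semigroup 𝓔).add_apply])
  contraction t := ContinuousLinearMap.opNorm_le_bound _ zero_le_one fun f => by
    simpa using hT.norm_le hp1 hp t f
  continuous f := by
    rw [Metric.tendsto_nhds]
    intro ε hε
    obtain ⟨_, ⟨s, hs, hs', rfl⟩, hg⟩ :=
      (dense_simple hp).exists_dist_lt f (show (0 : ℝ) < ε / 3 by positivity)
    set g := interToLp p μ (simpleInter hs hs')
    filter_upwards [Metric.tendsto_nhds.1 (tendsto_extension_simple hT hp1 hp hs hs') (ε / 3)
      (by positivity)] with t ht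
    have h2 : dist (T t f) (T t g) ≤ dist f g := by
      rw [dist_eq_norm, dist_eq_norm, ← map_sub]
      exact hT.norm_le hp1 hp t _
    have h3 := dist_triangle4 (T t f) (T t g) g f
    rw [dist_comm g f] at h3
    linarith

theorem ExtendsL2Semigroup.isLrSemigroup [Fact (1 ≤ p)]
    {T : ℝ≥0 → Lp ℝ p μ →L[ℝ] Lp ℝ p μ} (hT : ExtendsL2Semigroup 𝓔 T) (hp1 : 1 < p) (hp : p ≠ ∞) :
    IsLrSemigroup 𝓔 p T := by
  refine ⟨hT.isContractionSemigroup hp1 hp, fun t f g hfg _ _ => ?_⟩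
  have hg : MemLp g p μ := (Lp.memLp f).ae_eq hfg
  have h := hT t ⟨g, hg⟩
  rwa [interToLp_eq (f := ⟨g, hg⟩) (g := f) hfg] at h

/-- Once some family satisfies the specification, so does the chosen one. The specification
determines it on integrable simple functions, which lie in `L¹ ∩ L^∞` and are dense in `L^p`. -/
theorem extendsL2Semigroup_lrSemigroup [Fact (1 ≤ p)] (hp1 : 1 < p) (hp : p ≠ ∞) :
    ExtendsL2Semigroup 𝓔 (lrSemigroup 𝓔 p) := by
  obtain ⟨T, hT⟩ := exists_extendsL2Semigroup 𝓔 hp1 hp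
  have h : IsLrSemigroup 𝓔 p (lrSemigroup 𝓔 p) :=
    Classical.epsilon_spec (p := IsLrSemigroup 𝓔 p) ⟨T, hT.isLrSemigroup hp1 hp⟩
  have he : lrSemigroup 𝓔 p = T := by
    funext t
    refine ContinuousLinearMap.ext fun f => ?_
    refine congrFun (Continuous.ext_on (dense_simple hp) (lrSemigroup 𝓔 p t).continuous
      (T t).continuous ?_) f
    rintro _ ⟨s, hs, hs', rfl⟩
    refine Lp.ext ((h.2 t _ _ (coeFn_interToLp _) ?_ ?_).trans (hT t _).symm)
    · rw [interToLp_simpleInter]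
      exact (memLp_of_memLp_simpleFunc two_ne_zero ENNReal.ofNat_ne_top hs one_ne_zero
        ENNReal.one_ne_top).ae_eq hs'.coeFn_toLp.symm
    · rw [interToLp_simpleInter]
      exact (SimpleFunc.memLp_top s μ).ae_eq hs'.coeFn_toLp.symm
  rw [he]
  exact hT

/-- The semigroup on `L^p`, `1 < p < ∞`, is analytic: it maps `L^p` into the domain of its
generator. -/
theorem exists_isGeneratorAt [Fact (1 ≤ p)] (hp1 : 1 < p) (hp : p ≠ ∞) {t : ℝ≥0} (ht : 0 < t) :
    ∃ C : ℝ, ∀ f : Lp ℝ p μ, ∃ v, IsGeneratorAt (lrSemigroup 𝓔 p) (lrSemigroup 𝓔 p t f) v ∧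
      ‖v‖ ≤ C * ‖f‖ := by
  have hT := extendsL2Semigroup_lrSemigroup (𝓔 := 𝓔) hp1 hp
  have hsg := hT.isContractionSemigroup hp1 hp
  obtain ⟨q, hpq⟩ := exists_holderConjugate hp1 hp
  obtain ⟨c, hc, hb⟩ := exists_analyticBounds 𝓔 hpq
  set T := lrSemigroup 𝓔 p
  have hct : 0 < c * t := mul_pos hc (NNReal.coe_pos.2 ht)
  have hsub : ∀ h : ℝ≥0, ∀ f : interLp p μ, (T (t + h) - T t) (interToLp p μ f)
      =ᵐ[μ] (l2Semigroup 𝓔 (t + h) - l2Semigroup 𝓔 t) f := fun h f => by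
    have h1 := Lp.coeFn_sub (T (t + h) (interToLp p μ f)) (T t (interToLp p μ f))
    have h2 := Lp.coeFn_sub (l2Semigroup 𝓔 (t + h) f) (l2Semigroup 𝓔 t f)
    exact h1.trans (((hT _ f).sub (hT _ f)).trans h2.symm)
  have hlip : ∀ h : ℝ≥0, ∀ f, ‖T (t + h) f - T t f‖ ≤ h / (c * t) * ‖f‖ := fun h f =>
    (hb.lipschitz t h ht).norm_le (by positivity) hpq (hsub h) f
  have hslope : ∀ h l : ℝ≥0, 0 < h → 0 < l → ∀ f,
      ‖(h : ℝ)⁻¹ • (T (t + h) f - T t f) - (l : ℝ)⁻¹ • (T (t + l) f - T t f)‖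
        ≤ 2 * (h + l) / (c * t) ^ 2 * ‖f‖ := fun h l hh hl f => by
    refine (hb.slope t h l ht hh hl).norm_le (T := (h : ℝ)⁻¹ • (T (t + h) - T t)
      - (l : ℝ)⁻¹ • (T (t + l) - T t)) (by positivity) hpq (fun f => ?_) f
    have h1 := (hsub h f).const_smul (h : ℝ)⁻¹
    have h2 := (hsub l f).const_smul (l : ℝ)⁻¹
    have e1 := Lp.coeFn_smul (h : ℝ)⁻¹ ((T (t + h) - T t) (interToLp p μ f))
    have e2 := Lp.coeFn_smul (l : ℝ)⁻¹ ((T (t + l) - T t) (interToLp p μ f))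
    have e3 := Lp.coeFn_smul (h : ℝ)⁻¹ ((l2Semigroup 𝓔 (t + h) - l2Semigroup 𝓔 t) f)
    have e4 := Lp.coeFn_smul (l : ℝ)⁻¹ ((l2Semigroup 𝓔 (t + l) - l2Semigroup 𝓔 t) f)
    have e5 := Lp.coeFn_sub ((h : ℝ)⁻¹ • ((T (t + h) - T t) (interToLp p μ f)))
      ((l : ℝ)⁻¹ • ((T (t + l) - T t) (interToLp p μ f)))
    have e6 := Lp.coeFn_sub ((h : ℝ)⁻¹ • ((l2Semigroup 𝓔 (t + h) - l2Semigroup 𝓔 t) f))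
      ((l : ℝ)⁻¹ • ((l2Semigroup 𝓔 (t + l) - l2Semigroup 𝓔 t) f))
    exact e5.trans ((((e1.trans h1).trans e3.symm).sub ((e2.trans h2).trans e4.symm)).trans e6.symm)
  -- By the Lipschitz bound, the difference quotients at time `t` have norm at most `(c * t)⁻¹ *
  -- ‖f‖`, and so does their limit.
  refine ⟨(c * t)⁻¹, fun f => ?_⟩
  have hgen : ∀ h : ℝ≥0, (h : ℝ)⁻¹ • (T h (T t f) - T t f) = (h : ℝ)⁻¹ • (T (t + h) f - T t f) :=
    fun h => by rw [add_comm, hsg.add_apply]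
  -- Two difference quotients with steps `h` and `l` differ by a multiple of `h + l`, so the
  -- derivative exists by completeness of `L^p`.
  have hcauchy : Cauchy (map (fun h : ℝ≥0 => (h : ℝ)⁻¹ • (T h (T t f) - T t f)) (𝓝[>] 0)) := by
    rw [Metric.cauchy_iff]
    refine ⟨inferInstance, fun ε hε => ?_⟩
    have h0 : Tendsto (fun h : ℝ≥0 => 4 * (h : ℝ) / (c * t) ^ 2 * ‖f‖) (𝓝 0) (𝓝 0) := by
      have : Continuous fun h : ℝ≥0 => 4 * (h : ℝ) / (c * t) ^ 2 * ‖f‖ := by fun_prop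
      simpa using this.tendsto 0
    have h1 := (h0.mono_left (nhdsWithin_le_nhds (s := Set.Ioi 0))).eventually (gt_mem_nhds hε)
    refine ⟨_, image_mem_map (h1.and self_mem_nhdsWithin), ?_⟩
    rintro _ ⟨h, ⟨hh, hh0⟩, rfl⟩ _ ⟨l, ⟨hl, hl0⟩, rfl⟩
    dsimp only
    rw [dist_eq_norm, hgen, hgen]
    refine (hslope h l hh0 hl0 f).trans_lt ?_
    have e : 2 * ((h : ℝ) + l) / (c * t) ^ 2 * ‖f‖ = (4 * (h : ℝ) / (c * t) ^ 2 * ‖f‖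
      + 4 * (l : ℝ) / (c * t) ^ 2 * ‖f‖) / 2 := by ring
    rw [e]
    linarith
  obtain ⟨v, hv⟩ := CompleteSpace.complete hcauchy
  refine ⟨v, hv, ?_⟩
  have hv' : Tendsto (fun h : ℝ≥0 => (h : ℝ)⁻¹ • (T h (T t f) - T t f)) (𝓝[>] 0) (𝓝 v) := hv
  refine le_of_tendsto hv'.norm ?_
  filter_upwards [self_mem_nhdsWithin] with h hh
  have hh' : (0 : ℝ) < h := hh
  rw [hgen, norm_smul, norm_inv, Real.norm_of_nonneg hh'.le, inv_mul_le_iff₀ hh']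
  refine (hlip h f).trans (le_of_eq ?_)
  ring

end LrSemigroup

/-! ### Positive functionals on `L^p` as measures -/

section PositiveFunctional

variable {E : Type*} [MeasurableSpace E] {μ : Measure E}
variable {p : ℝ≥0∞}

open Classical in
/-- The class in `L^p` of the indicator function of a measurable set of finite measure (and `0` if
`A` is not such a set). -/
def indLp (p : ℝ≥0∞) (μ : Measure E) (A : Set E) : Lp ℝ p μ :=
  if h : MeasurableSet A ∧ μ A ≠ ∞ then indicatorConstLp p h.1 h.2 1 else 0

theorem indLp_eq {A : Set E} (hA : MeasurableSet A) (hμ : μ A ≠ ∞) :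
    indLp p μ A = indicatorConstLp p hA hμ 1 := dif_pos ⟨hA, hμ⟩

theorem coeFn_indLp {A : Set E} (hA : MeasurableSet A) (hμ : μ A ≠ ∞) :
    indLp p μ A =ᵐ[μ] A.indicator 1 := by
  rw [indLp_eq hA hμ]
  exact indicatorConstLp_coeFn

theorem indLp_empty : indLp p μ ∅ = 0 := by
  rw [indLp_eq MeasurableSet.empty (by simp), indicatorConstLp_empty]

theorem indLp_union {A B : Set E} (hA : MeasurableSet A) (hB : MeasurableSet B)
    (hμA : μ A ≠ ∞) (hμB : μ B ≠ ∞) (h : Disjoint A B) :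
    indLp p μ (A ∪ B) = indLp p μ A + indLp p μ B := by
  rw [indLp_eq hA hμA, indLp_eq hB hμB, ← indicatorConstLp_disjoint_union hA hB hμA hμB h,
    indLp_eq (hA.union hB) (measure_union_ne_top hμA hμB)]

theorem sum_indLp {s : ℕ → Set E} (hs : ∀ i, MeasurableSet (s i))
    (hd : Pairwise (Function.onFun Disjoint s)) (hμ : ∀ i, μ (s i) ≠ ∞) (n : ℕ) :
    ∑ i ∈ Finset.range n, indLp p μ (s i) = indLp p μ (⋃ i ∈ Finset.range n, s i) := by
  induction n with
  | zero => simp [indLp_empty]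
  | succ n ih =>
    rw [Finset.sum_range_succ, ih, ← indLp_union (Finset.measurableSet_biUnion _ fun i _ => hs i)
      (hs n) ?_ (hμ n) ?_, Finset.range_add_one, Finset.set_biUnion_insert, Set.union_comm]
    · exact (measure_biUnion_lt_top (Finset.finite_toSet _) fun i _ => (hμ i).lt_top).ne
    · rw [Set.disjoint_iUnion₂_left]
      exact fun i hi => hd (Finset.mem_range.1 hi).ne

variable [Fact (1 ≤ p)]

theorem tendsto_indLp_biUnion (hp : p ≠ ∞) {s : ℕ → Set E} (hs : ∀ i, MeasurableSet (s i))
    (hμ : μ (⋃ i, s i) ≠ ∞) :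
    Tendsto (fun n => indLp p μ (⋃ i ∈ Finset.range n, s i)) atTop (𝓝 (indLp p μ (⋃ i, s i))) := by
  have hsub : ∀ n, ⋃ i ∈ Finset.range n, s i ⊆ ⋃ i, s i := fun n =>
    Set.iUnion₂_subset fun i _ => Set.subset_iUnion s i
  have hm : ∀ n, MeasurableSet (⋃ i ∈ Finset.range n, s i) := fun n =>
    Finset.measurableSet_biUnion _ fun i _ => hs i
  have hfin : ∀ n, μ (⋃ i ∈ Finset.range n, s i) ≠ ∞ := fun n =>
    measure_ne_top_of_subset (hsub n) hμ
  rw [indLp_eq (MeasurableSet.iUnion hs) hμ]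
  simp only [fun n => indLp_eq (p := p) (hm n) (hfin n)]
  refine tendsto_indicatorConstLp_set hp ?_
  have hanti : Antitone fun n => (⋃ i, s i) \ ⋃ i ∈ Finset.range n, s i := fun m n hmn =>
    Set.sdiff_subset_sdiff_right (Set.biUnion_subset_biUnion_left
      (Finset.coe_subset.2 (Finset.range_mono hmn)))
  have h := tendsto_measure_iInter_atTop (μ := μ)
    (fun n => ((MeasurableSet.iUnion hs).diff (hm n)).nullMeasurableSet) hanti
    ⟨0, measure_ne_top_of_subset Set.sdiff_subset hμ⟩
  have he : ⋂ n, ((⋃ i, s i) \ ⋃ i ∈ Finset.range n, s i) = ∅ := by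
    refine Set.eq_empty_iff_forall_notMem.2 fun x hx => ?_
    rw [Set.mem_iInter] at hx
    obtain ⟨i, hi⟩ := Set.mem_iUnion.1 (hx 0).1
    exact (hx (i + 1)).2 (Set.mem_biUnion (Finset.mem_coe.2 (Finset.self_mem_range_succ i)) hi)
  rw [he, measure_empty] at h
  refine h.congr fun n => ?_
  rw [symmDiff_comm, Set.symmDiff_def, Set.sdiff_eq_empty.2 (hsub n), Set.union_empty,
    Function.comp_apply]

variable {ℓ : Lp ℝ p μ →L[ℝ] ℝ}

/-- Countable additivity is continuity of `ℓ`: the indicators of the finite unions converge in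
`L^p`, as `p < ∞`. -/
theorem ofReal_apply_indLp_iUnion (hp : p ≠ ∞)
    (h0 : ∀ A, MeasurableSet A → μ A ≠ ∞ → 0 ≤ ℓ (indLp p μ A)) {s : ℕ → Set E}
    (hs : ∀ i, MeasurableSet (s i)) (hd : Pairwise (Function.onFun Disjoint s))
    (hμ : μ (⋃ i, s i) ≠ ∞) :
    ENNReal.ofReal (ℓ (indLp p μ (⋃ i, s i))) = ∑' i, ENNReal.ofReal (ℓ (indLp p μ (s i))) := by
  have hμi : ∀ i, μ (s i) ≠ ∞ := fun i => measure_ne_top_of_subset (Set.subset_iUnion s i) hμ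
  have h : HasSum (fun i => ℓ (indLp p μ (s i))) (ℓ (indLp p μ (⋃ i, s i))) := by
    rw [hasSum_iff_tendsto_nat_of_nonneg fun i => h0 _ (hs i) (hμi i)]
    refine ((ℓ.continuous.tendsto _).comp (tendsto_indLp_biUnion hp hs hμ)).congr fun n => ?_
    rw [Function.comp_apply, ← sum_indLp hs hd hμi, map_sum]
  rw [← h.tsum_eq, ENNReal.ofReal_tsum_of_nonneg (fun i => h0 _ (hs i) (hμi i)) h.summable]

/-- The functional sees only sets of finite measure, so a measure is built on each piece of a
countable partition into such sets, and the pieces are summed. -/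
theorem exists_measure_of_nonneg [SigmaFinite μ] (hp : p ≠ ∞)
    (h0 : ∀ A, MeasurableSet A → μ A ≠ ∞ → 0 ≤ ℓ (indLp p μ A)) :
    ∃ ν : Measure E, ∀ A, MeasurableSet A → μ A ≠ ∞ → ν A = ENNReal.ofReal (ℓ (indLp p μ A)) := by
  set D := disjointed (spanningSets μ) with hD
  have hDm : ∀ n, MeasurableSet (D n) := MeasurableSet.disjointed (measurableSet_spanningSets μ)
  have hfin : ∀ A n, μ (A ∩ D n) ≠ ∞ := fun A n => measure_ne_top_of_subset
    (Set.inter_subset_right.trans (disjointed_subset _ n)) (measure_spanningSets_lt_top μ n).ne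
  let ν : ℕ → Measure E := fun n => Measure.ofMeasurable
    (fun A _ => ENNReal.ofReal (ℓ (indLp p μ (A ∩ D n))))
    (by simp [indLp_empty]) fun s hs hd => by
      rw [Set.iUnion_inter]
      exact ofReal_apply_indLp_iUnion hp h0 (fun i => (hs i).inter (hDm n))
        (fun i j hij => (hd hij).mono Set.inter_subset_left Set.inter_subset_left)
        (by rw [← Set.iUnion_inter]; exact hfin _ n)
  refine ⟨Measure.sum ν, fun A hA hμA => ?_⟩
  have hU : ⋃ n, A ∩ D n = A := by
    rw [← Set.inter_iUnion, hD, iUnion_disjointed, iUnion_spanningSets, Set.inter_univ]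
  rw [Measure.sum_apply _ hA]
  conv_rhs => rw [← hU]
  rw [ofReal_apply_indLp_iUnion hp h0 (fun n => hA.inter (hDm n))
    (fun i j hij => (disjoint_disjointed _ hij).mono Set.inter_subset_right Set.inter_subset_right)
    (by rwa [hU])]
  exact tsum_congr fun n => Measure.ofMeasurable_apply A hA

variable {ν : Measure E}

theorem absolutelyContinuous_of_apply_indLp
    (hν : ∀ A, MeasurableSet A → μ A ≠ ∞ → ν A = ENNReal.ofReal (ℓ (indLp p μ A))) : ν ≪ μ := by
  refine Measure.AbsolutelyContinuous.mk fun A hA hμA => ?_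
  have hne : μ A ≠ ∞ := by simp [hμA]
  have h : indLp p μ A = 0 := by
    refine Lp.ext ((coeFn_indLp hA hne).trans (EventuallyEq.trans ?_ (Lp.coeFn_zero _ _ _).symm))
    filter_upwards [measure_eq_zero_iff_ae_notMem.1 hμA] with x hx
    simp [hx]
  rw [hν A hA hne, h, map_zero, ENNReal.ofReal_zero]

theorem measure_univ_le_one [SigmaFinite μ]
    (h1 : ∀ A, MeasurableSet A → μ A ≠ ∞ → ℓ (indLp p μ A) ≤ 1)
    (hν : ∀ A, MeasurableSet A → μ A ≠ ∞ → ν A = ENNReal.ofReal (ℓ (indLp p μ A))) :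
    ν Set.univ ≤ 1 := by
  rw [← iUnion_spanningSets μ, (monotone_spanningSets μ).measure_iUnion]
  refine iSup_le fun n => ?_
  rw [hν _ (measurableSet_spanningSets μ n) (measure_spanningSets_lt_top μ n).ne]
  exact ENNReal.ofReal_le_one.2 (h1 _ (measurableSet_spanningSets μ n)
    (measure_spanningSets_lt_top μ n).ne)

theorem integral_simpleFunc [IsFiniteMeasure ν] (hp : p ≠ ∞)
    (h0 : ∀ A, MeasurableSet A → μ A ≠ ∞ → 0 ≤ ℓ (indLp p μ A))
    (hν : ∀ A, MeasurableSet A → μ A ≠ ∞ → ν A = ENNReal.ofReal (ℓ (indLp p μ A)))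
    {s : SimpleFunc E ℝ} (hs : MemLp s p μ) : ∫ x, s x ∂ν = ℓ (hs.toLp s) := by
  have hp0 : p ≠ 0 := (zero_lt_one.trans_le (Fact.out : (1 : ℝ≥0∞) ≤ p)).ne'
  have hint : ∀ s : SimpleFunc E ℝ, Integrable s ν := fun s =>
    SimpleFunc.integrable_of_isFiniteMeasure s
  revert hs
  refine SimpleFunc.induction (motive := fun s : SimpleFunc E ℝ => ∀ hs : MemLp s p μ,
    ∫ x, s x ∂ν = ℓ (hs.toLp s)) (fun c A hA hs => ?_) (fun f g hfg hf hg hs => ?_) s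
  -- For `c = 0` the set `A` may have infinite measure, and then its indicator has no class in
  -- `L^p`.
  · rcases eq_or_ne c 0 with rfl | hc
    · have : hs.toLp _ = 0 := by
        refine (MemLp.toLp_eq_toLp_iff hs MemLp.zero).2 (Eventually.of_forall fun x => ?_)
        simp
      rw [this, map_zero]
      simp
    · have hμ : μ A ≠ ∞ := by
        have := SimpleFunc.measure_preimage_lt_top_of_memLp hp0 hp _ hs c hc
        refine measure_ne_top_of_subset (fun x hx => ?_) this.ne
        simp [hx]
      have h : hs.toLp _ = c • indLp p μ A := by
        refine Lp.ext (hs.coeFn_toLp.trans ?_)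
        filter_upwards [Lp.coeFn_smul c (indLp p μ A), coeFn_indLp (p := p) hA hμ] with x h1 h2
        rw [h1, Pi.smul_apply, h2]
        by_cases hx : x ∈ A <;> simp [hx]
      rw [h, map_smul, smul_eq_mul]
      have h2 := SimpleFunc.coe_piecewise hA (SimpleFunc.const E c) (SimpleFunc.const E 0)
      rw [h2]
      simp only [SimpleFunc.coe_const, SimpleFunc.const_zero, SimpleFunc.coe_zero,
        Set.piecewise_eq_indicator]
      rw [show A.indicator (Function.const E c) = A.indicator fun _ => c from rfl,
        integral_indicator_const c hA, Measure.real, hν A hA hμ,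
        ENNReal.toReal_ofReal (h0 A hA hμ), smul_eq_mul, mul_comm]
  · obtain ⟨hf', hg'⟩ := (memLp_add_of_disjoint hfg f.stronglyMeasurable g.stronglyMeasurable).1 hs
    have h : hs.toLp _ = hf'.toLp f + hg'.toLp g := rfl
    rw [h, map_add, ← hf hf', ← hg hg']
    exact integral_add (hint f) (hint g)

/-- For simple functions this is boundedness of `ℓ`; the general case follows by Fatou's lemma along
simple functions dominated by `2 |f|`. The factor `2` is harmless, since only integrability and
continuity in `f` are drawn from this bound. -/
theorem lintegral_enorm_le [IsFiniteMeasure ν] (hp : p ≠ ∞)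
    (h0 : ∀ A, MeasurableSet A → μ A ≠ ∞ → 0 ≤ ℓ (indLp p μ A))
    (hν : ∀ A, MeasurableSet A → μ A ≠ ∞ → ν A = ENNReal.ofReal (ℓ (indLp p μ A)))
    {f : E → ℝ} (hf : MemLp f p μ) :
    ∫⁻ x, ‖f x‖ₑ ∂ν ≤ ENNReal.ofReal ‖ℓ‖ * (ENNReal.ofReal 2 * eLpNorm f p μ) := by
  have hsimple : ∀ s : SimpleFunc E ℝ, MemLp s p μ →
      ∫⁻ x, ‖s x‖ₑ ∂ν ≤ ENNReal.ofReal ‖ℓ‖ * eLpNorm s p μ := fun s hs => by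
    have hm : MemLp (s.map fun y => ‖y‖) p μ := hs.norm
    have hint : Integrable s ν := SimpleFunc.integrable_of_isFiniteMeasure s
    rw [← ofReal_integral_norm_eq_lintegral_enorm hint]
    have h := integral_simpleFunc hp h0 hν hm
    simp only [SimpleFunc.coe_map, Function.comp_apply] at h
    rw [h]
    refine (ENNReal.ofReal_le_ofReal ((le_abs_self _).trans (ℓ.le_opNorm _))).trans (le_of_eq ?_)
    rw [ENNReal.ofReal_mul (norm_nonneg _), Lp.norm_toLp]
    exact congrArg _ ((ENNReal.ofReal_toReal hm.eLpNorm_ne_top).trans (eLpNorm_norm s))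
  have hac := absolutelyContinuous_of_apply_indLp hν
  have hmk := hf.aestronglyMeasurable.ae_eq_mk
  set g := hf.aestronglyMeasurable.mk f
  have hg : StronglyMeasurable g := hf.aestronglyMeasurable.stronglyMeasurable_mk
  rw [lintegral_congr_ae (f := fun x => ‖f x‖ₑ) (g := fun x => ‖g x‖ₑ) ((hac.ae_eq hmk).fun_comp enorm), eLpNorm_congr_ae hmk]
  have hgp : MemLp g p μ := hf.ae_eq hmk
  obtain ⟨s, hs⟩ : ∃ s : ℕ → SimpleFunc E ℝ, (∀ x, Tendsto (fun n => s n x) atTop (𝓝 (g x))) ∧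
      ∀ n x, ‖s n x‖ ≤ 2 * ‖g x‖ := by
    refine ⟨fun n => SimpleFunc.approxOn g hg.measurable Set.univ 0 (Set.mem_univ _) n,
      fun x => SimpleFunc.tendsto_approxOn _ _ (by simp), fun n x => ?_⟩
    rw [two_mul]
    exact SimpleFunc.norm_approxOn_zero_le _ _ x n
  have hsp : ∀ n, MemLp (s n) p μ := fun n =>
    MemLp.of_le_mul hgp (s n).aestronglyMeasurable (Eventually.of_forall (hs.2 n))
  calc ∫⁻ x, ‖g x‖ₑ ∂ν = ∫⁻ x, liminf (fun n => ‖s n x‖ₑ) atTop ∂ν :=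
        lintegral_congr fun x => ((hs.1 x).enorm.liminf_eq).symm
    _ ≤ liminf (fun n => ∫⁻ x, ‖s n x‖ₑ ∂ν) atTop :=
        lintegral_liminf_le fun n => (s n).measurable.enorm
    _ ≤ liminf (fun _ : ℕ => ENNReal.ofReal ‖ℓ‖ * (ENNReal.ofReal 2 * eLpNorm g p μ)) atTop :=
        liminf_le_liminf (Eventually.of_forall fun n => (hsimple _ (hsp n)).trans (mul_le_mul_right
          (eLpNorm_le_mul_eLpNorm_of_ae_le_mul (Eventually.of_forall (hs.2 n)) p) _))
    _ = _ := liminf_const _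

theorem integrable_of_memLp [IsFiniteMeasure ν] (hp : p ≠ ∞)
    (h0 : ∀ A, MeasurableSet A → μ A ≠ ∞ → 0 ≤ ℓ (indLp p μ A))
    (hν : ∀ A, MeasurableSet A → μ A ≠ ∞ → ν A = ENNReal.ofReal (ℓ (indLp p μ A)))
    {f : E → ℝ} (hf : MemLp f p μ) : Integrable f ν :=
  ⟨hf.aestronglyMeasurable.mono_ac (absolutelyContinuous_of_apply_indLp hν),
    (lintegral_enorm_le hp h0 hν hf).trans_lt (ENNReal.mul_lt_top ENNReal.ofReal_lt_top
      (ENNReal.mul_lt_top ENNReal.ofReal_lt_top hf.eLpNorm_lt_top))⟩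

/-- Both sides are continuous on `L^p` and agree on the dense set of simple functions. -/
theorem integral_eq_apply [IsFiniteMeasure ν] (hp : p ≠ ∞)
    (h0 : ∀ A, MeasurableSet A → μ A ≠ ∞ → 0 ≤ ℓ (indLp p μ A))
    (hν : ∀ A, MeasurableSet A → μ A ≠ ∞ → ν A = ENNReal.ofReal (ℓ (indLp p μ A)))
    {f : E → ℝ} (hf : MemLp f p μ) : ∫ x, f x ∂ν = ℓ (hf.toLp f) := by
  have hac := absolutelyContinuous_of_apply_indLp hν
  have hint : ∀ f : Lp ℝ p μ, Integrable f ν := fun f =>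
    integrable_of_memLp hp h0 hν (Lp.memLp f)
  have hcont : Continuous fun f : Lp ℝ p μ => ∫ x, f x ∂ν := by
    refine (LipschitzWith.of_dist_le_mul (K := Real.toNNReal (‖ℓ‖ * 2)) fun f g => ?_).continuous
    rw [dist_eq_norm, dist_eq_norm, ← integral_sub (hint f) (hint g),
      Real.coe_toNNReal _ (by positivity)]
    refine (norm_integral_le_integral_norm _).trans ?_
    have h1 := lintegral_enorm_le hp h0 hν (Lp.memLp (f - g))
    have h2 : ∫ x, ‖f x - g x‖ ∂ν = ∫ x, ‖(f - g : Lp ℝ p μ) x‖ ∂ν := by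
      refine integral_congr_ae ((hac.ae_eq (Lp.coeFn_sub f g)).mono fun x hx => ?_)
      simp only [hx, Pi.sub_apply]
    rw [h2, integral_norm_eq_lintegral_enorm (hint _).aestronglyMeasurable]
    refine (ENNReal.toReal_mono (ENNReal.mul_ne_top ENNReal.ofReal_ne_top
      (ENNReal.mul_ne_top ENNReal.ofReal_ne_top (Lp.eLpNorm_ne_top _))) h1).trans (le_of_eq ?_)
    rw [ENNReal.toReal_mul, ENNReal.toReal_mul, ENNReal.toReal_ofReal (norm_nonneg _),
      ENNReal.toReal_ofReal two_pos.le, ← Lp.norm_def, mul_assoc]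
  have heq : (fun f : Lp ℝ p μ => ∫ x, f x ∂ν) = ℓ := by
    refine Continuous.ext_on (dense_simple hp) hcont ℓ.continuous ?_
    rintro _ ⟨s, hs, hs', rfl⟩
    dsimp only
    rw [interToLp_simpleInter, ← integral_simpleFunc hp h0 hν hs']
    exact integral_congr_ae (hac.ae_eq hs'.coeFn_toLp)
  rw [← heq]
  exact integral_congr_ae (hac.ae_eq hf.coeFn_toLp.symm)

end PositiveFunctional

/-! ### Null sets and continuous versions -/

section ContinuousVersion

variable {E : Type*} [TopologicalSpace E] [MeasurableSpace E] {μ : Measure E}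

/-- Chebyshev's inequality: if `u ≥ 1` almost everywhere on an open set containing `A`, then `μ A ≤
‖u‖²`, which is at most the energy of `u`. -/
theorem measure_eq_zero_of_cap_eq_zero {𝓔 : DirichletForm μ} {A : Set E} (h : 𝓔.cap A = 0) :
    μ A = 0 := by
  refine le_antisymm (ENNReal.le_of_forall_pos_le_add fun ε hε _ => ?_) zero_le
  have h1 : 𝓔.cap A < ε := by rw [h]; exact_mod_cast hε
  simp only [DirichletForm.cap, iInf_lt_iff] at h1
  obtain ⟨V, -, hAV, u, hu, hlt⟩ := h1
  rw [zero_add]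
  refine le_trans ?_ hlt.le
  have h2 : μ A ≤ μ {x | 1 ≤ ‖(u : Lp ℝ 2 μ) x‖ₑ} := by
    refine measure_mono_ae ?_
    filter_upwards [hu] with y hy hyA
    have h3 := hy (hAV hyA)
    change (1 : ℝ≥0∞) ≤ ‖(u : Lp ℝ 2 μ) y‖ₑ
    rw [Real.enorm_of_nonneg (by linarith)]
    exact ENNReal.one_le_ofReal.2 h3
  have h4 := mul_meas_ge_le_pow_eLpNorm' μ two_ne_zero ENNReal.ofNat_ne_top
    (Lp.aestronglyMeasurable (u : Lp ℝ 2 μ)) 1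
  rw [ENNReal.one_rpow, one_mul] at h4
  refine h2.trans (h4.trans ?_)
  rw [← Lp.enorm_def, ← ofReal_norm, ENNReal.ofReal_rpow_of_nonneg (norm_nonneg _) (by simp)]
  refine ENNReal.ofReal_le_ofReal ?_
  rw [ENNReal.toReal_ofNat, Real.rpow_two]
  exact le_add_of_nonneg_left (𝓔.nonneg u)

variable {E₁ : Set E}

/-- A closed condition that holds almost everywhere holds everywhere on `E₁` for continuous
functions. -/
theorem forall_mem_of_ae [μ.IsOpenPosMeasure] (h0 : μ E₁ᶜ = 0) {g : E₁ → ℝ} (hg : Continuous g)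
    {S : Set ℝ} (hS : IsClosed S) (h : ∀ᵐ y ∂μ, ∀ hy : y ∈ E₁, g ⟨y, hy⟩ ∈ S) (x : E₁) :
    g x ∈ S := by
  by_contra hx
  obtain ⟨U, hU, hUg⟩ := isOpen_induced_iff.1 (hS.isOpen_compl.preimage hg)
  have hxU : (x : E) ∈ U := by
    have : x ∈ Subtype.val ⁻¹' U := by rw [hUg]; exact hx
    exact this
  refine (hU.measure_pos μ ⟨_, hxU⟩).ne' (measure_mono_null (fun y hyU => ?_)
    (measure_union_null h0 (ae_iff.1 h)))
  by_cases hy : y ∈ E₁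
  · refine Or.inr fun h' => ?_
    have : (⟨y, hy⟩ : E₁) ∈ g ⁻¹' Sᶜ := by rw [← hUg]; exact hyU
    exact this (h' hy)
  · exact Or.inl hy

variable {r : ℝ≥0∞} {u v : Lp ℝ r μ} {g g' : E₁ → ℝ}

theorem IsContVersion.sub (hg : IsContVersion E₁ u g) (hg' : IsContVersion E₁ v g') :
    IsContVersion E₁ (u - v) (fun x => g x - g' x) := by
  refine ⟨hg.1.sub hg'.1, ?_⟩
  filter_upwards [hg.2, hg'.2, Lp.coeFn_sub u v] with y h1 h2 h3 hy
  rw [h1 hy, h2 hy, h3, Pi.sub_apply]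

theorem IsContVersion.add (hg : IsContVersion E₁ u g) (hg' : IsContVersion E₁ v g') :
    IsContVersion E₁ (u + v) (fun x => g x + g' x) := by
  refine ⟨hg.1.add hg'.1, ?_⟩
  filter_upwards [hg.2, hg'.2, Lp.coeFn_add u v] with y h1 h2 h3 hy
  rw [h1 hy, h2 hy, h3, Pi.add_apply]

theorem IsContVersion.smul (c : ℝ) (hg : IsContVersion E₁ u g) :
    IsContVersion E₁ (c • u) (fun x => c * g x) := by
  refine ⟨hg.1.const_mul c, ?_⟩
  filter_upwards [hg.2, Lp.coeFn_smul c u] with y h1 h2 hy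
  rw [h1 hy, h2, Pi.smul_apply, smul_eq_mul]

theorem IsContVersion.unique [μ.IsOpenPosMeasure] (h0 : μ E₁ᶜ = 0) (hg : IsContVersion E₁ u g)
    (hg' : IsContVersion E₁ u g') : g = g' := by
  funext x
  have h := forall_mem_of_ae h0 (hg.1.sub hg'.1) (isClosed_singleton (x := (0 : ℝ))) ?_ x
  · exact sub_eq_zero.1 h
  · filter_upwards [hg.2, hg'.2] with y h1 h2 hy
    exact sub_eq_zero.2 ((h1 hy).trans (h2 hy).symm)

end ContinuousVersion

/-! ### Point evaluations of the semigroup on `L^p` -/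

section PointFunctional

variable {E : Type*} [TopologicalSpace E] [MeasurableSpace E] {μ : Measure E} {E₁ : Set E}
  {p : ℝ≥0∞} [Fact (1 ≤ p)] {𝓔 : DirichletForm μ}

/-- `ℓ t x f` is the value at `x` of the continuous version of `T_t f`. -/
def IsPointFunctional (𝓔 : DirichletForm μ) (E₁ : Set E)
    (ℓ : ℝ≥0 → E₁ → Lp ℝ p μ →L[ℝ] ℝ) : Prop :=
  ∀ t > 0, ∀ f, IsContVersion E₁ (lrSemigroup 𝓔 p t f) (fun x => ℓ t x f)

/-- Analyticity puts `T_t f` into the domain of the generator with graph norm at most a multiple of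
`‖f‖`, so local continuity of the embedding bounds the evaluations. Linearity comes from uniqueness
of continuous versions. -/
theorem exists_isPointFunctional [μ.IsOpenPosMeasure] (hp1 : 1 < p) (hp : p ≠ ∞)
    (hcond : RegularityCondition 𝓔 p E₁) :
    ∃ ℓ : ℝ≥0 → E₁ → Lp ℝ p μ →L[ℝ] ℝ, IsPointFunctional 𝓔 E₁ ℓ := by
  have h0 := measure_eq_zero_of_cap_eq_zero hcond.cap_compl
  suffices h : ∀ t : ℝ≥0, ∃ ℓ : E₁ → Lp ℝ p μ →L[ℝ] ℝ, 0 < t →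
      ∀ f, IsContVersion E₁ (lrSemigroup 𝓔 p t f) (fun x => ℓ x f) by
    choose ℓ hℓ using h
    exact ⟨ℓ, hℓ⟩
  intro t
  rcases eq_zero_or_pos t with rfl | ht
  · exact ⟨0, fun h => absurd h (lt_irrefl _)⟩
  obtain ⟨C, hC⟩ := exists_isGeneratorAt (𝓔 := 𝓔) hp1 hp ht
  have hsg := (extendsL2Semigroup_lrSemigroup (𝓔 := 𝓔) hp1 hp).isContractionSemigroup hp1 hp
  have hver : ∀ f, ∃ g, IsContVersion E₁ (lrSemigroup 𝓔 p t f) g := fun f => by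
    obtain ⟨v, hv, -⟩ := hC f
    exact hcond.exists_version _ ⟨v, hv⟩
  choose g hg using hver
  let ℓ₀ : E₁ → Lp ℝ p μ →ₗ[ℝ] ℝ := fun x =>
    { toFun := fun f => g f x
      map_add' := fun f f' => by
        have h := (hg f).add (hg f')
        rw [← map_add] at h
        exact congrFun ((hg _).unique h0 h) x
      map_smul' := fun c f => by
        have h := (hg f).smul c
        rw [← map_smul] at h
        exact congrFun ((hg _).unique h0 h) x }
  have hbound : ∀ x, ∃ K : ℝ, ∀ f, ‖ℓ₀ x f‖ ≤ K * ‖f‖ := fun x => by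
    obtain ⟨U, hU, K, hK⟩ := hcond.locally_continuous x
    refine ⟨|K| * (1 + C), fun f => ?_⟩
    obtain ⟨v, hv, hvC⟩ := hC f
    refine (hK _ _ hv _ (hg f) x (mem_of_mem_nhds hU)).trans ?_
    rw [mul_assoc]
    refine (mul_le_mul_of_nonneg_right (le_abs_self K) (by positivity)).trans
      (mul_le_mul_of_nonneg_left ?_ (abs_nonneg K))
    rw [add_mul, one_mul]
    exact add_le_add (hsg.norm_apply_le t f) hvC
  choose K hK using hbound
  exact ⟨fun x => (ℓ₀ x).mkContinuous (K x) (hK x), fun _ => hg⟩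

variable {ℓ : ℝ≥0 → E₁ → Lp ℝ p μ →L[ℝ] ℝ} (hℓ : IsPointFunctional 𝓔 E₁ ℓ)
  (hp1 : 1 < p) (hp : p ≠ ∞) (h0 : μ E₁ᶜ = 0)

include hℓ hp1 hp h0

theorem IsPointFunctional.add_apply [μ.IsOpenPosMeasure] {t : ℝ≥0} (ht : 0 < t) (s : ℝ≥0) (x : E₁)
    (f : Lp ℝ p μ) : ℓ (t + s) x f = ℓ t x (lrSemigroup 𝓔 p s f) := by
  have hsg := (extendsL2Semigroup_lrSemigroup (𝓔 := 𝓔) hp1 hp).isContractionSemigroup hp1 hp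
  have h := hℓ t ht (lrSemigroup 𝓔 p s f)
  rw [← hsg.add_apply] at h
  exact congrFun ((hℓ _ (add_pos_of_pos_of_nonneg ht zero_le) f).unique h0 h) x

/-- The sub-Markov property on `L²` gives the inequalities almost everywhere; continuity on `E₁` and
full support give them at every point. -/
theorem IsPointFunctional.apply_indLp_mem [μ.IsOpenPosMeasure] {t : ℝ≥0} (ht : 0 < t) (x : E₁)
    {A : Set E} (hA : MeasurableSet A) (hμ : μ A ≠ ∞) :
    ℓ t x (indLp p μ A) ∈ Set.Icc (0 : ℝ) 1 := by
  have h := hℓ t ht (indLp p μ A)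
  refine forall_mem_of_ae h0 h.1 isClosed_Icc ?_ x
  have hmem : indLp 2 μ A ∈ unitOrderInterval μ := by
    filter_upwards [coeFn_indLp (p := 2) hA hμ] with y hy
    rw [hy]
    by_cases hyA : y ∈ A <;> simp [hyA]
  have hmemp : MemLp (indLp 2 μ A) p μ :=
    (Lp.memLp (indLp p μ A)).ae_eq ((coeFn_indLp hA hμ).trans (coeFn_indLp hA hμ).symm)
  have hext := extendsL2Semigroup_lrSemigroup (𝓔 := 𝓔) hp1 hp t ⟨_, hmemp⟩
  rw [interToLp_eq (g := indLp p μ A) ((coeFn_indLp hA hμ).trans (coeFn_indLp hA hμ).symm)] at hext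
  filter_upwards [h.2, hext, (isSymmSubMarkov_l2Semigroup 𝓔 t).mem _ hmem] with y h1 h2 h3 hy
  rw [h1 hy, h2]
  exact h3

theorem IsPointFunctional.continuousOn [μ.IsOpenPosMeasure] (x : E₁) (f : Lp ℝ p μ) :
    ContinuousOn (fun t => ℓ t x f) (Set.Ioi 0) := by
  have hsg := (extendsL2Semigroup_lrSemigroup (𝓔 := 𝓔) hp1 hp).isContractionSemigroup hp1 hp
  intro t ht
  obtain ⟨s, hs, hst⟩ := exists_between (Set.mem_Ioi.1 ht)
  -- With `0 < s < t` fixed, times near `t` are reached from `s`, and `ℓ s x` is composed with a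
  -- norm continuous orbit.
  have hc : Continuous fun t => ℓ s x (lrSemigroup 𝓔 p (t - s) f) :=
    (ℓ s x).continuous.comp ((hsg.continuous_orbit f).comp (continuous_id.sub continuous_const))
  refine (hc.continuousAt.congr ?_).continuousWithinAt
  filter_upwards [Ioi_mem_nhds hst] with r hr
  rw [← hℓ.add_apply hp1 hp h0 hs, add_tsub_cancel_of_le (le_of_lt hr)]

theorem IsPointFunctional.tendsto_add [μ.IsOpenPosMeasure] {s : ℝ≥0} (hs : 0 < s) (x : E₁)
    (f : Lp ℝ p μ) : Tendsto (fun t => ℓ (t + s) x f) (𝓝[>] 0) (𝓝 (ℓ s x f)) := by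
  have hsg := (extendsL2Semigroup_lrSemigroup (𝓔 := 𝓔) hp1 hp).isContractionSemigroup hp1 hp
  have h := ((ℓ s x).continuous.tendsto f).comp (hsg.continuous f)
  refine (h.mono_left nhdsWithin_le_nhds).congr fun t => ?_
  rw [Function.comp_apply, add_comm t, hℓ.add_apply hp1 hp h0 hs]

omit h0 in
theorem IsPointFunctional.tendsto_version (hcond : RegularityCondition 𝓔 p E₁) {u : Lp ℝ p μ}
    (hu : u ∈ generatorDomain (lrSemigroup 𝓔 p)) {g : E₁ → ℝ} (hg : IsContVersion E₁ u g) (x : E₁) :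
    Tendsto (fun t => ℓ t x u) (𝓝[>] 0) (𝓝 (g x)) := by
  have hsg := (extendsL2Semigroup_lrSemigroup (𝓔 := 𝓔) hp1 hp).isContractionSemigroup hp1 hp
  obtain ⟨v, hv⟩ := hu
  obtain ⟨U, hU, C, hC⟩ := hcond.locally_continuous x
  rw [tendsto_iff_norm_sub_tendsto_zero]
  set T := lrSemigroup 𝓔 p
  have h1 : ∀ w, Tendsto (fun t => ‖T t w - w‖) (𝓝[>] 0) (𝓝 0) := fun w =>
    tendsto_iff_norm_sub_tendsto_zero.1 ((hsg.continuous w).mono_left nhdsWithin_le_nhds)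
  have h2 : Tendsto (fun t => C * (‖T t u - u‖ + ‖T t v - v‖)) (𝓝[>] 0) (𝓝 0) := by
    simpa using ((h1 u).add (h1 v)).const_mul C
  refine squeeze_zero' (Eventually.of_forall fun t => norm_nonneg _) ?_ h2
  filter_upwards [self_mem_nhdsWithin] with t ht
  -- The generator commutes with the semigroup, so `T t u - u` tends to zero in the graph norm,
  -- which controls the value at `x`.
  exact hC _ _ ((hsg.isGeneratorAt_apply hv t).sub hv) _ ((hℓ t ht u).sub hg) x (mem_of_mem_nhds hU)

end PointFunctional

/-! ### Jointly measurable densities and determination of measures -/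

section Density

variable {X E : Type*} [MeasurableSpace X] [MeasurableSpace E] {μ : Measure E}

/-- A finite kernel whose measures are absolutely continuous has a jointly measurable density. -/
theorem exists_density [MeasurableSpace.CountablyGenerated E] [SigmaFinite μ] (κ : Kernel X E)
    [IsFiniteKernel κ] (hκ : ∀ x, κ x ≪ μ) :
    ∃ q : X → E → ℝ≥0, Measurable (Function.uncurry q) ∧
      ∀ x, κ x = μ.withDensity (fun y => (q x y : ℝ≥0∞)) := by
  -- The kernel derivative is taken with respect to a finite constant kernel, so `μ` is replaced by
  -- an equivalent finite measure.
  obtain ⟨ν, hν, hμν, hνμ⟩ := exists_isFiniteMeasure_absolutelyContinuous μ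
  set η : Kernel X E := Kernel.const X ν
  have hη : ∀ x, κ x ≪ η x := fun x => (hκ x).trans hμν
  refine ⟨fun x y => (ν.rnDeriv μ y).toNNReal * (κ.rnDeriv η x y).toNNReal,
    ((Measure.measurable_rnDeriv ν μ).comp measurable_snd).ennreal_toNNReal.mul
      (Kernel.measurable_rnDeriv κ η).ennreal_toNNReal, fun x => ?_⟩
  have h1 : κ x = ν.withDensity (κ.rnDeriv η x) := by
    conv_lhs => rw [← Kernel.withDensity_rnDeriv_eq (hη x)]
    rw [Kernel.withDensity_apply _ (Kernel.measurable_rnDeriv κ η), Kernel.const_apply]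
  conv_lhs => rw [h1, ← Measure.withDensity_rnDeriv_eq ν μ hνμ]
  rw [← withDensity_mul _ (Measure.measurable_rnDeriv ν μ) (Kernel.measurable_rnDeriv_right κ η x)]
  refine withDensity_congr_ae ?_
  have h2 : ∀ᵐ y ∂μ, κ.rnDeriv η x y < ∞ := hμν (Kernel.rnDeriv_lt_top κ η (a := x))
  filter_upwards [h2, Measure.rnDeriv_lt_top ν μ] with y h3 h4
  rw [Pi.mul_apply, ENNReal.coe_mul, ENNReal.coe_toNNReal h4.ne, ENNReal.coe_toNNReal h3.ne]

theorem apply_eq_iSup_spanningSets [SigmaFinite μ] (ν : Measure E) (A : Set E) :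
    ν A = ⨆ n, ν (A ∩ spanningSets μ n) := by
  rw [← Monotone.measure_iUnion fun m n hmn => Set.inter_subset_inter_right _
    (monotone_spanningSets μ hmn), ← Set.inter_iUnion, iUnion_spanningSets, Set.inter_univ]

theorem ext_of_forall_ne_top [SigmaFinite μ] {ν ν' : Measure E}
    (h : ∀ A, MeasurableSet A → μ A ≠ ∞ → ν A = ν' A) : ν = ν' := by
  refine Measure.ext fun A hA => ?_
  rw [apply_eq_iSup_spanningSets (μ := μ) ν, apply_eq_iSup_spanningSets (μ := μ) ν']
  exact iSup_congr fun n => h _ (hA.inter (measurableSet_spanningSets μ n))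
    (measure_ne_top_of_subset Set.inter_subset_right (measure_spanningSets_lt_top μ n).ne)

theorem memLp_indicator_one {p : ℝ≥0∞} {A : Set E} (hA : MeasurableSet A) (hμ : μ A ≠ ∞) :
    MemLp (A.indicator (1 : E → ℝ)) p μ :=
  memLp_indicator_const p hA 1 (Or.inr hμ)

/-- A measure is determined by the integrals of the functions in `L^p`. -/
theorem ext_of_forall_integral [SigmaFinite μ] {p : ℝ≥0∞} {ν ν' : Measure E} [IsFiniteMeasure ν']
    (h : ∀ f : E → ℝ, Measurable f → MemLp f p μ →
      Integrable f ν ∧ ∫ y, f y ∂ν = ∫ y, f y ∂ν') : ν = ν' := by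
  refine ext_of_forall_ne_top (μ := μ) fun A hA hμ => ?_
  obtain ⟨h1, h2⟩ := h _ (measurable_one.indicator hA) (memLp_indicator_one hA hμ)
  rw [integral_indicator_one hA, integral_indicator_one hA] at h2
  -- The real-valued measure does not distinguish `∞` from `0`; finiteness must come from
  -- integrability of the indicator.
  have h3 : ν A ≠ ∞ := by
    have h4 := h1.2
    rw [hasFiniteIntegral_iff_enorm] at h4
    refine ((lintegral_indicator_one hA).symm.trans_le (lintegral_mono fun y => ?_)).trans_lt h4 |>.ne
    by_cases hy : y ∈ A <;> simp [hy]
  exact (measureReal_eq_measureReal_iff h3 (measure_ne_top _ _)).1 h2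

end Density

/-! ### The kernels: Chapman–Kolmogorov and measurability -/

section PointKernel

variable {E : Type*} [MeasurableSpace E] {μ : Measure E} {E₁ : Set E}
  {p : ℝ≥0∞} [Fact (1 ≤ p)]

/-- `P` is a family of sub-Markovian kernels, absolutely continuous for `t > 0`, that represents
the functionals `ℓ`. -/
structure IsPointKernel (ℓ : ℝ≥0 → E₁ → Lp ℝ p μ →L[ℝ] ℝ) (P : ℝ≥0 → Kernel E₁ E) : Prop where
  zero : ∀ x : E₁, P 0 x = Measure.dirac (x : E)
  le_one : ∀ t x, P t x Set.univ ≤ 1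
  absolutelyContinuous : ∀ t > 0, ∀ x, P t x ≪ μ
  integrable : ∀ t > 0, ∀ x, ∀ f : E → ℝ, MemLp f p μ → Integrable f (P t x)
  integral : ∀ t > 0, ∀ x, ∀ (f : E → ℝ) (hf : MemLp f p μ), ∫ y, f y ∂(P t x) = ℓ t x (hf.toLp f)

variable {ℓ : ℝ≥0 → E₁ → Lp ℝ p μ →L[ℝ] ℝ} {P : ℝ≥0 → Kernel E₁ E}

theorem IsPointKernel.isFiniteKernel (hP : IsPointKernel ℓ P) (t : ℝ≥0) : IsFiniteKernel (P t) :=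
  ⟨1, ENNReal.one_lt_top, hP.le_one t⟩

theorem IsPointKernel.apply_compl (hP : IsPointKernel ℓ P) (hE₁ : MeasurableSet E₁)
    (h0 : μ E₁ᶜ = 0) (t : ℝ≥0) (x : E₁) : P t x E₁ᶜ = 0 := by
  rcases eq_zero_or_pos t with rfl | ht
  · rw [hP.zero, Measure.dirac_apply' _ hE₁.compl]
    simp
  · exact hP.absolutelyContinuous t ht x h0

theorem integrable_comap_and_integral {ν : Measure E} (hE₁ : MeasurableSet E₁) (h0 : ν E₁ᶜ = 0)
    {F : E₁ → ℝ} {G : E → ℝ} (hG : Integrable G ν)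
    (hFG : ∀ᵐ y ∂ν, ∀ hy : y ∈ E₁, F ⟨y, hy⟩ = G y) :
    Integrable F (ν.comap Subtype.val) ∧
      ∫ y, F y ∂(ν.comap Subtype.val) = ∫ y, G y ∂ν := by
  have hae : F =ᵐ[ν.comap Subtype.val] fun y : E₁ => G y := by
    have h1 := ae_restrict_of_ae (s := E₁) hFG
    rw [← map_comap_subtype_coe hE₁] at h1
    filter_upwards [ae_of_ae_map measurable_subtype_coe.aemeasurable h1] with y hy
    exact hy y.2
  have hr : ν.restrict E₁ = ν := Measure.restrict_eq_self_of_ae_mem (by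
    rw [ae_iff]; exact h0)
  refine ⟨Integrable.congr ?_ hae.symm, ?_⟩
  · rw [← integrableOn_univ]
    exact ((MeasurableEmbedding.subtype_coe hE₁).integrable_map_iff.1
      (by rw [map_comap_subtype_coe hE₁, hr]; exact hG)).integrableOn
  · rw [integral_congr_ae hae, integral_subtype_comap hE₁, hr]

theorem onSubset_comp (hE₁ : MeasurableSet E₁) (κ η : Kernel E₁ E) :
    onSubset hE₁ (κ ∘ₖ onSubset hE₁ η) = onSubset hE₁ κ ∘ₖ onSubset hE₁ η := by
  refine Kernel.ext fun x => Measure.ext fun A hA => ?_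
  have hA' : MeasurableSet (Subtype.val '' A : Set E) :=
    (MeasurableEmbedding.subtype_coe hE₁).measurableSet_image.2 hA
  rw [onSubset, Kernel.comapRight_apply' _ _ _ hA, Kernel.comp_apply' _ _ _ hA',
    Kernel.comp_apply' _ _ _ hA]
  exact lintegral_congr fun y => (Kernel.comapRight_apply' _ _ _ hA).symm

variable [TopologicalSpace E] {𝓔 : DirichletForm μ}

theorem IsPointFunctional.exists_isPointKernel [BorelSpace E] [SigmaFinite μ]
    [μ.IsOpenPosMeasure] (hℓ : IsPointFunctional 𝓔 E₁ ℓ) (hp1 : 1 < p) (hp : p ≠ ∞)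
    (h0 : μ E₁ᶜ = 0) : ∃ P, IsPointKernel ℓ P := by
  have hmem : ∀ t : ℝ≥0, 0 < t → ∀ x A, MeasurableSet A → μ A ≠ ∞ →
      ℓ t x (indLp p μ A) ∈ Set.Icc (0 : ℝ) 1 := fun t ht x A hA hμ =>
    hℓ.apply_indLp_mem hp1 hp h0 ht x hA hμ
  have hν : ∀ t : ℝ≥0, ∀ x : E₁, ∃ ν : Measure E, 0 < t →
      ∀ A, MeasurableSet A → μ A ≠ ∞ → ν A = ENNReal.ofReal (ℓ t x (indLp p μ A)) := fun t x => by
    rcases eq_zero_or_pos t with rfl | ht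
    · exact ⟨0, fun h => absurd h (lt_irrefl _)⟩
    · obtain ⟨ν, hν⟩ := exists_measure_of_nonneg hp fun A hA hμ => (hmem t ht x A hA hμ).1
      exact ⟨ν, fun _ => hν⟩
  choose ν hν using hν
  have hle : ∀ t : ℝ≥0, 0 < t → ∀ x, ν t x Set.univ ≤ 1 := fun t ht x =>
    measure_univ_le_one (fun A hA hμ => (hmem t ht x A hA hμ).2) (hν t x ht)
  have hmeas : ∀ t : ℝ≥0, 0 < t → Measurable (ν t) := fun t ht => by
    refine Measure.measurable_of_measurable_coe _ fun A hA => ?_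
    -- For sets of finite `μ`-measure the value is a continuous function of `x`; the general case is
    -- a countable supremum of these.
    simp only [fun x => apply_eq_iSup_spanningSets (μ := μ) (ν t x) A]
    refine Measurable.iSup fun n => ?_
    have hm := hA.inter (measurableSet_spanningSets μ n)
    have hfin := measure_ne_top_of_subset (μ := μ) (Set.inter_subset_right (s := A))
      (measure_spanningSets_lt_top μ n).ne
    simp only [fun x => hν t x ht _ hm hfin]
    exact (hℓ t ht _).1.measurable.ennreal_ofReal
  classical
  -- At time zero the functionals carry no information, and the kernel is prescribed to be the Dirac
  -- kernel.
  let P : ℝ≥0 → Kernel E₁ E := fun t =>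
    if ht : 0 < t then ⟨ν t, hmeas t ht⟩ else Kernel.deterministic Subtype.val measurable_subtype_coe
  have hP0 : ∀ x, P 0 x = Measure.dirac (x : E) := fun x => by
    simp only [P, lt_irrefl, dif_neg, not_false_iff, Kernel.deterministic_apply]
  have hP : ∀ t : ℝ≥0, 0 < t → ∀ x, P t x = ν t x := fun t ht x => by
    simp only [P, dif_pos ht]
    rfl
  have hfin : ∀ t : ℝ≥0, 0 < t → ∀ x, IsFiniteMeasure (ν t x) := fun t ht x =>
    ⟨(hle t ht x).trans_lt ENNReal.one_lt_top⟩
  refine ⟨P, hP0, fun t x => ?_, fun t ht x => ?_, fun t ht x f hf => ?_, fun t ht x f hf => ?_⟩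
  · rcases eq_zero_or_pos t with rfl | ht
    · rw [hP0, measure_univ]
    · rw [hP t ht]
      exact hle t ht x
  · rw [hP t ht]
    exact absolutelyContinuous_of_apply_indLp (hν t x ht)
  · rw [hP t ht]
    have := hfin t ht x
    exact integrable_of_memLp hp (fun A hA hμ => (hmem t ht x A hA hμ).1) (hν t x ht) hf
  · rw [hP t ht]
    have := hfin t ht x
    exact integral_eq_apply hp (fun A hA hμ => (hmem t ht x A hA hμ).1) (hν t x ht) hf

theorem IsPointKernel.isContVersion (hP : IsPointKernel ℓ P) (hℓ : IsPointFunctional 𝓔 E₁ ℓ)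
    {t : ℝ≥0} (ht : 0 < t) {f : E → ℝ} (hf : MemLp f p μ) :
    IsContVersion E₁ (lrSemigroup 𝓔 p t (hf.toLp f)) (fun x => ∫ y, f y ∂(P t x)) := by
  simp only [fun x => hP.integral t ht x f hf]
  exact hℓ t ht _

/-- At `s = 0` an arbitrary `f ∈ L^p` has only an almost everywhere identity to offer. This suffices
for integration against `P t x` with `t > 0`, which is absolutely continuous. -/
theorem IsPointKernel.ae_integral_eq [MeasurableSingletonClass E] (hP : IsPointKernel ℓ P)
    (hℓ : IsPointFunctional 𝓔 E₁ ℓ) (hp1 : 1 < p) (hp : p ≠ ∞) (s : ℝ≥0) {f : E → ℝ}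
    (hf : MemLp f p μ) :
    ∀ᵐ y ∂μ, ∀ hy : y ∈ E₁, ∫ z, f z ∂(P s ⟨y, hy⟩) = lrSemigroup 𝓔 p s (hf.toLp f) y := by
  rcases eq_zero_or_pos s with rfl | hs
  · have hsg := (extendsL2Semigroup_lrSemigroup (𝓔 := 𝓔) hp1 hp).isContractionSemigroup hp1 hp
    filter_upwards [hf.coeFn_toLp] with y hy hyE
    rw [hP.zero, integral_dirac, hsg.zero_apply, hy]
  · exact (hP.isContVersion hℓ hs hf).2

/-- The Chapman–Kolmogorov equation, tested on functions in `L^p`. -/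
theorem IsPointKernel.chapman_kolmogorov [MeasurableSingletonClass E] [μ.IsOpenPosMeasure]
    (hP : IsPointKernel ℓ P) (hℓ : IsPointFunctional 𝓔 E₁ ℓ) (hp1 : 1 < p) (hp : p ≠ ∞)
    (hE₁ : MeasurableSet E₁) (h0 : μ E₁ᶜ = 0) (s t : ℝ≥0) {f : E → ℝ} (hf : MemLp f p μ) (x : E₁) :
    Integrable (fun y : E₁ => ∫ z, f z ∂(P s y)) (onSubset hE₁ (P t) x) ∧
      ∫ z, f z ∂(P (t + s) x) =
        ∫ y : E₁, (∫ z, f z ∂(P s y)) ∂(onSubset hE₁ (P t) x) := by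
  rw [onSubset, Kernel.comapRight_apply]
  rcases eq_zero_or_pos t with rfl | ht
  · have hd : Measure.comap Subtype.val (P 0 x) = Measure.dirac x := by
      have h := MeasurableEmbedding.comap_map (MeasurableEmbedding.subtype_coe hE₁) (Measure.dirac x)
      rwa [Measure.map_dirac, ← hP.zero] at h
    rw [hd, zero_add, integral_dirac]
    exact ⟨integrable_dirac (by simp), rfl⟩
  · have h1 := integrable_comap_and_integral (F := fun y => ∫ z, f z ∂(P s y)) hE₁ (hP.apply_compl hE₁ h0 t x)
      (hP.integrable t ht x _ (Lp.memLp (lrSemigroup 𝓔 p s (hf.toLp f))))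
      ((hP.ae_integral_eq hℓ hp1 hp s hf).filter_mono (hP.absolutelyContinuous t ht x).ae_le)
    refine ⟨h1.1, ?_⟩
    -- The inner integral is a version of `T_s f`, so the outer one is `ℓ t x (T_s f) = ℓ (t + s) x
    -- f`.
    rw [h1.2, hP.integral t ht x _ (Lp.memLp _), Lp.toLp_coeFn, ← hℓ.add_apply hp1 hp h0 ht,
      hP.integral _ (add_pos_of_pos_of_nonneg ht zero_le)]

theorem IsPointKernel.comp_eq [MeasurableSingletonClass E] [SigmaFinite μ] [μ.IsOpenPosMeasure]
    (hP : IsPointKernel ℓ P) (hℓ : IsPointFunctional 𝓔 E₁ ℓ) (hp1 : 1 < p) (hp : p ≠ ∞)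
    (hE₁ : MeasurableSet E₁) (h0 : μ E₁ᶜ = 0) (s t : ℝ≥0) :
    P (t + s) = P s ∘ₖ onSubset hE₁ (P t) := by
  refine Kernel.ext fun x => ext_of_forall_ne_top (μ := μ) fun A hA hμ => ?_
  have hfin := hP.isFiniteKernel
  obtain ⟨h1, h2⟩ := hP.chapman_kolmogorov hℓ hp1 hp hE₁ h0 s t
    (memLp_indicator_one (p := p) hA hμ) x
  simp only [integral_indicator_one hA] at h1 h2
  rw [Kernel.comp_apply' _ _ _ hA, ← ENNReal.ofReal_toReal (measure_ne_top (P (t + s) x) A)]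
  rw [Measure.real] at h2
  rw [h2, ofReal_integral_eq_lintegral_ofReal h1 (Eventually.of_forall fun y => measureReal_nonneg)]
  exact lintegral_congr fun y => ENNReal.ofReal_toReal (measure_ne_top _ _)

/-- For `t > 0` the integral is continuous in each variable separately, hence jointly measurable.
Continuity may fail at `t = 0`, so times are cut off below at `1 / (n + 1)` and the value at zero is
inserted by hand; at each point the resulting sequence is eventually constant. -/
theorem IsPointKernel.measurable_of_memLp [BorelSpace E] [MeasurableSingletonClass E]
    [SecondCountableTopology E] [μ.IsOpenPosMeasure] (hP : IsPointKernel ℓ P)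
    (hℓ : IsPointFunctional 𝓔 E₁ ℓ) (hp1 : 1 < p) (hp : p ≠ ∞) (h0 : μ E₁ᶜ = 0) {f : E → ℝ}
    (hfm : Measurable f) (hf : MemLp f p μ) :
    Measurable fun z : ℝ≥0 × E₁ => ∫ y, f y ∂(P z.1 z.2) := by
  have hpos : ∀ (n : ℕ) (t : ℝ≥0), 0 < max t (1 / ((n : ℝ≥0) + 1)) := fun n t =>
    lt_max_of_lt_right (by positivity)
  have hmeas : ∀ n : ℕ, Measurable fun z : ℝ≥0 × E₁ =>
      if z.1 = 0 then f z.2 else ℓ (max z.1 (1 / ((n : ℝ≥0) + 1))) z.2 (hf.toLp f) := fun n => by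
    refine Measurable.ite (measurable_fst (measurableSet_singleton 0))
      (hfm.comp (measurable_subtype_coe.comp measurable_snd)) ?_
    refine measurable_uncurry_of_continuous_of_measurable
      (u := fun (t : ℝ≥0) (x : E₁) => ℓ (max t (1 / ((n : ℝ≥0) + 1))) x (hf.toLp f))
      (fun x => ?_) fun t => (hℓ _ (hpos n t) _).1.measurable
    exact (hℓ.continuousOn hp1 hp h0 x _).comp_continuous (by fun_prop) (hpos n)
  refine measurable_of_tendsto_metrizable hmeas (tendsto_pi_nhds.2 fun z => ?_)
  obtain ⟨t, x⟩ := z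
  rcases eq_zero_or_pos t with rfl | ht
  · simp only [if_true, hP.zero, integral_dirac]
    exact tendsto_const_nhds
  · refine tendsto_const_nhds.congr' ?_
    have hlim : Tendsto (fun n : ℕ => 1 / ((n : ℝ≥0) + 1)) atTop (𝓝 0) :=
      tendsto_one_div_add_atTop_nhds_zero_nat
    filter_upwards [hlim.eventually (gt_mem_nhds ht)] with n hn
    simp only [if_neg ht.ne', max_eq_left hn.le]
    exact hP.integral t ht x f hf

theorem IsPointKernel.measurable_of_bounded [BorelSpace E] [MeasurableSingletonClass E]
    [SecondCountableTopology E] [SigmaFinite μ] [μ.IsOpenPosMeasure] (hP : IsPointKernel ℓ P)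
    (hℓ : IsPointFunctional 𝓔 E₁ ℓ) (hp1 : 1 < p) (hp : p ≠ ∞) (h0 : μ E₁ᶜ = 0) {f : E → ℝ}
    (hfm : Measurable f) {C : ℝ} (hC : ∀ y, |f y| ≤ C) :
    Measurable fun z : ℝ≥0 × E₁ => ∫ y, f y ∂(P z.1 z.2) := by
  have hfin := hP.isFiniteKernel
  have hm : ∀ n, Measurable ((spanningSets μ n).indicator f) := fun n =>
    hfm.indicator (measurableSet_spanningSets μ n)
  have hb : ∀ n y, ‖(spanningSets μ n).indicator f y‖ ≤ C := fun n y =>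
    (norm_indicator_le_norm_self f y).trans (hC y)
  -- A bounded function need not lie in `L^p`; its truncations to sets of finite measure do, and
  -- dominated convergence applies because the kernels are finite.
  refine measurable_of_tendsto_metrizable
    (f := fun n (z : ℝ≥0 × E₁) => ∫ y, (spanningSets μ n).indicator f y ∂(P z.1 z.2))
    (fun n => hP.measurable_of_memLp hℓ hp1 hp h0 (hm n) ?_) (tendsto_pi_nhds.2 fun z => ?_)
  · have h1 : MemLp ((spanningSets μ n).indicator fun _ => C) p μ :=
      memLp_indicator_const p (measurableSet_spanningSets μ n) C
        (Or.inr (measure_spanningSets_lt_top μ n).ne)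
    refine h1.mono (hm n).aestronglyMeasurable (Eventually.of_forall fun y => ?_)
    by_cases hy : y ∈ spanningSets μ n
    · simp only [Set.indicator_of_mem hy]
      exact (hC y).trans (le_abs_self C)
    · simp [hy]
  · refine tendsto_integral_of_dominated_convergence (fun _ => C)
      (fun n => (hm n).aestronglyMeasurable) (integrable_const C)
      (fun n => Eventually.of_forall (hb n)) (Eventually.of_forall fun y => ?_)
    refine tendsto_const_nhds.congr' ?_
    filter_upwards [eventually_mem_spanningSets μ y] with n hn
    exact (Set.indicator_of_mem hn f).symm

end PointKernel

end FellerKernel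

end

/-! ### Assembly of the kernel family -/

theorem mainTheorem8 {E : Type*} [MetricSpace E] [LocallyCompactSpace E]
    [TopologicalSpace.SeparableSpace E] [MeasurableSpace E] [BorelSpace E]
    (μ : Measure E) [IsLocallyFiniteMeasure μ] [μ.IsOpenPosMeasure]
    (𝓔 : FellerKernel.DirichletForm μ) (hreg : 𝓔.IsRegular) (hloc : 𝓔.IsStronglyLocal)
    (p : ℝ≥0∞) [Fact (1 ≤ p)] (hp : 1 < p) (hp' : p ≠ ∞)
    (E₁ : Set E) (hE₁ : MeasurableSet E₁)
    (hcond : FellerKernel.RegularityCondition 𝓔 p E₁) :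
    ∃ P : ℝ≥0 → Kernel E₁ E,
      -- normalization at time zero
      (∀ x : E₁, P 0 x = Measure.dirac (x : E)) ∧
      -- (i) the kernels are sub-Markovian, have densities, do not charge the complement of `E₁`
      (∀ t, ∀ x : E₁, P t x Set.univ ≤ 1) ∧
      (∀ t > 0, ∃ q : E₁ → E → ℝ≥0, Measurable (Function.uncurry q) ∧
        ∀ x : E₁, P t x = μ.withDensity (fun y => (q x y : ℝ≥0∞))) ∧
      (∀ t, ∀ x : E₁, P t x E₁ᶜ = 0) ∧
      -- and `P_t f` is the unique continuous version of `T_t f`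
      (∀ t > 0, ∀ (f : E → ℝ) (hf : MemLp f p μ),
        (∀ x : E₁, Integrable f (P t x)) ∧
        FellerKernel.IsContVersion E₁ (FellerKernel.lrSemigroup 𝓔 p t (hf.toLp f))
          (fun x => ∫ y, f y ∂(P t x)) ∧
        ∀ g, FellerKernel.IsContVersion E₁ (FellerKernel.lrSemigroup 𝓔 p t (hf.toLp f)) g →
          g = fun x => ∫ y, f y ∂(P t x)) ∧
      -- which determines the measures `P_t(x, ·)`
      (∀ t > 0, ∀ (x : E₁) (ν : Measure E),
        (∀ f : E → ℝ, Measurable f → MemLp f p μ →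
          Integrable f ν ∧ ∫ y, f y ∂ν = ∫ y, f y ∂(P t x)) → ν = P t x) ∧
      -- (ii) semigroup of kernels on `E₁`, strong Feller on `L^p`
      (∀ s t, FellerKernel.onSubset hE₁ (P (t + s)) =
        FellerKernel.onSubset hE₁ (P s) ∘ₖ FellerKernel.onSubset hE₁ (P t)) ∧
      (∀ t > 0, ∀ f : E → ℝ, MemLp f p μ → Continuous fun x : E₁ => ∫ y, f y ∂(P t x)) ∧
      (∀ s t, ∀ f : E → ℝ, MemLp f p μ → ∀ x : E₁,
        Integrable (fun y : E₁ => ∫ z, f z ∂(P s y)) (FellerKernel.onSubset hE₁ (P t) x) ∧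
        ∫ z, f z ∂(P (t + s) x) =
          ∫ y : E₁, (∫ z, f z ∂(P s y)) ∂(FellerKernel.onSubset hE₁ (P t) x)) ∧
      -- (iii) pointwise right continuity in time
      (∀ s > 0, ∀ f : E → ℝ, MemLp f p μ → ∀ x : E₁,
        Tendsto (fun t => ∫ y, f y ∂(P (t + s) x)) (𝓝[>] 0) (𝓝 (∫ y, f y ∂(P s x)))) ∧
      (∀ u ∈ FellerKernel.generatorDomain (FellerKernel.lrSemigroup 𝓔 p),
        ∀ g, FellerKernel.IsContVersion E₁ u g → ∀ x : E₁,
          Tendsto (fun t => ∫ y, u y ∂(P t x)) (𝓝[>] 0) (𝓝 (g x))) ∧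
      -- (iv) joint measurability in time and space
      (∀ f : E → ℝ, Measurable f → ((∃ C : ℝ, ∀ y, |f y| ≤ C) ∨ MemLp f p μ) →
        Measurable fun z : ℝ≥0 × E₁ => ∫ y, f y ∂(P z.1 z.2)) := by
  -- Second countability makes the locally finite measure `μ` σ-finite and the Borel σ-algebra
  -- countably generated, as the construction of measures and densities requires.
  have : SecondCountableTopology E := UniformSpace.secondCountable_of_separable E
  have h0 : μ E₁ᶜ = 0 := FellerKernel.measure_eq_zero_of_cap_eq_zero hcond.cap_compl
  obtain ⟨ℓ, hℓ⟩ := FellerKernel.exists_isPointFunctional hp hp' hcond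
  obtain ⟨P, hP⟩ := hℓ.exists_isPointKernel hp hp' h0
  have hfin := hP.isFiniteKernel
  refine ⟨P, hP.zero, hP.le_one,
    fun t ht => FellerKernel.exists_density (P t) (hP.absolutelyContinuous t ht),
    hP.apply_compl hE₁ h0,
    fun t ht f hf => ⟨fun x => hP.integrable t ht x f hf, hP.isContVersion hℓ ht hf,
      fun g hg => hg.unique h0 (hP.isContVersion hℓ ht hf)⟩,
    fun t ht x ν hν => FellerKernel.ext_of_forall_integral hν,
    fun s t => by rw [hP.comp_eq hℓ hp hp' hE₁ h0, FellerKernel.onSubset_comp],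
    fun t ht f hf => (hP.isContVersion hℓ ht hf).1,
    fun s t f hf x => hP.chapman_kolmogorov hℓ hp hp' hE₁ h0 s t hf x,
    fun s hs f hf x => ?_, fun u hu g hg x => ?_, fun f hfm hf => ?_⟩
  · rw [hP.integral s hs x f hf]
    refine (hℓ.tendsto_add hp hp' h0 hs x (hf.toLp f)).congr fun t => ?_
    rw [hP.integral _ (add_pos_of_nonneg_of_pos zero_le hs)]
  · refine (hℓ.tendsto_version hp hp' hcond hu hg x).congr' ?_
    filter_upwards [self_mem_nhdsWithin] with t ht
    rw [hP.integral t ht x _ (Lp.memLp u), Lp.toLp_coeFn]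
  · rcases hf with ⟨C, hC⟩ | hf
    · exact hP.measurable_of_bounded hℓ hp hp' h0 hfm hC
    · exact hP.measurable_of_memLp hℓ hp hp' h0 hfm hf
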